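/- Let $d\ge 1$ and let $\alpha=(\alpha_1,\dots,\alpha_d)$, $\beta=(\beta_1,\dots,\beta_d)\in\mathbb{R}^d$ with $\alpha_j,\beta_j\ge -1/2$ for all $j$. Let $\tilde P_n^{(a,b)}$ denote the Jacobi polynomial of degree $n$ with parameters $a,b$, normalized in $L^2([-1,1],(1-t)^a(1+t)^b\,dt)$, and for $\nu\in\mathbb{N}_0^d$, $x\in[-1,1]^d$ put $\tilde P_\nu(x)=\prod_{j=1}^d\tilde P_{\nu_j}^{(\alpha_j,\beta_j)}(x_j)$. For a function $\hat A:[0,\infty)^d\to\mathbb{C}$ supported in $[0,2]^d$, an integer $n\ge 1$, and $x,y\in[-1,1]^d$ set $$\Lambda_n(x,y)=\sum_{\nu\in\mathbb{N}_0^d}\hat A\Big(\frac{\nu}{n}\Big)\tilde P_\nu(x)\tilde P_\nu(y),$$ $$W(n;x)=\prod_{j=1}^d(1-x_j+n^{-2})^{\alpha_j+1/2}(1+x_j+n^{-2})^{\beta_j+1/2},\qquad \rho(x,y)=\max_{1\le j\le d}|\arccos x_j-\arccos y_j|.$$ Write $D_\ell$ for the partial derivative with respect to $t_\ell$ (one-sided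 where $t_\ell=0$) and $\|\cdot\|_\infty$ for the supremum norm on $[0,\infty)^d$. (i) Let $k\ge 1$ be an integer. Suppose that $\hat A\in C^{3k-1}([0,\infty)^d)$, that $\operatorname{supp}\hat A\subset[0,2]^d$, and that for every $1\le\ell\le d$ and every $t\in[0,2]^d$ with $t_\ell=0$ we have $D_\ell^m\hat A(t)=0$ for $m=1,2,\dots,3k-1$. Then $$|\Lambda_n(x,y)|\le \frac{c\,n^d}{\sqrt{W(n;x)}\sqrt{W(n;y)}}\,\big(1+n\rho(x,y)\big)^{-k},\qquad x,y\in[-1,1]^d,\ n\ge 1,$$ where the constant $c>0$ depends only on $k$, $d$, $\alpha$, $\beta$ and upper bounds for $\|D_\ell^{3k-1}\hat A\|_\infty$, $\ell=1,\dots,d$, but not on $x$, $y$ and $n$. (ii) Consequently, if $\hat A$ is admissible, i.e. $\hat A\in C^\infty([0,\infty)^d)$, $\operatorname{supp}\hat A\subset[0,2]^d$, and for every $\ell$ and every $t\in[0,\infty)^d$ with $t_\ell=0$ we have $D_\ell^m\hat A(t)=0$ for all $m\ge 1$, then for every real $k>0$ the same estimate holds with a constant $c>0$ independent of $x$, $y$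 and $n$. -/

import Mathlib

open scoped ContDiff

noncomputable section

namespace TensorJacobi

/-- The Jacobi polynomial `P_n^{(α,β)}`, with the classical normalization
`P_n^{(α,β)}(1) = binom (n+α) n`, as
`∑_{s ≤ n} binom (n+α) (n-s) * binom (n+β) s * ((x-1)/2)^s * ((x+1)/2)^(n-s)`. -/
def jacobiP (α β : ℝ) (n : ℕ) (x : ℝ) : ℝ :=
  ∑ s ∈ Finset.range (n + 1),
    Ring.choose ((n : ℝ) + α) (n - s) * Ring.choose ((n : ℝ) + β) s *
      ((x - 1) / 2) ^ s * ((x + 1) / 2) ^ (n - s)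

/-- The univariate Jacobi weight `(1-t)^α (1+t)^β` on `[-1,1]`. -/
def jacobiWeight (α β t : ℝ) : ℝ := (1 - t) ^ α * (1 + t) ^ β

/-- The squared norm of `P_n^{(α,β)}` in `L²([-1,1], (1-t)^α (1+t)^β)`. -/
def jacobiNormSq (α β : ℝ) (n : ℕ) : ℝ :=
  ∫ t in (-1 : ℝ)..1, jacobiP α β n t ^ 2 * jacobiWeight α β t

/-- The `L²`-normalized Jacobi polynomial. -/
def jacobiPn (α β : ℝ) (n : ℕ) (x : ℝ) : ℝ :=
  (Real.sqrt (jacobiNormSq α β n))⁻¹ * jacobiP α β n x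

/-- The tensor product `L²`-normalized Jacobi polynomial. -/
def tensorJacobi {d : ℕ} (α β : Fin d → ℝ) (ν : Fin d → ℕ) (x : Fin d → ℝ) : ℝ :=
  ∏ j, jacobiPn (α j) (β j) (ν j) (x j)

/-- The kernel `Λ_n(x,y) = ∑_ν A(ν/n) P̃_ν(x) P̃_ν(y)`. For `n ≥ 1` and `A` compactly supported
the sum has finitely many nonzero terms. -/
def kernel {d : ℕ} (α β : Fin d → ℝ) (A : (Fin d → ℝ) → ℂ) (n : ℕ) (x y : Fin d → ℝ) : ℂ :=
  ∑' ν : Fin d → ℕ,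
    A (fun j => (ν j : ℝ) / n) * (tensorJacobi α β ν x : ℂ) * (tensorJacobi α β ν y : ℂ)

/-- The weight `W_{α,β}(n;x)`, for `n ≥ 1`. -/
def bigW {d : ℕ} (α β : Fin d → ℝ) (n : ℕ) (x : Fin d → ℝ) : ℝ :=
  ∏ j, (1 - x j + ((n : ℝ) ^ 2)⁻¹) ^ (α j + 1 / 2) * (1 + x j + ((n : ℝ) ^ 2)⁻¹) ^ (β j + 1 / 2)

/-- The distance `max_j |arccos x_j - arccos y_j|` on `[-1,1]^d`, `d ≥ 1`. -/
def rho {d : ℕ} (x y : Fin d → ℝ) : ℝ :=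
  ⨆ j, |Real.arccos (x j) - Real.arccos (y j)|

/-- The closed orthant `[0,∞)^d`. -/
def orthant (d : ℕ) : Set (Fin d → ℝ) := {t | ∀ j, 0 ≤ t j}

/-- The partial derivative `D_ℓ^m A(t)` of a function on `[0,∞)^d`, one-sided where `t_ℓ = 0`. -/
def partialD {d : ℕ} (ℓ : Fin d) (m : ℕ) (A : (Fin d → ℝ) → ℂ) (t : Fin d → ℝ) : ℂ :=
  iteratedDerivWithin m (fun s => A (Function.update t ℓ s)) (Set.Ici 0) (t ℓ)

/-- `A`, as a function on `[0,∞)^d`, is supported in `[0,2]^d`. -/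
def SuppInCube {d : ℕ} (A : (Fin d → ℝ) → ℂ) : Prop :=
  ∀ t ∈ orthant d, A t ≠ 0 → ∀ j, t j ≤ 2

/-- `A` is of class `C^{3k-1}` on `[0,∞)^d`, supported in `[0,2]^d`, and for every `ℓ` the
derivatives `D_ℓ^m A`, `1 ≤ m ≤ 3k-1`, vanish on the part of `{t_ℓ = 0}` in `[0,2]^d`. Only the
values of `A` on `[0,∞)^d` matter. -/
structure IsCutoff {d : ℕ} (k : ℕ) (A : (Fin d → ℝ) → ℂ) : Prop where
  contDiffOn : ContDiffOn ℝ ((3 * k - 1 : ℕ) : ℕ∞) A (orthant d)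
  supp : SuppInCube A
  boundary : ∀ ℓ : Fin d, ∀ t ∈ orthant d, (∀ j, t j ≤ 2) → t ℓ = 0 →
    ∀ m : ℕ, 1 ≤ m → m ≤ 3 * k - 1 → partialD ℓ m A t = 0

/-- Admissible cutoff functions (of the first kind): `C^∞` on `[0,∞)^d`, supported in `[0,2]^d`,
with all `D_ℓ^m A`, `m ≥ 1`, vanishing on `{t_ℓ = 0}`. -/
structure IsAdmissible {d : ℕ} (A : (Fin d → ℝ) → ℂ) : Prop where
  contDiffOn : ContDiffOn ℝ ∞ A (orthant d)
  supp : SuppInCube A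
  boundary : ∀ ℓ : Fin d, ∀ t ∈ orthant d, t ℓ = 0 → ∀ m : ℕ, 1 ≤ m → partialD ℓ m A t = 0

end TensorJacobi

end

/-! ### Jacobi polynomials: contiguous relations, differential equation, recurrence -/

noncomputable section

namespace TensorJacobi

open Finset Polynomial

/-! Reduction to one variable. Let `ℓ` be a coordinate in which `rho` is attained. Up to a
normalization, the kernel is the average of its partial sums along lines parallel to the axis `ℓ`
(`sum_cube_eq_average`). On a line the sum is a univariate kernel, whose multiplier is the
restriction of the cutoff, times factors from the other coordinates. Those factors need only a
pointwise bound on the polynomials; all the decay comes from the direction `ℓ`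
(`exists_tensor_bound`). This is why only pure derivatives in one variable enter the constant.

Decay in one variable. Multiply the kernel by `x - y`, use the three-term recurrence and sum by
parts. The degree-raised polynomials are then rewritten through `P_n` and `(1-x) P_n^{(α+1,β)}`.
This stays within the bilinear forms `jetForm α β i j`, built from `(1-x)^i P_ν^{(α+i,β)}(x)` and
`(1-y)^j P_ν^{(α+j,β)}(y)`, with new multipliers (`sub_smul_jetForm`). If the multiplier `g` is a
discrete symbol of order `r`, there are two kinds of new term. Either `i` or `j` rises by one and
the order of `g` drops by one, or `i, j` stay and the order drops by two. The second gain rests on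
the recurrence coefficients agreeing, for all parameters, up to order `ν^{-2}`. Raising `i` gains a
factor `√(1-x)` in size (`exists_jet_sq_le`). So if `q` dominates `√(1-x)`, `√(1-y)` and `1/n`, each
multiplication by `x - y` gains `q / n` (`exists_jetForm_bound`).

With `q = arccos x + arccos y ≤ π` one has `|x - y| ≥ c q |arccos x - arccos y|`. The powers of `q`
cancel and `k` multiplications give the factor `(n ρ)^{-k}`; the case `q > π` follows by reflection.
The cutoff enters through its first difference: flatness at `0` makes it a symbol of order `3k-2`
with constant of size `n^{-(3k-1)}` (`exists_sym_diff_cutoff`). In the first multiplication only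
this difference occurs, so the cutoff need not vanish at `0`.

The pointwise bound (`exists_jacobiP_sq_le`) comes from the Liouville normal form. The energy of `√w
P_n(cos θ)` varies by a bounded factor as long as `sin θ ≥ δ/(n+1)`, and a local energy estimate in
the middle of the interval compares it with the `L²` norm. Close to the endpoints `P_n` is nearly
constant. Applied to the shifted parameters, the bound needs norms that are comparable with the
original ones (`exists_normSq_shift_le`). -/

theorem succ_mul_ringChoose_succ (r : ℝ) (k : ℕ) :
    ((k : ℝ) + 1) * Ring.choose (r + 1) (k + 1) = (r + 1) * Ring.choose r k := by
  have h := Ring.choose_add_smul_choose r k 1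
  simpa [Ring.choose_one_right, nsmul_eq_mul] using h

theorem sub_mul_ringChoose (r : ℝ) (k : ℕ) :
    (r + 1 - k) * Ring.choose (r + 1) k = (r + 1) * Ring.choose r k := by
  cases k with
  | zero => simp
  | succ k =>
    have h1 := succ_mul_ringChoose_succ r k
    have h2 := Ring.choose_succ_succ r k
    push_cast
    linear_combination (r + 1) * h2 - h1

theorem succ_mul_ringChoose (r : ℝ) (k : ℕ) :
    ((k : ℝ) + 1) * Ring.choose r (k + 1) = (r - k) * Ring.choose r k := by
  have h1 := succ_mul_ringChoose_succ r k
  have h2 := Ring.choose_succ_succ r k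
  linear_combination h1 - ((k : ℝ) + 1) * h2

/-- The homogeneous form in `X, Y` underlying the Jacobi polynomials. -/
def jacobiForm (X Y : ℝ) (n : ℕ) (a b : ℝ) : ℝ :=
  ∑ p ∈ antidiagonal n, Ring.choose a p.2 * Ring.choose b p.1 * X ^ p.1 * Y ^ p.2

theorem jacobiP_eq_form (α β : ℝ) (n : ℕ) (x : ℝ) :
    jacobiP α β n x = jacobiForm ((x - 1) / 2) ((x + 1) / 2) n (n + α) (n + β) := by
  unfold jacobiP jacobiForm
  rw [Finset.Nat.sum_antidiagonal_eq_sum_range_succ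
    (fun s i => Ring.choose (n + α) i * Ring.choose (n + β) s *
      ((x - 1) / 2) ^ s * ((x + 1) / 2) ^ i)]

/-- Pascal's rule absorbs the index shift, and the term with `p.1 = 0` vanishes. All forms of total
degree `n + 1` thus become sums over one antidiagonal, and the contiguous relations can be checked
term by term. -/
theorem mul_left_form (X Y : ℝ) (n : ℕ) (a b : ℝ) :
    X * jacobiForm X Y n a b = ∑ p ∈ antidiagonal (n + 1),
      Ring.choose a p.2 * (Ring.choose (b + 1) p.1 - Ring.choose b p.1) * X ^ p.1 * Y ^ p.2 := by
  rw [Finset.Nat.sum_antidiagonal_succ, jacobiForm, mul_sum]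
  simp only [Ring.choose_zero_right, Ring.choose_succ_succ]
  simp only [sub_self, mul_zero, zero_mul, zero_add]
  refine sum_congr rfl fun p _ => ?_
  ring

theorem mul_right_form (X Y : ℝ) (n : ℕ) (a b : ℝ) :
    Y * jacobiForm X Y n a b = ∑ p ∈ antidiagonal (n + 1),
      (Ring.choose (a + 1) p.2 - Ring.choose a p.2) * Ring.choose b p.1 * X ^ p.1 * Y ^ p.2 := by
  rw [Finset.Nat.sum_antidiagonal_succ', jacobiForm, mul_sum]
  simp only [Ring.choose_zero_right, Ring.choose_succ_succ]
  simp only [sub_self, zero_mul, zero_add]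
  refine sum_congr rfl fun p _ => ?_
  ring

theorem form_raise_left (X Y : ℝ) (n : ℕ) (a b : ℝ) :
    -(a + b + 2) * (X * jacobiForm X Y n (a + 1) b) =
      (a + 1) * (Y * jacobiForm X Y n a b - X * jacobiForm X Y n a b) -
        (n + 1) * jacobiForm X Y (n + 1) (a + 1) (b + 1) := by
  rw [mul_left_form, mul_left_form, mul_right_form, jacobiForm, mul_sum, mul_sum,
    ← sum_sub_distrib, mul_sum, ← sum_sub_distrib]
  refine sum_congr rfl fun p hp => ?_
  have hn : (p.1 : ℝ) + p.2 = n + 1 := by exact_mod_cast mem_antidiagonal.mp hp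
  have h1 := sub_mul_ringChoose a p.2
  have h2 := sub_mul_ringChoose b p.1
  linear_combination
    (X ^ p.1 * Y ^ p.2) * (-(Ring.choose (b + 1) p.1) * h1 - Ring.choose (a + 1) p.2 * h2
     - Ring.choose (a + 1) p.2 * Ring.choose (b + 1) p.1 * hn)

theorem form_lower_left (X Y : ℝ) (n : ℕ) (a b : ℝ) :
    (a + b + 2) * jacobiForm X Y (n + 1) a (b + 1) =
      (a + b + 1 - n) * jacobiForm X Y (n + 1) (a + 1) (b + 1) -
        (b + 1) * (Y * jacobiForm X Y n a b - X * jacobiForm X Y n a b) := by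
  rw [mul_left_form, mul_right_form, jacobiForm, jacobiForm, mul_sum, mul_sum,
    ← sum_sub_distrib, mul_sum, ← sum_sub_distrib]
  refine sum_congr rfl fun p hp => ?_
  have hn : (p.1 : ℝ) + p.2 = n + 1 := by exact_mod_cast mem_antidiagonal.mp hp
  have h1 := sub_mul_ringChoose a p.2
  have h2 := sub_mul_ringChoose b p.1
  linear_combination
    (X ^ p.1 * Y ^ p.2) * (-(Ring.choose (b + 1) p.1) * h1 - Ring.choose (a + 1) p.2 * h2
     - Ring.choose (a + 1) p.2 * Ring.choose (b + 1) p.1 * hn)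

/-- Raising the first parameter by a forward difference in the degree. -/
theorem jacobiP_raise (α β : ℝ) (n : ℕ) (x : ℝ) :
    (n + (α + β) / 2 + 1) * ((1 - x) * jacobiP (α + 1) β n x) =
      (n + α + 1) * jacobiP α β n x - (n + 1) * jacobiP α β (n + 1) x := by
  have h := form_raise_left ((x - 1) / 2) ((x + 1) / 2) n (n + α) (n + β)
  simp only [jacobiP_eq_form]
  push_cast
  rw [show (n : ℝ) + (α + 1) = n + α + 1 by ring, show (n : ℝ) + 1 + α = n + α + 1 by ring,
    show (n : ℝ) + 1 + β = n + β + 1 by ring]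
  linear_combination h

/-- Lowering the first parameter. -/
theorem jacobiP_lower (α β : ℝ) (n : ℕ) (x : ℝ) :
    (2 * n + α + β + 3) * jacobiP α β (n + 1) x =
      (n + α + β + 2) * jacobiP (α + 1) β (n + 1) x -
        (n + β + 1) * jacobiP (α + 1) β n x := by
  have h := form_lower_left ((x - 1) / 2) ((x + 1) / 2) n (n + α + 1) (n + β)
  simp only [jacobiP_eq_form]
  push_cast
  rw [show (n : ℝ) + (α + 1) = n + α + 1 by ring, show (n : ℝ) + 1 + α = n + α + 1 by ring,
    show (n : ℝ) + 1 + β = n + β + 1 by ring, show (n : ℝ) + 1 + (α + 1) = n + α + 1 + 1 by ring]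
  linear_combination h

theorem jacobiP_zero (α β x : ℝ) : jacobiP α β 0 x = 1 := by
  simp [jacobiP]

theorem jacobiP_neg (α β : ℝ) (n : ℕ) (x : ℝ) :
    jacobiP α β n (-x) = (-1) ^ n * jacobiP β α n x := by
  rw [jacobiP_eq_form, jacobiP_eq_form, jacobiForm, jacobiForm,
    ← Finset.Nat.sum_antidiagonal_swap, mul_sum]
  refine sum_congr rfl fun p hp => ?_
  rw [← mem_antidiagonal.mp hp]
  simp only [Prod.fst_swap, Prod.snd_swap]
  rw [show (-x - 1) / 2 = -1 * ((x + 1) / 2) by ring, show (-x + 1) / 2 = -1 * ((x - 1) / 2) by ring,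
    mul_pow, mul_pow, pow_add]
  ring

theorem ringChoose_pos (k : ℕ) : ∀ r : ℝ, (k : ℝ) - 1 < r → 0 < Ring.choose r k := by
  induction k with
  | zero => intro r _; simp
  | succ k ih =>
    intro r hr
    push_cast at hr
    have h := succ_mul_ringChoose r k
    have h1 := ih r (by linarith)
    have h2 : 0 < ((k : ℝ) + 1) * Ring.choose r (k + 1) := by
      rw [h]; exact mul_pos (by linarith) h1
    exact (mul_pos_iff_of_pos_left (by positivity)).mp h2

theorem jacobiP_one_pos {α : ℝ} (β : ℝ) (hα : -1 < α) (n : ℕ) : 0 < jacobiP α β n 1 := by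
  rw [jacobiP, Finset.sum_eq_single 0]
  · simp only [Nat.sub_zero, Ring.choose_zero_right]
    have := ringChoose_pos n (n + α) (by linarith)
    norm_num
    exact this
  · intro s _ hs
    simp [hs]
  · simp

/-- The Jacobi polynomial as an element of `ℝ[X]`. -/
def jacobiPoly (α β : ℝ) (n : ℕ) : ℝ[X] :=
  ∑ p ∈ antidiagonal n, C (Ring.choose (n + α) p.2 * Ring.choose (n + β) p.1) *
    ((C (1 / 2) * (X - 1)) ^ p.1 * (C (1 / 2) * (X + 1)) ^ p.2)

theorem eval_jacobiPoly (α β : ℝ) (n : ℕ) (x : ℝ) :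
    (jacobiPoly α β n).eval x = jacobiP α β n x := by
  rw [jacobiP_eq_form, jacobiForm, jacobiPoly, eval_finsetSum]
  refine sum_congr rfl fun p _ => ?_
  simp only [eval_mul, eval_C, eval_pow, eval_sub, eval_add, eval_X, eval_one]
  rw [show (1 / 2 * (x - 1)) = (x - 1) / 2 by ring, show (1 / 2 * (x + 1)) = (x + 1) / 2 by ring]
  ring

/-- The Jacobi differential operator, as a linear map on polynomials. -/
def jacobiOp (α β lam : ℝ) (p : ℝ[X]) : ℝ[X] :=
  (1 - X ^ 2) * derivative (derivative p) +
    (C (β - α) - C (α + β + 2) * X) * derivative p + C lam * p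

/-- In this basis of fixed total degree `s + i` the operator only couples neighbours. The truncated
subtractions are harmless, since their coefficients contain the factor `s` or `i`. -/
theorem jacobiOp_monomial (α β : ℝ) (s i : ℕ) :
    jacobiOp α β ((s + i : ℝ) * (s + i + α + β + 1))
      ((C (1 / 2) * (X - 1)) ^ s * (C (1 / 2) * (X + 1)) ^ i) =
    C ((s : ℝ) * (s + α)) * ((C (1 / 2) * (X - 1)) ^ s * (C (1 / 2) * (X + 1)) ^ i -
      (C (1 / 2) * (X - 1)) ^ (s - 1) * (C (1 / 2) * (X + 1)) ^ (i + 1)) +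
    C ((i : ℝ) * (i + β)) * ((C (1 / 2) * (X - 1)) ^ s * (C (1 / 2) * (X + 1)) ^ i -
      (C (1 / 2) * (X - 1)) ^ (s + 1) * (C (1 / 2) * (X + 1)) ^ (i - 1)) := by
  refine Polynomial.funext fun x => ?_
  rcases s with _ | _ | s <;> rcases i with _ | _ | i <;>
  simp [jacobiOp, derivative_mul, derivative_pow] <;> ring

theorem jacobiOp_sum_C_mul {ι : Type*} (t : Finset ι) (α β lam : ℝ) (c : ι → ℝ) (q : ι → ℝ[X]) :
    jacobiOp α β lam (∑ p ∈ t, C (c p) * q p) = ∑ p ∈ t, C (c p) * jacobiOp α β lam (q p) := by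
  simp only [jacobiOp, derivative_sum, derivative_C_mul, mul_sum, ← sum_add_distrib]
  refine sum_congr rfl fun p _ => ?_
  ring

theorem jacobiOp_jacobiPoly (α β : ℝ) (n : ℕ) :
    jacobiOp α β (n * (n + α + β + 1)) (jacobiPoly α β n) = 0 := by
  have key : ∀ p ∈ antidiagonal n, jacobiOp α β (n * (n + α + β + 1))
      ((C (1 / 2) * (X - 1)) ^ p.1 * (C (1 / 2) * (X + 1)) ^ p.2) = _ := fun p hp => by
    have hn : (n : ℝ) = p.1 + p.2 := by exact_mod_cast (mem_antidiagonal.mp hp).symm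
    rw [hn, jacobiOp_monomial]
  rw [jacobiPoly, jacobiOp_sum_C_mul, sum_congr rfl fun p hp => by rw [key p hp, mul_add], sum_add_distrib]
  cases n with
  | zero => simp
  | succ m =>
    rw [Finset.Nat.sum_antidiagonal_succ, Finset.Nat.sum_antidiagonal_succ']
    simp only [Nat.cast_zero, zero_mul, map_zero, mul_zero, zero_add]
    rw [← sum_add_distrib]
    refine sum_eq_zero fun p hp => ?_
    have hn : (p.1 : ℝ) + p.2 = m := by exact_mod_cast mem_antidiagonal.mp hp
    have h1 := succ_mul_ringChoose ((m + 1 : ℕ) + α) p.2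
    have h2 := succ_mul_ringChoose ((m + 1 : ℕ) + β) p.1
    set E := (C (1 / 2 : ℝ) * (X - 1)) ^ (p.1 + 1) * (C (1 / 2) * (X + 1)) ^ p.2
    set E' := (C (1 / 2 : ℝ) * (X - 1)) ^ p.1 * (C (1 / 2) * (X + 1)) ^ (p.2 + 1)
    -- The flow between two neighbouring monomials is the same in both directions, so the
    -- contributions cancel in pairs.
    have hc : Ring.choose ((m + 1 : ℕ) + α) p.2 * Ring.choose ((m + 1 : ℕ) + β) (p.1 + 1) *
        (((p.1 + 1 : ℕ) : ℝ) * ((p.1 + 1 : ℕ) + α)) =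
        Ring.choose ((m + 1 : ℕ) + α) (p.2 + 1) * Ring.choose ((m + 1 : ℕ) + β) p.1 *
        (((p.2 + 1 : ℕ) : ℝ) * ((p.2 + 1 : ℕ) + β)) := by
      push_cast at h1 h2 ⊢
      rw [← hn] at h1 h2 ⊢
      linear_combination (p.1 + 1 + α) * Ring.choose (p.1 + p.2 + 1 + α) p.2 * h2 -
        (p.2 + 1 + β) * Ring.choose (p.1 + p.2 + 1 + β) p.1 * h1
    simp only [Nat.add_sub_cancel]
    rw [← mul_assoc, ← mul_assoc, ← C_mul, ← C_mul, hc]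
    ring

theorem hasDerivAt_jacobiP (α β : ℝ) (n : ℕ) (x : ℝ) :
    HasDerivAt (jacobiP α β n) ((derivative (jacobiPoly α β n)).eval x) x := by
  have h := (jacobiPoly α β n).hasDerivAt x
  rwa [show (fun x => eval x (jacobiPoly α β n)) = jacobiP α β n from
    _root_.funext (eval_jacobiPoly α β n)] at h

theorem continuous_jacobiP (α β : ℝ) (n : ℕ) : Continuous (jacobiP α β n) :=
  continuous_iff_continuousAt.mpr fun x => (hasDerivAt_jacobiP α β n x).continuousAt

/-- The Jacobi differential equation. -/
theorem jacobiP_ode (α β : ℝ) (n : ℕ) (x : ℝ) :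
    (1 - x ^ 2) * (derivative (derivative (jacobiPoly α β n))).eval x +
      (β - α - (α + β + 2) * x) * (derivative (jacobiPoly α β n)).eval x +
      n * (n + α + β + 1) * jacobiP α β n x = 0 := by
  have h := congrArg (eval x) (jacobiOp_jacobiPoly α β n)
  simp only [jacobiOp, eval_add, eval_mul, eval_sub, eval_one, eval_pow, eval_X, eval_C,
    eval_zero, eval_jacobiPoly] at h
  exact h

/-- Coefficients of the recurrence `x P_n = A_n P_{n+1} + B_n P_n + C_n P_{n-1}`. -/
def recA (α β : ℝ) (n : ℕ) : ℝ :=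
  -- The general formula degenerates to `0/0` at `n = 0` when `α + β = -1`, which is allowed here;
  -- this is its cancelled form. The same happens for `recB` when `α + β = 0`.
  if n = 0 then 2 / (α + β + 2) else
    2 * (n + 1) * (n + α + β + 1) / ((2 * n + α + β + 1) * (2 * n + α + β + 2))

def recB (α β : ℝ) (n : ℕ) : ℝ :=
  if n = 0 then (β - α) / (α + β + 2) else
    (β ^ 2 - α ^ 2) / ((2 * n + α + β) * (2 * n + α + β + 2))

/-- The coefficient `C_{n+1}`. -/
def recC (α β : ℝ) (n : ℕ) : ℝ :=
  2 * (n + 1 + α) * (n + 1 + β) / ((2 * n + α + β + 2) * (2 * n + α + β + 3))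

theorem jacobiP_rec_zero {α β : ℝ} (h : -2 < α + β) (x : ℝ) :
    x * jacobiP α β 0 x = recA α β 0 * jacobiP α β 1 x + recB α β 0 * jacobiP α β 0 x := by
  have h1 := jacobiP_raise α β 0 x
  simp only [jacobiP_zero, recA, recB, if_true] at h1 ⊢
  have h2 : α + β + 2 ≠ 0 := by linarith
  norm_num at h1
  field_simp
  linear_combination (-2) * h1

/-- The raising relations in degrees `n + 1` and `n` express two polynomials `(1-x) P^{(α+1,β)}`;
the lowering relation multiplied by `x - 1` eliminates both. -/
theorem jacobiP_rec_succ {α β : ℝ} (h : -2 < α + β) (n : ℕ) (x : ℝ) :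
    x * jacobiP α β (n + 1) x = recA α β (n + 1) * jacobiP α β (n + 2) x +
      recB α β (n + 1) * jacobiP α β (n + 1) x + recC α β n * jacobiP α β n x := by
  have h1 := jacobiP_raise α β (n + 1) x
  have h2 := jacobiP_raise α β n x
  have h3 := jacobiP_lower α β n x
  simp only [recA, recB, recC, Nat.succ_ne_zero, if_false]
  push_cast at h1 h2 h3 ⊢
  have hn : (0 : ℝ) ≤ n := n.cast_nonneg
  have e1 : 2 * (n : ℝ) + α + β + 2 ≠ 0 := by linarith
  have e2 : 2 * (n : ℝ) + α + β + 3 ≠ 0 := by linarith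
  have e3 : 2 * (n : ℝ) + α + β + 4 ≠ 0 := by linarith
  rw [show 2 * ((n : ℝ) + 1) + α + β + 1 = 2 * n + α + β + 3 by ring,
    show 2 * ((n : ℝ) + 1) + α + β + 2 = 2 * n + α + β + 4 by ring,
    show 2 * ((n : ℝ) + 1) + α + β = 2 * n + α + β + 2 by ring]
  field_simp
  rw [show n + 1 + 1 = n + 2 from rfl] at h1
  linear_combination -2 * (2 * n + α + β + 2) * (n + α + β + 2) * h1 +
    2 * (2 * n + α + β + 4) * (n + β + 1) * h2 +
    (2 * n + α + β + 2) * (2 * n + α + β + 4) * (x - 1) * h3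

end TensorJacobi
end

/-! ### Orthogonality and norms -/

noncomputable section

namespace TensorJacobi

open Polynomial

theorem jacobiWeight_nonneg (α β : ℝ) {t : ℝ} (ht : t ∈ Set.Icc (-1 : ℝ) 1) :
    0 ≤ jacobiWeight α β t :=
  mul_nonneg (Real.rpow_nonneg (by linarith [ht.2]) _) (Real.rpow_nonneg (by linarith [ht.1]) _)

theorem jacobiWeight_pos (α β : ℝ) {t : ℝ} (ht : t ∈ Set.Ioo (-1 : ℝ) 1) :
    0 < jacobiWeight α β t :=
  mul_pos (Real.rpow_pos_of_pos (by linarith [ht.2]) _) (Real.rpow_pos_of_pos (by linarith [ht.1]) _)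

theorem jacobiWeight_neg (α β t : ℝ) : jacobiWeight α β (-t) = jacobiWeight β α t := by
  unfold jacobiWeight
  rw [mul_comm, sub_neg_eq_add, ← sub_eq_add_neg]

theorem jacobiWeight_succ {α : ℝ} (β : ℝ) (hα : -1 < α) (t : ℝ) :
    jacobiWeight (α + 1) β t = (1 - t) * jacobiWeight α β t := by
  unfold jacobiWeight
  rcases eq_or_ne (1 - t) 0 with h | h
  · rw [h, Real.zero_rpow (by linarith)]; ring
  · rw [Real.rpow_add_one h]; ring

theorem intervalIntegrable_jacobiWeight_right {α : ℝ} (β : ℝ) (hα : -1 < α) :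
    IntervalIntegrable (jacobiWeight α β) MeasureTheory.volume 0 1 := by
  have h : IntervalIntegrable (fun t : ℝ => (1 - t) ^ α) MeasureTheory.volume 0 1 := by
    have h0 := (intervalIntegral.intervalIntegrable_rpow' (a := 1) (b := 0) hα).comp_sub_left 1
    simpa using h0
  refine h.mul_continuousOn ?_
  refine ContinuousOn.rpow_const (by fun_prop) fun t ht => Or.inl ?_
  rw [Set.uIcc_of_le zero_le_one] at ht
  linarith [ht.1]

theorem intervalIntegrable_jacobiWeight {α β : ℝ} (hα : -1 < α) (hβ : -1 < β) :
    IntervalIntegrable (jacobiWeight α β) MeasureTheory.volume (-1) 1 := by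
  refine IntervalIntegrable.trans (b := 0) ?_ (intervalIntegrable_jacobiWeight_right β hα)
  have h := (intervalIntegrable_jacobiWeight_right α hβ).comp_sub_left 0
  simp only [zero_sub, sub_zero, jacobiWeight_neg] at h
  exact h.symm

theorem intervalIntegrable_mul_jacobiWeight {α β : ℝ} (hα : -1 < α) (hβ : -1 < β) {f : ℝ → ℝ}
    (hf : Continuous f) :
    IntervalIntegrable (fun t => f t * jacobiWeight α β t) MeasureTheory.volume (-1) 1 :=
  (intervalIntegrable_jacobiWeight hα hβ).continuousOn_mul hf.continuousOn

/-- `(1-x)^{α+1} (1+x)^{β+1} P_n'(x)`. -/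
def jacobiFlux (α β : ℝ) (n : ℕ) (x : ℝ) : ℝ :=
  (1 - x) ^ (α + 1) * (1 + x) ^ (β + 1) * (derivative (jacobiPoly α β n)).eval x

theorem continuous_jacobiFlux {α β : ℝ} (hα : -1 < α) (hβ : -1 < β) (n : ℕ) :
    Continuous (jacobiFlux α β n) := by
  unfold jacobiFlux
  refine ((Continuous.rpow_const (by fun_prop) fun x => Or.inr (by linarith)).mul
    (Continuous.rpow_const (by fun_prop) fun x => Or.inr (by linarith))).mul ?_
  exact (derivative (jacobiPoly α β n)).continuous

/-- This is the differential equation in self-adjoint form. -/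
theorem hasDerivAt_jacobiFlux (α β : ℝ) (n : ℕ) {x : ℝ} (hx : x ∈ Set.Ioo (-1 : ℝ) 1) :
    HasDerivAt (jacobiFlux α β n)
      (-(n * (n + α + β + 1)) * (jacobiP α β n x * jacobiWeight α β x)) x := by
  have h1 : (1 - x) ≠ 0 := by linarith [hx.2]
  have h2 : (1 + x) ≠ 0 := by linarith [hx.1]
  have d1 : HasDerivAt (fun x : ℝ => (1 - x) ^ (α + 1)) _ x :=
    ((hasDerivAt_const x (1 : ℝ)).sub (hasDerivAt_id x)).rpow_const (Or.inl h1)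
  have d2 : HasDerivAt (fun x : ℝ => (1 + x) ^ (β + 1)) _ x :=
    ((hasDerivAt_const x (1 : ℝ)).add (hasDerivAt_id x)).rpow_const (Or.inl h2)
  have d3 := (derivative (jacobiPoly α β n)).hasDerivAt x
  refine ((d1.mul d2).mul d3).congr_deriv ?_
  have ode := jacobiP_ode α β n x
  simp only [id, add_sub_cancel_right, Pi.sub_apply, Pi.add_apply, Pi.mul_apply]
  rw [Real.rpow_add_one h1, Real.rpow_add_one h2, jacobiWeight]
  linear_combination ((1 - x) ^ α * (1 + x) ^ β) * ode

/-- Lagrange's identity: the Wronskian `F` has the weighted product, times the difference of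
eigenvalues, as derivative, and it vanishes at both ends because `α + 1` and `β + 1` are positive.
-/
theorem jacobi_orthogonal {α β : ℝ} (hα : -1 < α) (hβ : -1 < β) {n m : ℕ}
    (h : n ≠ m) :
    ∫ t in (-1 : ℝ)..1, jacobiP α β n t * jacobiP α β m t * jacobiWeight α β t = 0 := by
  set F : ℝ → ℝ := fun x =>
    jacobiFlux α β n x * jacobiP α β m x - jacobiFlux α β m x * jacobiP α β n x
  set c : ℝ := m * (m + α + β + 1) - n * (n + α + β + 1)
  have hF : ContinuousOn F (Set.Icc (-1) 1) := by
    refine Continuous.continuousOn ?_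
    exact ((continuous_jacobiFlux hα hβ n).mul (continuous_jacobiP α β m)).sub
      ((continuous_jacobiFlux hα hβ m).mul (continuous_jacobiP α β n))
  have hd : ∀ x ∈ Set.Ioo (-1 : ℝ) 1,
      HasDerivAt F (c * (jacobiP α β n x * jacobiP α β m x * jacobiWeight α β x)) x := by
    intro x hx
    refine (((hasDerivAt_jacobiFlux α β n hx).mul (hasDerivAt_jacobiP α β m x)).sub
      ((hasDerivAt_jacobiFlux α β m hx).mul (hasDerivAt_jacobiP α β n x))).congr_deriv ?_
    simp only [jacobiFlux, c]
    ring
  have hint := intervalIntegrable_mul_jacobiWeight hα hβ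
    ((continuous_jacobiP α β n).mul (continuous_jacobiP α β m))
  have key := intervalIntegral.integral_eq_sub_of_hasDerivAt_of_le (by norm_num) hF hd
    (hint.const_mul c)
  rw [intervalIntegral.integral_const_mul] at key
  have hF1 : F 1 = 0 := by
    simp only [F, jacobiFlux, sub_self]
    rw [Real.zero_rpow (by linarith)]; ring
  have hF2 : F (-1) = 0 := by
    simp only [F, jacobiFlux, add_neg_cancel]
    rw [Real.zero_rpow (show β + 1 ≠ 0 by linarith)]; ring
  rw [hF1, hF2, sub_zero] at key
  refine (mul_eq_zero.mp key).resolve_left ?_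
  have hc : c = ((m : ℝ) - n) * (m + n + α + β + 1) := by simp only [c]; ring
  rw [hc]
  refine mul_ne_zero (sub_ne_zero.mpr (by exact_mod_cast h.symm)) ?_
  have : (1 : ℝ) ≤ m + n := by exact_mod_cast (by omega : 1 ≤ m + n)
  linarith

/-- Since `P_n(1) > 0`, the integrand is positive on an interval ending at `1`. -/
theorem jacobiNormSq_pos {α β : ℝ} (hα : -1 < α) (hβ : -1 < β) (n : ℕ) :
    0 < jacobiNormSq α β n := by
  obtain ⟨a, ha, hpos⟩ : ∃ a ∈ Set.Ioo (0 : ℝ) 1, ∀ t ∈ Set.Ioo a 1, 0 < jacobiP α β n t := by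
    have h1 := (continuous_jacobiP α β n).continuousAt.eventually_mem
      (Ioi_mem_nhds (jacobiP_one_pos β hα n))
    obtain ⟨ε, hε, h⟩ := Metric.eventually_nhds_iff.mp h1
    refine ⟨1 - min (ε / 2) (1 / 2), ⟨?_, ?_⟩, fun t ht => h ?_⟩
    · linarith [min_le_right (ε / 2) (1 / 2 : ℝ)]
    · have : 0 < min (ε / 2) (1 / 2 : ℝ) := by positivity
      linarith
    · rw [Real.dist_eq, abs_lt]
      constructor <;> linarith [ht.1, ht.2, min_le_left (ε / 2) (1 / 2 : ℝ)]
  have hint := intervalIntegrable_mul_jacobiWeight hα hβ ((continuous_jacobiP α β n).pow 2)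
  have hnn : ∀ t ∈ Set.Icc (-1 : ℝ) 1, 0 ≤ jacobiP α β n t ^ 2 * jacobiWeight α β t := fun t ht =>
    mul_nonneg (sq_nonneg _) (jacobiWeight_nonneg α β ht)
  have hsub : IntervalIntegrable (fun t => jacobiP α β n t ^ 2 * jacobiWeight α β t)
      MeasureTheory.volume a 1 := hint.mono_set (by
        rw [Set.uIcc_of_le (by linarith [ha.2]), Set.uIcc_of_le (by norm_num)]
        exact Set.Icc_subset_Icc (by linarith [ha.1]) le_rfl)
  have hlt : 0 < ∫ t in a..1, jacobiP α β n t ^ 2 * jacobiWeight α β t := by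
    refine intervalIntegral.intervalIntegral_pos_of_pos_on hsub (fun t ht => ?_) ha.2
    exact mul_pos (pow_pos (hpos t ht) 2) (jacobiWeight_pos α β ⟨by linarith [ht.1, ha.1], ht.2⟩)
  refine hlt.trans_le ?_
  unfold jacobiNormSq
  refine intervalIntegral.integral_mono_interval (by linarith [ha.1]) ha.2.le le_rfl ?_ hint
  refine (MeasureTheory.ae_restrict_iff' measurableSet_Ioc).mpr (Filter.Eventually.of_forall ?_)
  intro t ht
  exact hnn t ⟨ht.1.le, ht.2⟩

theorem jacobiNormSq_swap (α β : ℝ) (n : ℕ) : jacobiNormSq α β n = jacobiNormSq β α n := by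
  unfold jacobiNormSq
  have h := intervalIntegral.integral_comp_neg (a := -1) (b := 1)
    (fun t => jacobiP α β n t ^ 2 * jacobiWeight α β t)
  simp only [neg_neg] at h
  rw [← h]
  refine intervalIntegral.integral_congr fun t _ => ?_
  simp only [jacobiP_neg, jacobiWeight_neg, mul_pow, ← pow_mul, mul_comm n 2]
  rw [pow_mul]
  norm_num

/-- The weighted inner product. -/
def jacobiInner (α β : ℝ) (f g : ℝ → ℝ) : ℝ :=
  ∫ t in (-1 : ℝ)..1, f t * g t * jacobiWeight α β t

theorem jacobiInner_comb {α β : ℝ} (hα : -1 < α) (hβ : -1 < β) {f g h : ℝ → ℝ}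
    (hf : Continuous f) (hg : Continuous g) (hh : Continuous h) (a b : ℝ) :
    jacobiInner α β (fun t => a * f t + b * g t) h =
      a * jacobiInner α β f h + b * jacobiInner α β g h := by
  unfold jacobiInner
  rw [← intervalIntegral.integral_const_mul, ← intervalIntegral.integral_const_mul,
    ← intervalIntegral.integral_add]
  · refine intervalIntegral.integral_congr fun t _ => ?_
    ring
  · exact (intervalIntegrable_mul_jacobiWeight hα hβ (hf.mul hh)).const_mul a
  · exact (intervalIntegrable_mul_jacobiWeight hα hβ (hg.mul hh)).const_mul b

theorem jacobiInner_comm (α β : ℝ) (f g : ℝ → ℝ) :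
    jacobiInner α β f g = jacobiInner α β g f := by
  unfold jacobiInner
  refine intervalIntegral.integral_congr fun t _ => ?_
  ring

theorem jacobiInner_self (α β : ℝ) (n : ℕ) :
    jacobiInner α β (jacobiP α β n) (jacobiP α β n) = jacobiNormSq α β n := by
  unfold jacobiInner jacobiNormSq
  refine intervalIntegral.integral_congr fun t _ => ?_
  ring

/-- Both sides equal the inner product of `x P_n` with `P_{n+1}`, the recurrence being applied to
one factor or to the other. This gives ratios of consecutive norms without evaluating any norm. -/
theorem recA_mul_normSq {α β : ℝ} (hα : -1 < α) (hβ : -1 < β) (n : ℕ) :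
    recA α β n * jacobiNormSq α β (n + 1) = recC α β n * jacobiNormSq α β n := by
  have c := continuous_jacobiP α β
  have orth : ∀ i j, i ≠ j → jacobiInner α β (jacobiP α β i) (jacobiP α β j) = 0 :=
    fun i j h => jacobi_orthogonal hα hβ h
  have e1 : jacobiInner α β (fun t => t * jacobiP α β n t) (jacobiP α β (n + 1)) =
      recA α β n * jacobiNormSq α β (n + 1) := by
    cases n with
    | zero =>
      rw [_root_.funext (jacobiP_rec_zero (α := α) (β := β) (by linarith)),
        jacobiInner_comb hα hβ (c _) (c _) (c _), orth 0 (0 + 1) (by simp), jacobiInner_self]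
      ring
    | succ n =>
      rw [_root_.funext (jacobiP_rec_succ (α := α) (β := β) (by linarith) n)]
      have := jacobiInner_comb hα hβ (f := fun t => recA α β (n + 1) * jacobiP α β (n + 2) t +
        recB α β (n + 1) * jacobiP α β (n + 1) t) (((c _).const_mul _).add ((c _).const_mul _))
        (c n) (c (n + 2)) 1 (recC α β n)
      simp only [one_mul] at this
      rw [this, jacobiInner_comb hα hβ (c _) (c _) (c _), orth n (n + 2) (by omega),
        orth (n + 1) (n + 2) (by omega), jacobiInner_self]
      ring
  have e2 : jacobiInner α β (fun t => t * jacobiP α β (n + 1) t) (jacobiP α β n) =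
      recC α β n * jacobiNormSq α β n := by
    rw [_root_.funext (jacobiP_rec_succ (α := α) (β := β) (by linarith) n)]
    have := jacobiInner_comb hα hβ (f := fun t => recA α β (n + 1) * jacobiP α β (n + 2) t +
      recB α β (n + 1) * jacobiP α β (n + 1) t) (((c _).const_mul _).add ((c _).const_mul _))
      (c n) (c n) 1 (recC α β n)
    simp only [one_mul] at this
    rw [this, jacobiInner_comb hα hβ (c _) (c _) (c _), orth (n + 2) n (by omega),
      orth (n + 1) n (by omega), jacobiInner_self]
    ring
  rw [← e1, ← e2]
  unfold jacobiInner
  refine intervalIntegral.integral_congr fun t _ => ?_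
  ring

/-- The lowering relation, read as a recursion for `P_n^{(α+1,β)}`, expands it in the `P_s^{(α,β)}`
with `s ≤ n`. -/
theorem jacobiInner_raise_of_lt {α β : ℝ} (hα : -1 < α) (hβ : -1 < β)
    {n m : ℕ} (h : n < m) :
    jacobiInner α β (jacobiP (α + 1) β n) (jacobiP α β m) = 0 := by
  induction n with
  | zero =>
    have : jacobiP (α + 1) β 0 = jacobiP α β 0 := by
      ext x; rw [jacobiP_zero, jacobiP_zero]
    rw [this]
    exact jacobi_orthogonal hα hβ h.ne
  | succ n ih =>
    have hn : (0 : ℝ) ≤ n := n.cast_nonneg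
    have h0 : (n : ℝ) + α + β + 2 ≠ 0 := by linarith
    have e : jacobiP (α + 1) β (n + 1) = fun x =>
        ((2 * n + α + β + 3) / (n + α + β + 2)) * jacobiP α β (n + 1) x +
          ((n + β + 1) / (n + α + β + 2)) * jacobiP (α + 1) β n x := by
      ext x
      have := jacobiP_lower α β n x
      field_simp
      linear_combination -this
    rw [e, jacobiInner_comb hα hβ (continuous_jacobiP _ _ _) (continuous_jacobiP _ _ _)
      (continuous_jacobiP _ _ _), ih (by omega)]
    rw [show jacobiInner α β (jacobiP α β (n + 1)) (jacobiP α β m) = 0 from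
      jacobi_orthogonal hα hβ h.ne]
    ring

/-- Put the factor `1 - x` of the raised weight on one polynomial and apply the raising relation;
the term in `P_{n+1}` is orthogonal to degree `n`. -/
theorem normSq_raise {α β : ℝ} (hα : -1 < α) (hβ : -1 < β) (n : ℕ) :
    (n + (α + β) / 2 + 1) * jacobiNormSq (α + 1) β n =
      (n + α + 1) * jacobiInner α β (jacobiP (α + 1) β n) (jacobiP α β n) := by
  have h0 : jacobiNormSq (α + 1) β n =
      jacobiInner α β (fun x => (1 - x) * jacobiP (α + 1) β n x) (jacobiP (α + 1) β n) := by
    unfold jacobiNormSq jacobiInner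
    refine intervalIntegral.integral_congr fun t _ => ?_
    simp only [jacobiWeight_succ β hα t]
    ring
  have hn : (0 : ℝ) ≤ n := n.cast_nonneg
  have h1 : (n : ℝ) + (α + β) / 2 + 1 ≠ 0 := by linarith
  have e : (fun x => (1 - x) * jacobiP (α + 1) β n x) = fun x =>
      ((n + α + 1) / (n + (α + β) / 2 + 1)) * jacobiP α β n x +
        (-(n + 1) / (n + (α + β) / 2 + 1)) * jacobiP α β (n + 1) x := by
    ext x
    have := jacobiP_raise α β n x
    generalize (n : ℝ) + (α + β) / 2 + 1 = D at this h1 ⊢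
    field_simp
    linear_combination this
  rw [h0, e, jacobiInner_comb hα hβ (continuous_jacobiP _ _ _) (continuous_jacobiP _ _ _)
      (continuous_jacobiP _ _ _), jacobiInner_comm α β (jacobiP α β (n + 1)),
      jacobiInner_raise_of_lt hα hβ (Nat.lt_succ_self n), jacobiInner_comm α β (jacobiP α β n)]
  generalize (n : ℝ) + (α + β) / 2 + 1 = D at h1 ⊢
  field_simp
  ring

/-- The mixed inner product in `normSq_raise` is an explicit coefficient times the norm for `(α,
β)`. The resulting ratio is bounded uniformly in `n`, which keeps the normalization by the original
norm usable after the parameter has been raised. -/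
theorem normSq_raise_le {α β : ℝ} (hα : -1 / 2 ≤ α) (hβ : -1 / 2 ≤ β) (n : ℕ) :
    jacobiNormSq (α + 1) β n ≤ 6 * (|α| + 2) * jacobiNormSq α β n := by
  have hα' : -1 < α := by linarith
  have hβ' : -1 < β := by linarith
  have hs : -1 ≤ α + β := by linarith
  have h := normSq_raise hα' hβ' n
  have hpos := jacobiNormSq_pos hα' hβ' n
  have ha := le_abs_self α
  have ha0 := abs_nonneg α
  cases n with
  | zero =>
    have e : jacobiP (α + 1) β 0 = jacobiP α β 0 := by
      ext x; rw [jacobiP_zero, jacobiP_zero]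
    rw [e, jacobiInner_self] at h
    push_cast at h
    have h2 : (1 / 2 : ℝ) * jacobiNormSq (α + 1) β 0 ≤
        (0 + (α + β) / 2 + 1) * jacobiNormSq (α + 1) β 0 :=
      mul_le_mul_of_nonneg_right (by linarith) (jacobiNormSq_pos (by linarith) hβ' 0).le
    nlinarith
  | succ n =>
    have hn : (0 : ℝ) ≤ n := n.cast_nonneg
    have h0 : 0 < (n : ℝ) + α + β + 2 := by linarith
    have h1 : 0 < ((n + 1 : ℕ) : ℝ) + (α + β) / 2 + 1 := by push_cast; linarith
    have e : jacobiP (α + 1) β (n + 1) = fun x =>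
        ((2 * n + α + β + 3) / (n + α + β + 2)) * jacobiP α β (n + 1) x +
          ((n + β + 1) / (n + α + β + 2)) * jacobiP (α + 1) β n x := by
      ext x
      have := jacobiP_lower α β n x
      field_simp
      linear_combination -this
    have h2 : jacobiInner α β (jacobiP (α + 1) β (n + 1)) (jacobiP α β (n + 1)) =
        (2 * n + α + β + 3) / (n + α + β + 2) * jacobiNormSq α β (n + 1) := by
      rw [e, jacobiInner_comb hα' hβ' (continuous_jacobiP _ _ _) (continuous_jacobiP _ _ _)
        (continuous_jacobiP _ _ _), jacobiInner_raise_of_lt hα' hβ' (Nat.lt_succ_self n),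
        jacobiInner_self]
      ring
    rw [h2] at h
    have h3 : (2 * (n : ℝ) + α + β + 3) / (n + α + β + 2) ≤ 3 := by
      rw [div_le_iff₀ h0]; linarith
    have h4 : ((n + 1 : ℕ) + α + 1 : ℝ) ≤ (|α| + 2) * ((n + 1 : ℕ) + (α + β) / 2 + 1) := by
      push_cast
      nlinarith
    have h5 : 0 ≤ ((n + 1 : ℕ) + α + 1 : ℝ) := by push_cast; linarith
    refine le_of_mul_le_mul_left ?_ h1
    rw [h]
    calc _ ≤ ((n + 1 : ℕ) + α + 1 : ℝ) * (3 * jacobiNormSq α β (n + 1)) := by gcongr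
      _ ≤ (|α| + 2) * ((n + 1 : ℕ) + (α + β) / 2 + 1) * (3 * jacobiNormSq α β (n + 1)) := by gcongr
      _ ≤ _ := by
        have : 0 ≤ (|α| + 2) * ((n + 1 : ℕ) + (α + β) / 2 + 1) * jacobiNormSq α β (n + 1) := by
          positivity
        linarith

theorem exists_normSq_shift_le {α β : ℝ} (hα : -1 / 2 ≤ α) (hβ : -1 / 2 ≤ β) (i : ℕ) :
    ∃ C : ℝ, 0 < C ∧ ∀ n, jacobiNormSq (α + i) β n ≤ C * jacobiNormSq α β n := by
  induction i with
  | zero => exact ⟨1, one_pos, fun n => by simp⟩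
  | succ i ih =>
    obtain ⟨C, hC, h⟩ := ih
    have hi : (0 : ℝ) ≤ i := i.cast_nonneg
    refine ⟨6 * (|α + i| + 2) * C, by positivity, fun n => ?_⟩
    push_cast
    rw [← add_assoc, mul_assoc]
    exact (normSq_raise_le (by linarith) hβ n).trans (by gcongr; exact h n)

end TensorJacobi
end

/-! ### Liouville normal form and energy comparison -/

noncomputable section

namespace TensorJacobi

open Polynomial Real

/-- The weight in the trigonometric variable. -/
def trigWeight (α β θ : ℝ) : ℝ := (1 - cos θ) ^ (α + 1 / 2) * (1 + cos θ) ^ (β + 1 / 2)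

/-- Half the logarithmic derivative of `trigWeight`. -/
def trigDrift (α β θ : ℝ) : ℝ := ((α - β) + (α + β + 1) * cos θ) / (2 * sin θ)

def trigDriftDeriv (α β θ : ℝ) : ℝ := -((α + β + 1) + (α - β) * cos θ) / (2 * sin θ ^ 2)

/-- The potential of the Liouville normal form. -/
def trigPotential (α β : ℝ) (n : ℕ) (θ : ℝ) : ℝ :=
  trigDrift α β θ ^ 2 + trigDriftDeriv α β θ - n * (n + α + β + 1)

/-- The twisted derivative of `θ ↦ P_n(cos θ)`. -/
def trigSlope (α β : ℝ) (n : ℕ) (θ : ℝ) : ℝ :=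
  -sin θ * (derivative (jacobiPoly α β n)).eval (cos θ) + trigDrift α β θ * jacobiP α β n (cos θ)

theorem cos_mem_Ioo {θ : ℝ} (hθ : θ ∈ Set.Ioo 0 π) : cos θ ∈ Set.Ioo (-1 : ℝ) 1 := by
  have hs := sin_pos_of_mem_Ioo hθ
  have h := sin_sq_add_cos_sq θ
  constructor <;> nlinarith

theorem trigWeight_pos (α β : ℝ) {θ : ℝ} (hθ : θ ∈ Set.Ioo 0 π) : 0 < trigWeight α β θ := by
  have h := cos_mem_Ioo hθ
  exact mul_pos (rpow_pos_of_pos (by linarith [h.2]) _) (rpow_pos_of_pos (by linarith [h.1]) _)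

theorem hasDerivAt_trigWeight (α β : ℝ) {θ : ℝ} (hθ : θ ∈ Set.Ioo 0 π) :
    HasDerivAt (trigWeight α β) (2 * trigDrift α β θ * trigWeight α β θ) θ := by
  have hc := cos_mem_Ioo hθ
  have h1 : 1 - cos θ ≠ 0 := by linarith [hc.2]
  have h2 : 1 + cos θ ≠ 0 := by linarith [hc.1]
  have hs : sin θ ≠ 0 := (sin_pos_of_mem_Ioo hθ).ne'
  have d1 : HasDerivAt (fun x : ℝ => (1 - cos x) ^ (α + 1 / 2)) _ θ :=
    ((hasDerivAt_cos θ).const_sub 1).rpow_const (Or.inl h1)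
  have d2 : HasDerivAt (fun x : ℝ => (1 + cos x) ^ (β + 1 / 2)) _ θ :=
    ((hasDerivAt_cos θ).const_add 1).rpow_const (Or.inl h2)
  refine (d1.mul d2).congr_deriv ?_
  rw [rpow_sub_one h1, rpow_sub_one h2, trigDrift, trigWeight]
  have h3 : sin θ ^ 2 = (1 - cos θ) * (1 + cos θ) := by
    linear_combination sin_sq_add_cos_sq θ
  generalize (1 - cos θ) ^ (α + 1 / 2) = U
  generalize (1 + cos θ) ^ (β + 1 / 2) = V
  field_simp
  linear_combination ((α * 2 + 1) * (1 + cos θ) - (β * 2 + 1) * (1 - cos θ)) * U * V * h3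

theorem hasDerivAt_trigDrift (α β : ℝ) {θ : ℝ} (hθ : θ ∈ Set.Ioo 0 π) :
    HasDerivAt (trigDrift α β) (trigDriftDeriv α β θ) θ := by
  have hs : sin θ ≠ 0 := (sin_pos_of_mem_Ioo hθ).ne'
  have d := (((hasDerivAt_cos θ).const_mul (α + β + 1)).const_add (α - β)).div
    ((hasDerivAt_sin θ).const_mul 2) (by simpa using hs)
  refine d.congr_deriv ?_
  rw [trigDriftDeriv]
  field_simp
  linear_combination (-(α + β + 1)) * sin_sq_add_cos_sq θ

theorem hasDerivAt_trigJacobi (α β : ℝ) (n : ℕ) (θ : ℝ) :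
    HasDerivAt (fun θ => jacobiP α β n (cos θ))
      (trigSlope α β n θ - trigDrift α β θ * jacobiP α β n (cos θ)) θ := by
  refine ((hasDerivAt_jacobiP α β n (cos θ)).comp θ (hasDerivAt_cos θ)).congr_deriv ?_
  rw [trigSlope]
  ring

/-- With `u = √w P_n(cos θ)` one has `u' = √w · trigSlope`, and this is `u'' = V u` for `V` the
`trigPotential`. Keeping the factor `√w` apart avoids differentiating square roots. -/
theorem hasDerivAt_trigSlope (α β : ℝ) (n : ℕ) {θ : ℝ} (hθ : θ ∈ Set.Ioo 0 π) :
    HasDerivAt (trigSlope α β n) (-trigDrift α β θ * trigSlope α β n θ +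
      trigPotential α β n θ * jacobiP α β n (cos θ)) θ := by
  have hs : sin θ ≠ 0 := (sin_pos_of_mem_Ioo hθ).ne'
  have d1 := ((derivative (jacobiPoly α β n)).hasDerivAt (cos θ)).comp θ (hasDerivAt_cos θ)
  have d2 := (((hasDerivAt_sin θ).neg).mul d1).add
    ((hasDerivAt_trigDrift α β hθ).mul (hasDerivAt_trigJacobi α β n θ))
  refine d2.congr_deriv ?_
  have ode := jacobiP_ode α β n (cos θ)
  have e : 2 * trigDrift α β θ * sin θ = (α - β) + (α + β + 1) * cos θ := by
    rw [trigDrift]; field_simp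
  simp only [Function.comp, trigPotential, trigSlope, Pi.neg_apply]
  linear_combination ode - (derivative (jacobiPoly α β n)).eval (cos θ) * e +
    (derivative (derivative (jacobiPoly α β n))).eval (cos θ) * sin_sq_add_cos_sq θ

/-- The energy of the Liouville normal form. -/
def trigEnergy (α β : ℝ) (n : ℕ) (θ : ℝ) : ℝ :=
  trigWeight α β θ *
    (trigSlope α β n θ ^ 2 + ((n : ℝ) + 1) ^ 2 * jacobiP α β n (cos θ) ^ 2)

theorem hasDerivAt_trigEnergy (α β : ℝ) (n : ℕ) {θ : ℝ} (hθ : θ ∈ Set.Ioo 0 π) :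
    HasDerivAt (trigEnergy α β n) (2 * trigWeight α β θ * jacobiP α β n (cos θ) *
      trigSlope α β n θ * (trigPotential α β n θ + ((n : ℝ) + 1) ^ 2)) θ := by
  have d := (hasDerivAt_trigWeight α β hθ).mul (((hasDerivAt_trigSlope α β n hθ).pow 2).add
    (((hasDerivAt_trigJacobi α β n θ).pow 2).const_mul (((n : ℝ) + 1) ^ 2)))
  refine d.congr_deriv ?_
  simp
  ring

theorem trigEnergy_nonneg (α β : ℝ) (n : ℕ) {θ : ℝ} (hθ : θ ∈ Set.Ioo 0 π) :
    0 ≤ trigEnergy α β n θ := by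
  have := trigWeight_pos α β hθ
  unfold trigEnergy
  positivity

/-- Constant controlling the drift terms. -/
def driftConst (α β : ℝ) : ℝ := (|α - β| + |α + β + 1|) ^ 2 + (|α - β| + |α + β + 1|)

theorem driftConst_nonneg (α β : ℝ) : 0 ≤ driftConst α β := by
  unfold driftConst; positivity

theorem abs_drift_le (α β : ℝ) {θ : ℝ} (hθ : θ ∈ Set.Ioo 0 π) :
    |trigDrift α β θ ^ 2 + trigDriftDeriv α β θ| ≤ driftConst α β / sin θ ^ 2 := by
  have hs := sin_pos_of_mem_Ioo hθ
  have hc := abs_cos_le_one θ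
  have h1 : |(α - β) + (α + β + 1) * cos θ| ≤ |α - β| + |α + β + 1| := by
    refine (abs_add_le _ _).trans ?_
    rw [abs_mul]
    nlinarith [abs_nonneg (α + β + 1)]
  have h2 : |(α + β + 1) + (α - β) * cos θ| ≤ |α - β| + |α + β + 1| := by
    refine (abs_add_le _ _).trans ?_
    rw [abs_mul]
    nlinarith [abs_nonneg (α - β)]
  have e : trigDrift α β θ ^ 2 + trigDriftDeriv α β θ =
      (((α - β) + (α + β + 1) * cos θ) ^ 2 / 4 - ((α + β + 1) + (α - β) * cos θ) / 2) /
        sin θ ^ 2 := by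
    rw [trigDrift, trigDriftDeriv]
    field_simp
    ring
  rw [e, abs_div, abs_of_pos (show 0 < sin θ ^ 2 by positivity)]
  gcongr
  have h3 := sq_le_sq' (by linarith [neg_abs_le ((α - β) + (α + β + 1) * cos θ)])
    ((le_abs_self _).trans h1)
  unfold driftConst
  have h4 := abs_le.mp h2
  rw [abs_le]
  constructor <;> nlinarith [sq_nonneg ((α - β) + (α + β + 1) * cos θ)]

/-- Constant controlling the spectral shift. -/
def shiftConst (α β : ℝ) : ℝ := 2 + |α + β|

theorem abs_spectral_shift_le (α β : ℝ) (n : ℕ) :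
    |((n : ℝ) + 1) ^ 2 - n * (n + α + β + 1)| ≤ shiftConst α β * (n + 1) := by
  have hn : (0 : ℝ) ≤ n := n.cast_nonneg
  unfold shiftConst
  have h := abs_le.mp (le_refl |α + β|)
  rw [abs_le]
  constructor <;> nlinarith [h.1, h.2, abs_nonneg (α + β)]

/-- The energy is `u'^2 + (n+1)^2 u^2`, so `2 |u u'|` is at most the energy divided by `n + 1`. The
large part of the potential is cancelled by `(n+1)^2`, leaving a singular drift term and an error
linear in `n`. -/
theorem abs_deriv_trigEnergy_le (α β : ℝ) (n : ℕ) {θ : ℝ} (hθ : θ ∈ Set.Ioo 0 π) :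
    |2 * trigWeight α β θ * jacobiP α β n (cos θ) *
      trigSlope α β n θ * (trigPotential α β n θ + ((n : ℝ) + 1) ^ 2)| ≤
    (driftConst α β / (n + 1) / sin θ ^ 2 + shiftConst α β) * trigEnergy α β n θ := by
  have hL : (0 : ℝ) < n + 1 := by positivity
  have hm := trigWeight_pos α β hθ
  have hs := sin_pos_of_mem_Ioo hθ
  have h1 : |2 * trigWeight α β θ * jacobiP α β n (cos θ) * trigSlope α β n θ| ≤
      trigEnergy α β n θ / (n + 1) := by
    rw [le_div_iff₀ hL, trigEnergy, ← abs_of_pos hL, ← abs_mul, abs_of_pos hL, abs_le]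
    constructor
    · nlinarith [mul_nonneg hm.le (sq_nonneg
        (trigSlope α β n θ + ((n : ℝ) + 1) * jacobiP α β n (cos θ)))]
    · nlinarith [mul_nonneg hm.le (sq_nonneg
        (trigSlope α β n θ - ((n : ℝ) + 1) * jacobiP α β n (cos θ)))]
  have h2 : |trigPotential α β n θ + ((n : ℝ) + 1) ^ 2| ≤
      driftConst α β / sin θ ^ 2 + shiftConst α β * (n + 1) := by
    rw [trigPotential, sub_add_eq_add_sub, add_sub_assoc]
    exact (abs_add_le _ _).trans (add_le_add (abs_drift_le α β hθ) (abs_spectral_shift_le α β n))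
  rw [abs_mul]
  calc _ ≤ trigEnergy α β n θ / (n + 1) *
        (driftConst α β / sin θ ^ 2 + shiftConst α β * (n + 1)) := by
        have := (abs_nonneg _).trans h1
        gcongr
    _ = _ := by
      field_simp

/-- Grönwall-type comparison of the energy at two points. -/
theorem trigEnergy_le (α β : ℝ) (n : ℕ) {θ₁ θ₂ : ℝ} (h0 : 0 < θ₁) (h12 : θ₁ ≤ θ₂) (h2 : θ₂ < π) :
    trigEnergy α β n θ₁ ≤ trigEnergy α β n θ₂ *
      exp (driftConst α β / (n + 1) * (cos θ₁ / sin θ₁ - cos θ₂ / sin θ₂) +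
        shiftConst α β * (θ₂ - θ₁)) := by
  -- An antiderivative of the growth rate, as `-cot` has derivative `1 / sin²`; the energy times
  -- `exp ψ` is then monotone.
  set ψ : ℝ → ℝ := fun θ =>
    -(driftConst α β / (n + 1)) * (cos θ / sin θ) + shiftConst α β * θ
  have dψ : ∀ θ ∈ Set.Ioo 0 π,
      HasDerivAt ψ (driftConst α β / (n + 1) / sin θ ^ 2 + shiftConst α β) θ := by
    intro θ hθ
    have hs := (sin_pos_of_mem_Ioo hθ).ne'
    have d := (((hasDerivAt_cos θ).div (hasDerivAt_sin θ) hs).const_mul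
      (-(driftConst α β / (n + 1)))).add ((hasDerivAt_id θ).const_mul (shiftConst α β))
    refine d.congr_deriv ?_
    have h3 : -sin θ * sin θ - cos θ * cos θ = -1 := by
      linear_combination -sin_sq_add_cos_sq θ
    rw [h3]
    ring
  have dG : ∀ θ ∈ Set.Ioo 0 π, HasDerivAt (fun θ => trigEnergy α β n θ * exp (ψ θ)) _ θ :=
    fun θ hθ => (hasDerivAt_trigEnergy α β n hθ).mul ((dψ θ hθ).exp)
  have mono : MonotoneOn (fun θ => trigEnergy α β n θ * exp (ψ θ)) (Set.Ioo 0 π) := by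
    refine monotoneOn_of_deriv_nonneg (convex_Ioo _ _)
      (fun θ hθ => (dG θ hθ).continuousAt.continuousWithinAt) ?_ ?_
    · rw [interior_Ioo]
      exact fun θ hθ => (dG θ hθ).differentiableAt.differentiableWithinAt
    · rw [interior_Ioo]
      intro θ hθ
      rw [(dG θ hθ).deriv]
      have h3 := (abs_le.mp (abs_deriv_trigEnergy_le α β n hθ)).1
      have h4 := exp_pos (ψ θ)
      nlinarith
  have h := mono ⟨h0, h12.trans_lt h2⟩ ⟨h0.trans_le h12, h2⟩ h12
  simp only at h
  rw [show driftConst α β / (n + 1) * (cos θ₁ / sin θ₁ - cos θ₂ / sin θ₂) +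
        shiftConst α β * (θ₂ - θ₁) = ψ θ₂ - ψ θ₁ by simp only [ψ]; ring, exp_sub, ← mul_div_assoc,
        le_div_iff₀ (exp_pos _)]
  exact h

end TensorJacobi
end

/-! ### Interior pointwise bound from a local energy estimate -/

noncomputable section

namespace TensorJacobi

open Polynomial Real

theorem cos_two_pi_div_three : cos (2 * π / 3) = -1 / 2 := by
  rw [show 2 * π / 3 = π - π / 3 by ring, cos_pi_sub, cos_pi_div_three]; norm_num

theorem cos_mem_of_mem_middle {θ : ℝ} (h : θ ∈ Set.Icc (π / 2) (2 * π / 3)) :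
    cos θ ∈ Set.Icc (-1 / 2 : ℝ) 0 := by
  have hp := pi_pos
  constructor
  · rw [← cos_two_pi_div_three]
    exact cos_le_cos_of_nonneg_of_le_pi (by linarith [h.1]) (by linarith) h.2
  · rw [← cos_pi_div_two]
    exact cos_le_cos_of_nonneg_of_le_pi (by linarith) (by linarith [h.2]) h.1

theorem mem_Ioo_of_mem_middle {θ : ℝ} (h : θ ∈ Set.Icc (π / 2) (2 * π / 3)) :
    θ ∈ Set.Ioo 0 π := by
  have hp := pi_pos
  exact ⟨by linarith [h.1], by linarith [h.2]⟩

theorem trigWeight_eq (α β : ℝ) {θ : ℝ} (hθ : θ ∈ Set.Ioo 0 π) :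
    trigWeight α β θ = jacobiWeight α β (cos θ) * sin θ := by
  have hc := cos_mem_Ioo hθ
  have h1 : 0 < 1 - cos θ := by linarith [hc.2]
  have h2 : 0 < 1 + cos θ := by linarith [hc.1]
  have hs : sin θ = (1 - cos θ) ^ (1 / 2 : ℝ) * (1 + cos θ) ^ (1 / 2 : ℝ) := by
    rw [← mul_rpow h1.le h2.le, ← sqrt_eq_rpow, eq_comm,
      sqrt_eq_iff_eq_sq (by positivity) (sin_pos_of_mem_Ioo hθ).le]
    linear_combination -sin_sq_add_cos_sq θ
  rw [trigWeight, jacobiWeight, rpow_add h1, rpow_add h2, hs]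
  ring

theorem continuousOn_middle {f : ℝ → ℝ} {f' : ℝ → ℝ}
    (h : ∀ θ ∈ Set.Ioo 0 π, HasDerivAt f (f' θ) θ) :
    ContinuousOn f (Set.Icc (π / 2) (2 * π / 3)) :=
  fun θ hθ => (h θ (mem_Ioo_of_mem_middle hθ)).continuousAt.continuousWithinAt

theorem middle_le : π / 2 ≤ 2 * π / 3 := by linarith [pi_pos]

/-- The substitution `t = cos θ` turns the left side into the part of the norm integral over `[-1/2,
0]`. -/
theorem integral_trig_le {α β : ℝ} (hα : -1 < α) (hβ : -1 < β) (n : ℕ) :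
    ∫ θ in (π / 2)..(2 * π / 3), trigWeight α β θ * jacobiP α β n (cos θ) ^ 2 ≤
      jacobiNormSq α β n := by
  have hint := intervalIntegrable_mul_jacobiWeight hα hβ ((continuous_jacobiP α β n).pow 2)
  set F : ℝ → ℝ := fun t => jacobiP α β n t ^ 2 * jacobiWeight α β t
  have hcont : ContinuousOn F (cos '' Set.uIcc (π / 2) (2 * π / 3)) := by
    rw [Set.uIcc_of_le middle_le]
    refine ((continuous_jacobiP α β n).pow 2).continuousOn.mul ?_
    unfold jacobiWeight
    refine ContinuousOn.mul ?_ ?_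
    · refine ContinuousOn.rpow_const (by fun_prop) ?_
      rintro _ ⟨θ, hθ, rfl⟩
      exact Or.inl (by linarith [(cos_mem_of_mem_middle hθ).2])
    · refine ContinuousOn.rpow_const (by fun_prop) ?_
      rintro _ ⟨θ, hθ, rfl⟩
      exact Or.inl (by linarith [(cos_mem_of_mem_middle hθ).1])
  have key := intervalIntegral.integral_comp_mul_deriv' (a := π / 2) (b := 2 * π / 3) (f := cos)
    (f' := fun θ => -sin θ) (g := F) (fun θ _ => hasDerivAt_cos θ)
    (continuous_sin.neg.continuousOn) hcont
  have e : ∫ θ in (π / 2)..(2 * π / 3), trigWeight α β θ * jacobiP α β n (cos θ) ^ 2 =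
      -∫ θ in (π / 2)..(2 * π / 3), (F ∘ cos) θ * -sin θ := by
    rw [← intervalIntegral.integral_neg]
    refine intervalIntegral.integral_congr fun θ hθ => ?_
    rw [Set.uIcc_of_le middle_le] at hθ
    simp only [Function.comp, F, trigWeight_eq α β (mem_Ioo_of_mem_middle hθ)]
    ring
  rw [e, key, ← intervalIntegral.integral_symm, cos_two_pi_div_three, cos_pi_div_two]
  unfold jacobiNormSq
  refine intervalIntegral.integral_mono_interval (by norm_num) (by norm_num) (by norm_num) ?_ hint
  refine (MeasureTheory.ae_restrict_iff' measurableSet_Ioc).mpr (Filter.Eventually.of_forall ?_)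
  intro t ht
  exact mul_nonneg (sq_nonneg _) (jacobiWeight_nonneg α β ⟨ht.1.le, ht.2⟩)

/-- A bump vanishing at the ends of the middle interval. -/
def middleBump (θ : ℝ) : ℝ := (θ - π / 2) * (2 * π / 3 - θ)

theorem hasDerivAt_middleBump (θ : ℝ) :
    HasDerivAt middleBump (π / 2 + 2 * π / 3 - 2 * θ) θ := by
  refine (((hasDerivAt_id θ).sub_const (π / 2)).mul
    ((hasDerivAt_id θ).const_sub (2 * π / 3))).congr_deriv ?_
  simp
  ring

theorem continuous_middleBump : Continuous middleBump := by
  unfold middleBump; fun_prop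

theorem integral_middleBump_sq_pos : 0 < ∫ θ in (π / 2)..(2 * π / 3), middleBump θ ^ 2 := by
  refine intervalIntegral.intervalIntegral_pos_of_pos_on
    ((continuous_middleBump.pow 2).intervalIntegrable _ _) (fun θ hθ => ?_)
    (by linarith [pi_pos])
  have : 0 < middleBump θ := mul_pos (by linarith [hθ.1]) (by linarith [hθ.2])
  positivity

/-- Derivative of the localized product of the function and its slope. -/
def trigCrossDeriv (α β : ℝ) (n : ℕ) (θ : ℝ) : ℝ :=
  2 * middleBump θ * (π / 2 + 2 * π / 3 - 2 * θ) *
      (trigWeight α β θ * jacobiP α β n (cos θ) * trigSlope α β n θ) +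
    middleBump θ ^ 2 * (trigWeight α β θ * (trigSlope α β n θ ^ 2 +
      trigPotential α β n θ * jacobiP α β n (cos θ) ^ 2))

theorem hasDerivAt_trigCross (α β : ℝ) (n : ℕ) {θ : ℝ} (hθ : θ ∈ Set.Ioo 0 π) :
    HasDerivAt (fun θ => middleBump θ ^ 2 *
      (trigWeight α β θ * jacobiP α β n (cos θ) * trigSlope α β n θ))
      (trigCrossDeriv α β n θ) θ := by
  have d := ((hasDerivAt_middleBump θ).pow 2).mul (((hasDerivAt_trigWeight α β hθ).mul
    (hasDerivAt_trigJacobi α β n θ)).mul (hasDerivAt_trigSlope α β n hθ))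
  refine d.congr_deriv ?_
  simp only [trigCrossDeriv, Pi.mul_apply, Pi.pow_apply, Nat.cast_ofNat, Nat.add_one_sub_one,
    pow_one]
  ring

theorem continuousOn_trigCrossDeriv (α β : ℝ) (n : ℕ) :
    ContinuousOn (trigCrossDeriv α β n) (Set.Icc (π / 2) (2 * π / 3)) := by
  have c1 := continuousOn_middle fun θ hθ => hasDerivAt_trigWeight α β hθ
  have c2 := continuousOn_middle fun θ hθ => hasDerivAt_trigSlope α β n hθ
  have c3 := continuousOn_middle fun θ _ => hasDerivAt_trigJacobi α β n θ
  have c4 := continuousOn_middle fun θ hθ => hasDerivAt_trigDrift α β hθ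
  have c5 : ContinuousOn (trigDriftDeriv α β) (Set.Icc (π / 2) (2 * π / 3)) := by
    unfold trigDriftDeriv
    refine ContinuousOn.div (by fun_prop) (by fun_prop) fun θ hθ => ?_
    have := sin_pos_of_mem_Ioo (mem_Ioo_of_mem_middle hθ)
    positivity
  have c6 : ContinuousOn (trigPotential α β n) (Set.Icc (π / 2) (2 * π / 3)) := by
    unfold trigPotential
    exact ((c4.pow 2).add c5).sub continuousOn_const
  have c7 := continuous_middleBump.continuousOn (s := Set.Icc (π / 2) (2 * π / 3))
  unfold trigCrossDeriv
  exact (((continuousOn_const.mul c7).mul (by fun_prop)).mul ((c1.mul c3).mul c2)).add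
    ((c7.pow 2).mul (c1.mul ((c2.pow 2).add (c6.mul (c3.pow 2)))))

theorem integral_trigCrossDeriv (α β : ℝ) (n : ℕ) :
    ∫ θ in (π / 2)..(2 * π / 3), trigCrossDeriv α β n θ = 0 := by
  rw [intervalIntegral.integral_eq_sub_of_hasDerivAt (f := fun θ => middleBump θ ^ 2 *
      (trigWeight α β θ * jacobiP α β n (cos θ) * trigSlope α β n θ))]
  · simp [middleBump]
  · intro θ hθ
    rw [Set.uIcc_of_le middle_le] at hθ
    exact hasDerivAt_trigCross α β n (mem_Ioo_of_mem_middle hθ)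
  · refine ContinuousOn.intervalIntegrable ?_
    rw [Set.uIcc_of_le middle_le]
    exact continuousOn_trigCrossDeriv α β n

/-- Constant of the local energy estimate. -/
def localConst (α β : ℝ) : ℝ := 4 + 2 * driftConst α β + shiftConst α β

theorem shiftConst_nonneg (α β : ℝ) : 0 ≤ shiftConst α β := by
  unfold shiftConst; positivity

theorem localConst_pos (α β : ℝ) : 0 < localConst α β := by
  have := driftConst_nonneg α β
  have := shiftConst_nonneg α β
  unfold localConst
  positivity

/-- A Caccioppoli estimate: the derivative of `η² u u'` contains `η² u'^2`, and the remaining terms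
are absorbed by completing a square and by a multiple of `(n+1)^2 u^2`. The derivative itself
integrates to zero, so the mean energy is controlled by the mean of `u²` alone. -/
theorem trigCrossDeriv_lower (α β : ℝ) (n : ℕ) {θ : ℝ}
    (hθ : θ ∈ Set.Icc (π / 2) (2 * π / 3)) :
    middleBump θ ^ 2 / 2 * trigEnergy α β n θ ≤ trigCrossDeriv α β n θ +
      localConst α β * ((n : ℝ) + 1) ^ 2 * (trigWeight α β θ * jacobiP α β n (cos θ) ^ 2) := by
  have hθ' := mem_Ioo_of_mem_middle hθ
  have hc := cos_mem_of_mem_middle hθ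
  have hm := trigWeight_pos α β hθ'
  have hp := pi_lt_four
  have hp0 := pi_pos
  have hs : 3 / 4 ≤ sin θ ^ 2 := by
    have := sin_sq_add_cos_sq θ
    nlinarith [hc.1, hc.2]
  have hK := driftConst_nonneg α β
  have hV : |trigPotential α β n θ| ≤
      2 * driftConst α β + ((n : ℝ) + 1) ^ 2 + shiftConst α β * (n + 1) := by
    have h1 := abs_drift_le α β hθ'
    have h2 := abs_spectral_shift_le α β n
    have h3 : driftConst α β / sin θ ^ 2 ≤ 2 * driftConst α β := by
      rw [div_le_iff₀ (by linarith)]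
      nlinarith
    unfold trigPotential
    rw [abs_le] at h1 h2 ⊢
    constructor <;> linarith [h1.1, h1.2, h2.1, h2.2, sq_nonneg ((n : ℝ) + 1)]
  have hL : (1 : ℝ) ≤ n + 1 := by linarith [n.cast_nonneg (α := ℝ)]
  have hL2 : ((n : ℝ) + 1) ≤ (n + 1) ^ 2 := by nlinarith
  have hS := shiftConst_nonneg α β
  have hη0 : 0 ≤ middleBump θ := mul_nonneg (by linarith [hθ.1]) (by linarith [hθ.2])
  have hη1 : middleBump θ ≤ 1 := by
    unfold middleBump
    exact mul_le_one₀ (by linarith [hθ.2]) (by linarith [hθ.2]) (by linarith [hθ.1])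
  have hη2 : (π / 2 + 2 * π / 3 - 2 * θ) ^ 2 ≤ 1 := by
    rw [sq_le_one_iff_abs_le_one, abs_le]
    constructor <;> linarith [hθ.1, hθ.2]
  rw [trigEnergy, trigCrossDeriv]
  set η := middleBump θ
  set ξ := π / 2 + 2 * π / 3 - 2 * θ
  set V := trigPotential α β n θ
  set f := jacobiP α β n (cos θ)
  set g := trigSlope α β n θ
  set m := trigWeight α β θ
  have hη3 : η ^ 2 ≤ 1 := by nlinarith
  have hcoef : 2 * ξ ^ 2 + η ^ 2 * |V| + η ^ 2 * ((n : ℝ) + 1) ^ 2 / 2 ≤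
      localConst α β * ((n : ℝ) + 1) ^ 2 := by
    have h1 : η ^ 2 * |V| ≤ |V| := mul_le_of_le_one_left (abs_nonneg _) hη3
    have h2 : η ^ 2 * ((n : ℝ) + 1) ^ 2 ≤ ((n : ℝ) + 1) ^ 2 :=
      mul_le_of_le_one_left (sq_nonneg _) hη3
    have h3 : shiftConst α β * ((n : ℝ) + 1) ≤ shiftConst α β * ((n : ℝ) + 1) ^ 2 := by gcongr
    have h4 : driftConst α β ≤ driftConst α β * ((n : ℝ) + 1) ^ 2 :=
      le_mul_of_one_le_right hK (by linarith)
    have h5 : 1 ≤ ((n : ℝ) + 1) ^ 2 := by linarith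
    unfold localConst
    linarith
  have key : 0 ≤ (η * g + 2 * ξ * f) ^ 2 / 2 + η ^ 2 * (V + |V|) * f ^ 2 +
      (localConst α β * ((n : ℝ) + 1) ^ 2 -
        (2 * ξ ^ 2 + η ^ 2 * |V| + η ^ 2 * ((n : ℝ) + 1) ^ 2 / 2)) * f ^ 2 := by
    have h1 : 0 ≤ V + |V| := by linarith [neg_abs_le V]
    have h2 := sub_nonneg.mpr hcoef
    positivity
  have := mul_nonneg hm.le key
  linarith

/-- The energy at `θ` is, up to a constant factor, below the energy at every point of the middle
interval. Integrating there against the squared bump and using the local estimate bounds it by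
`(n+1)^2` times the norm, and the factor `(n+1)^2` cancels. -/
theorem exists_trig_bound {α β : ℝ} (hα : -1 < α) (hβ : -1 < β) {δ : ℝ} (hδ : 0 < δ) :
    ∃ C : ℝ, 0 < C ∧ ∀ (n : ℕ) (θ : ℝ), θ ∈ Set.Ioc 0 (π / 2) → δ ≤ ((n : ℝ) + 1) * sin θ →
      trigWeight α β θ * jacobiP α β n (cos θ) ^ 2 ≤ C * jacobiNormSq α β n := by
  -- Bounds the Grönwall exponent: `cot θ ≤ (n+1)/δ`, the middle cotangent is at least `-1`, and the
  -- two angles differ by less than `4`.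
  set B : ℝ := driftConst α β * (1 / δ + 1) + shiftConst α β * 4
  set c₀ : ℝ := ∫ θ in (π / 2)..(2 * π / 3), middleBump θ ^ 2
  have hc₀ : 0 < c₀ := integral_middleBump_sq_pos
  have hloc := localConst_pos α β
  refine ⟨2 * localConst α β * exp B / c₀, by positivity, fun n θ hθ hn => ?_⟩
  have hp := pi_pos
  have hp4 := pi_lt_four
  have hL : (1 : ℝ) ≤ n + 1 := by linarith [n.cast_nonneg (α := ℝ)]
  have hθ' : θ ∈ Set.Ioo 0 π := ⟨hθ.1, by linarith [hθ.2]⟩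
  have hs := sin_pos_of_mem_Ioo hθ'
  have hK := driftConst_nonneg α β
  have hS := shiftConst_nonneg α β
  have hH : ∀ φ ∈ Set.Icc (π / 2) (2 * π / 3),
      trigEnergy α β n θ * exp (-B) ≤ trigEnergy α β n φ := by
    intro φ hφ
    have hφ' := mem_Ioo_of_mem_middle hφ
    have hc := cos_mem_of_mem_middle hφ
    have hsφ := sin_pos_of_mem_Ioo hφ'
    have h1 := trigEnergy_le α β n hθ.1 (hθ.2.trans hφ.1) hφ'.2
    have h2 : cos θ / sin θ - cos φ / sin φ ≤ (1 / δ + 1) * (n + 1) := by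
      have e1 : cos θ / sin θ ≤ (n + 1) / δ := by
        rw [div_le_div_iff₀ hs hδ]
        nlinarith [cos_le_one θ]
      have e2 : -(cos φ / sin φ) ≤ 1 := by
        rw [← neg_div, div_le_one hsφ]
        have := sin_sq_add_cos_sq φ
        nlinarith [hc.1, hc.2]
      rw [add_mul, one_div_mul_eq_div]
      linarith
    have h3 : driftConst α β / (n + 1) * (cos θ / sin θ - cos φ / sin φ) +
        shiftConst α β * (φ - θ) ≤ B := by
      have e1 : driftConst α β / (n + 1) * (cos θ / sin θ - cos φ / sin φ) ≤
          driftConst α β / (n + 1) * ((1 / δ + 1) * (n + 1)) := by gcongr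
      have e2 : driftConst α β / (n + 1) * ((1 / δ + 1) * (n + 1)) =
          driftConst α β * (1 / δ + 1) := by field_simp
      have e3 : shiftConst α β * (φ - θ) ≤ shiftConst α β * 4 := by
        gcongr
        linarith [hφ.2, hθ.1]
      simp only [B]
      linarith
    have h4 := trigEnergy_nonneg α β n hφ'
    rw [exp_neg, ← div_eq_mul_inv, div_le_iff₀ (exp_pos _)]
    exact h1.trans (by gcongr)
  have c1 := continuousOn_middle fun θ hθ => hasDerivAt_trigWeight α β hθ
  have c3 := continuousOn_middle fun θ _ => hasDerivAt_trigJacobi α β n θ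
  have hcross : IntervalIntegrable (trigCrossDeriv α β n) MeasureTheory.volume
      (π / 2) (2 * π / 3) := by
    refine ContinuousOn.intervalIntegrable ?_
    rw [Set.uIcc_of_le middle_le]
    exact continuousOn_trigCrossDeriv α β n
  have hmf : IntervalIntegrable (fun θ => trigWeight α β θ * jacobiP α β n (cos θ) ^ 2)
      MeasureTheory.volume (π / 2) (2 * π / 3) := by
    refine ContinuousOn.intervalIntegrable ?_
    rw [Set.uIcc_of_le middle_le]
    exact c1.mul (c3.pow 2)
  have hmain : c₀ * (trigEnergy α β n θ * exp (-B) / 2) ≤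
      localConst α β * ((n : ℝ) + 1) ^ 2 * jacobiNormSq α β n := by
    calc c₀ * (trigEnergy α β n θ * exp (-B) / 2)
        = ∫ φ in (π / 2)..(2 * π / 3), middleBump φ ^ 2 * (trigEnergy α β n θ * exp (-B) / 2) := by
          rw [intervalIntegral.integral_mul_const]
      _ ≤ ∫ φ in (π / 2)..(2 * π / 3), (trigCrossDeriv α β n φ + localConst α β *
            ((n : ℝ) + 1) ^ 2 * (trigWeight α β φ * jacobiP α β n (cos φ) ^ 2)) := by
          refine intervalIntegral.integral_mono_on middle_le
            (((continuous_middleBump.pow 2).mul continuous_const).intervalIntegrable _ _)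
            (hcross.add (hmf.const_mul _)) fun φ hφ => ?_
          refine le_trans ?_ (trigCrossDeriv_lower α β n hφ)
          have := mul_le_mul_of_nonneg_left (hH φ hφ)
            (show 0 ≤ middleBump φ ^ 2 / 2 by positivity)
          linarith
      _ = localConst α β * ((n : ℝ) + 1) ^ 2 *
            ∫ φ in (π / 2)..(2 * π / 3), trigWeight α β φ * jacobiP α β n (cos φ) ^ 2 := by
          rw [intervalIntegral.integral_add hcross (hmf.const_mul _), integral_trigCrossDeriv,
            intervalIntegral.integral_const_mul, zero_add]
      _ ≤ _ := by
          gcongr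
          exact integral_trig_le hα hβ n
  have hE : ((n : ℝ) + 1) ^ 2 * (trigWeight α β θ * jacobiP α β n (cos θ) ^ 2) ≤
      trigEnergy α β n θ := by
    have := mul_nonneg (trigWeight_pos α β hθ').le (sq_nonneg (trigSlope α β n θ))
    unfold trigEnergy
    linarith
  rw [exp_neg] at hmain
  refine le_of_mul_le_mul_left (hE.trans ?_) (show 0 < ((n : ℝ) + 1) ^ 2 by positivity)
  have hexp := exp_pos B
  rw [show ((n : ℝ) + 1) ^ 2 * (2 * localConst α β * exp B / c₀ * jacobiNormSq α β n) =
    (localConst α β * ((n : ℝ) + 1) ^ 2 * jacobiNormSq α β n) * (2 * exp B / c₀) by ring]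
  refine le_trans (le_of_eq ?_) (mul_le_mul_of_nonneg_right hmain (by positivity))
  field_simp

end TensorJacobi
end

/-! ### Pointwise bound up to the endpoints -/

noncomputable section

namespace TensorJacobi

open Polynomial Real

/-- The univariate factor of `bigW`. -/
def uniW (α β : ℝ) (n : ℕ) (x : ℝ) : ℝ :=
  (1 - x + ((n : ℝ) ^ 2)⁻¹) ^ (α + 1 / 2) * (1 + x + ((n : ℝ) ^ 2)⁻¹) ^ (β + 1 / 2)

theorem uniW_neg (α β : ℝ) (n : ℕ) (x : ℝ) : uniW α β n (-x) = uniW β α n x := by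
  unfold uniW
  rw [mul_comm, sub_neg_eq_add, ← sub_eq_add_neg]

theorem uniW_pos (α β : ℝ) {n : ℕ} (hn : 1 ≤ n) {x : ℝ} (hx : x ∈ Set.Icc (-1 : ℝ) 1) :
    0 < uniW α β n x := by
  have h : 0 < ((n : ℝ) ^ 2)⁻¹ := by
    have : (0 : ℝ) < n := by exact_mod_cast hn
    positivity
  exact mul_pos (rpow_pos_of_pos (by linarith [hx.2]) _) (rpow_pos_of_pos (by linarith [hx.1]) _)

/-- Constant in the derivative bound near the right endpoint. -/
def endConst (α β : ℝ) : ℝ := (1 + shiftConst α β) * 2 ^ |β| / (α + 1)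

/-- Cauchy's mean value theorem on `[x, 1]` for the flux against `(1-x)^{α+1}`. Both functions
vanish at `1`, and the singular powers of `1 - x` and `1 - c` cancel in the quotients. -/
theorem exists_deriv_jacobiP_le {α β : ℝ} (hα : -1 < α) (hβ : -1 < β) (n : ℕ) {x : ℝ}
    (hx : x ∈ Set.Ico (0 : ℝ) 1) :
    ∃ c ∈ Set.Ioo x 1, |(derivative (jacobiPoly α β n)).eval x| ≤
      endConst α β * ((n : ℝ) + 1) ^ 2 * |jacobiP α β n c| := by
  obtain ⟨c, hc, h⟩ := exists_ratio_hasDerivAt_eq_ratio_slope (jacobiFlux α β n)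
    (fun x => -(n * (n + α + β + 1)) * (jacobiP α β n x * jacobiWeight α β x)) hx.2
    (continuous_jacobiFlux hα hβ n).continuousOn
    (fun y hy => hasDerivAt_jacobiFlux α β n ⟨by linarith [hx.1, hy.1], hy.2⟩)
    (fun x => (1 - x) ^ (α + 1)) (fun x => -1 * (α + 1) * (1 - x) ^ (α + 1 - 1))
    (Continuous.continuousOn (Continuous.rpow_const (by fun_prop)
      fun x => Or.inr (by linarith)))
    (fun y hy => ((hasDerivAt_id y).const_sub 1).rpow_const
      (Or.inl (by simp only [id]; linarith [hy.2])))
  refine ⟨c, hc, ?_⟩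
  have hc1 : 0 < 1 - c := by linarith [hc.2]
  have hx1 : 0 < 1 - x := by linarith [hx.2]
  have hL : (1 : ℝ) ≤ n + 1 := by linarith [n.cast_nonneg (α := ℝ)]
  simp only [sub_self, add_sub_cancel_right, jacobiFlux, jacobiWeight] at h
  rw [zero_rpow (by linarith)] at h
  have p1 := rpow_pos_of_pos hc1 α
  have p2 := rpow_pos_of_pos hx1 (α + 1)
  have e : (α + 1) * ((1 + x) ^ (β + 1) * (derivative (jacobiPoly α β n)).eval x) =
      n * (n + α + β + 1) * (jacobiP α β n c * (1 + c) ^ β) := by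
    refine mul_left_cancel₀ (mul_pos p1 p2).ne' ?_
    linear_combination -h
  have h1 : 1 ≤ (1 + x) ^ (β + 1) := one_le_rpow (by linarith [hx.1]) (by linarith)
  have h2 : (1 + c) ^ β ≤ 2 ^ |β| := by
    have hc0 : 1 ≤ 1 + c := by linarith [hx.1, hc.1]
    calc (1 + c) ^ β ≤ (1 + c) ^ |β| := rpow_le_rpow_of_exponent_le hc0 (le_abs_self β)
      _ ≤ 2 ^ |β| := rpow_le_rpow (by linarith) (by linarith [hc.2]) (abs_nonneg β)
  have h2' : 0 ≤ (1 + c) ^ β := rpow_nonneg (by linarith [hx.1, hc.1]) _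
  have h3 : |(n : ℝ) * (n + α + β + 1)| ≤ (1 + shiftConst α β) * ((n : ℝ) + 1) ^ 2 := by
    have e1 := abs_le.mp (abs_spectral_shift_le α β n)
    have e2 : shiftConst α β * ((n : ℝ) + 1) ≤ shiftConst α β * ((n : ℝ) + 1) ^ 2 :=
      mul_le_mul_of_nonneg_left (by nlinarith) (shiftConst_nonneg α β)
    rw [abs_le]
    constructor <;> nlinarith [e1.1, e1.2]
  have h4 : (α + 1) * |(derivative (jacobiPoly α β n)).eval x| ≤
      (1 + shiftConst α β) * ((n : ℝ) + 1) ^ 2 * (|jacobiP α β n c| * 2 ^ |β|) := by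
    calc (α + 1) * |(derivative (jacobiPoly α β n)).eval x|
        ≤ (α + 1) * ((1 + x) ^ (β + 1) * |(derivative (jacobiPoly α β n)).eval x|) := by
          refine mul_le_mul_of_nonneg_left ?_ (by linarith)
          exact le_mul_of_one_le_left (abs_nonneg _) h1
      _ = |(α + 1) * ((1 + x) ^ (β + 1) * (derivative (jacobiPoly α β n)).eval x)| := by
          rw [abs_mul, abs_mul, abs_of_pos (show 0 < α + 1 by linarith),
            abs_of_pos (show 0 < (1 + x) ^ (β + 1) by linarith)]
      _ = |(n : ℝ) * (n + α + β + 1)| * (|jacobiP α β n c| * (1 + c) ^ β) := by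
          rw [e, abs_mul, abs_mul (jacobiP α β n c), abs_of_nonneg h2']
      _ ≤ _ := by
          refine mul_le_mul h3 ?_ (by positivity) ((abs_nonneg _).trans h3)
          gcongr
  rw [endConst]
  have h5 : 0 < α + 1 := by linarith
  rw [div_mul_eq_mul_div, div_mul_eq_mul_div, le_div_iff₀ h5]
  linarith

theorem endConst_pos {α : ℝ} (β : ℝ) (hα : -1 < α) : 0 < endConst α β := by
  have := shiftConst_nonneg α β
  have h5 : 0 < α + 1 := by linarith
  unfold endConst
  positivity

/-- At a maximum point `ξ` of `|P_n|` on `[x₁, 1]`, the derivative bound makes the change between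
`x₁` and `ξ` at most half of the maximum itself. -/
theorem abs_jacobiP_le_two_mul {α β : ℝ} (hα : -1 < α) (hβ : -1 < β) (n : ℕ) {x₁ : ℝ}
    (h0 : 0 ≤ x₁) (h1 : endConst α β * ((n : ℝ) + 1) ^ 2 * (1 - x₁) ≤ 1 / 2) {x : ℝ}
    (hx : x ∈ Set.Icc x₁ 1) :
    |jacobiP α β n x| ≤ 2 * |jacobiP α β n x₁| := by
  obtain ⟨ξ, hξ, hmax⟩ := isCompact_Icc.exists_isMaxOn (⟨x, hx⟩ : (Set.Icc x₁ 1).Nonempty)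
    ((continuous_jacobiP α β n).abs.continuousOn)
  have hmax' : ∀ y ∈ Set.Icc x₁ 1, |jacobiP α β n y| ≤ |jacobiP α β n ξ| := fun y hy => hmax hy
  refine (hmax' x hx).trans ?_
  rcases hξ.1.eq_or_lt with rfl | hlt
  · linarith [abs_nonneg (jacobiP α β n x₁)]
  obtain ⟨z, hz, hslope⟩ := exists_hasDerivAt_eq_slope (jacobiP α β n) _ hlt
    (continuous_jacobiP α β n).continuousOn (fun y _ => hasDerivAt_jacobiP α β n y)
  obtain ⟨c, hc, hbound⟩ := exists_deriv_jacobiP_le hα hβ n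
    (⟨h0.trans hz.1.le, hz.2.trans_le hξ.2⟩ : z ∈ Set.Ico (0 : ℝ) 1)
  have hE := endConst_pos β hα
  have hM := hmax' c ⟨hz.1.le.trans hc.1.le, hc.2.le⟩
  rw [hslope, abs_div, abs_of_pos (sub_pos.mpr hlt), div_le_iff₀ (sub_pos.mpr hlt)] at hbound
  have h2 : |jacobiP α β n ξ - jacobiP α β n x₁| ≤ 1 / 2 * |jacobiP α β n ξ| := by
    calc _ ≤ _ := hbound
      _ ≤ endConst α β * ((n : ℝ) + 1) ^ 2 * |jacobiP α β n ξ| * (1 - x₁) := by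
        gcongr
        exact hξ.2
      _ = endConst α β * ((n : ℝ) + 1) ^ 2 * (1 - x₁) * |jacobiP α β n ξ| := by ring
      _ ≤ _ := by gcongr
  have h3 := abs_sub_abs_le_abs_sub (jacobiP α β n ξ) (jacobiP α β n x₁)
  linarith

theorem exists_jacobiP_sq_le_right {α β : ℝ} (hα : -1 / 2 ≤ α) (hβ : -1 / 2 ≤ β) :
    ∃ C : ℝ, 0 < C ∧ ∀ (n : ℕ) (x : ℝ), x ∈ Set.Icc (0 : ℝ) 1 →
      jacobiP α β n x ^ 2 * uniW α β (n + 1) x ≤ C * jacobiNormSq α β n := by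
  have hα' : -1 < α := by linarith
  have hβ' : -1 < β := by linarith
  have hE := endConst_pos β hα'
  obtain ⟨δ, hδ, hδ1, hδ2⟩ : ∃ δ : ℝ, 0 < δ ∧ δ ≤ 1 ∧ endConst α β * δ ≤ 1 / 2 := by
    refine ⟨min 1 (1 / (2 * endConst α β)), by positivity, min_le_left _ _, ?_⟩
    calc _ ≤ endConst α β * (1 / (2 * endConst α β)) := by gcongr; exact min_le_right _ _
      _ = 1 / 2 := by field_simp
  obtain ⟨C, hC, hbound⟩ := exists_trig_bound hα' hβ' (sqrt_pos.mpr hδ)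
  refine ⟨4 * ((1 + 1 / δ) ^ (α + 1 / 2) * 3 ^ (β + 1 / 2)) * C, by positivity, fun n x hx => ?_⟩
  have hL : (1 : ℝ) ≤ n + 1 := by linarith [n.cast_nonneg (α := ℝ)]
  have hL2 : 0 < ((n : ℝ) + 1) ^ 2 := by positivity
  have hLi : (((n : ℝ) + 1) ^ 2)⁻¹ ≤ 1 := inv_le_one_of_one_le₀ (by nlinarith)
  have hLi0 : 0 < (((n : ℝ) + 1) ^ 2)⁻¹ := by positivity
  -- Beyond `x₁` the polynomial is compared with its value at `x₁`, so the interior bound is only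
  -- used at `y = min x x₁`. There `sin² (arccos y) = 1 - y² ≥ 1 - y ≥ δ/(n+1)²`, hence the
  -- threshold `√δ` above.
  set x₁ : ℝ := 1 - δ * (((n : ℝ) + 1) ^ 2)⁻¹ with hx₁
  have hx₁0 : 0 ≤ x₁ := by nlinarith
  set y := min x x₁
  have hy0 : 0 ≤ y := le_min hx.1 hx₁0
  have hy1 : δ * (((n : ℝ) + 1) ^ 2)⁻¹ ≤ 1 - y := by linarith [min_le_right x x₁]
  have hyx : y ≤ x := min_le_left _ _
  have hy2 : 0 < 1 - y := lt_of_lt_of_le (by positivity) hy1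
  have hP : |jacobiP α β n x| ≤ 2 * |jacobiP α β n y| := by
    rcases le_total x x₁ with h | h
    · rw [show y = x from min_eq_left h]
      linarith [abs_nonneg (jacobiP α β n x)]
    · rw [show y = x₁ from min_eq_right h]
      refine abs_jacobiP_le_two_mul hα' hβ' n hx₁0 ?_ ⟨h, hx.2⟩
      rw [hx₁, sub_sub_cancel]
      calc _ = endConst α β * δ := by field_simp
        _ ≤ _ := hδ2
  have hP2 : jacobiP α β n x ^ 2 ≤ 4 * jacobiP α β n y ^ 2 := by
    have := pow_le_pow_left₀ (abs_nonneg _) hP 2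
    rw [mul_pow, sq_abs, sq_abs] at this
    linarith
  have hW : uniW α β (n + 1) x ≤ (1 + 1 / δ) ^ (α + 1 / 2) * 3 ^ (β + 1 / 2) *
      ((1 - y) ^ (α + 1 / 2) * (1 + y) ^ (β + 1 / 2)) := by
    have e1 : (1 - x + (((n : ℝ) + 1) ^ 2)⁻¹) ^ (α + 1 / 2) ≤
        (1 + 1 / δ) ^ (α + 1 / 2) * (1 - y) ^ (α + 1 / 2) := by
      rw [← mul_rpow (by positivity) hy2.le]
      refine rpow_le_rpow (by linarith [hx.2]) ?_ (by linarith)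
      have : (((n : ℝ) + 1) ^ 2)⁻¹ ≤ 1 / δ * (1 - y) := by
        rw [one_div_mul_eq_div, le_div_iff₀ hδ]; linarith
      linarith
    have e2 : (1 + x + (((n : ℝ) + 1) ^ 2)⁻¹) ^ (β + 1 / 2) ≤
        3 ^ (β + 1 / 2) * (1 + y) ^ (β + 1 / 2) := by
      rw [← mul_rpow (by positivity) (by linarith)]
      exact rpow_le_rpow (by linarith [hx.1]) (by linarith [hx.2]) (by linarith)
    unfold uniW
    push_cast
    calc _ ≤ ((1 + 1 / δ) ^ (α + 1 / 2) * (1 - y) ^ (α + 1 / 2)) *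
        (3 ^ (β + 1 / 2) * (1 + y) ^ (β + 1 / 2)) := by
          refine mul_le_mul e1 e2 (rpow_nonneg (by linarith [hx.1]) _) (by positivity)
      _ = _ := by ring
  have hcos : cos (arccos y) = y := cos_arccos (by linarith) (by linarith)
  have hb := hbound n (arccos y) ⟨arccos_pos.mpr (by linarith), arccos_le_pi_div_two.mpr hy0⟩ (by
    rw [sin_arccos, ← sqrt_sq (show (0 : ℝ) ≤ n + 1 by linarith), ← sqrt_mul (sq_nonneg _)]
    refine sqrt_le_sqrt ?_
    have h1 : δ ≤ ((n : ℝ) + 1) ^ 2 * (1 - y) := by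
      have := mul_le_mul_of_nonneg_left hy1 hL2.le
      calc δ = ((n : ℝ) + 1) ^ 2 * (δ * (((n : ℝ) + 1) ^ 2)⁻¹) := by field_simp
        _ ≤ _ := this
    refine h1.trans (mul_le_mul_of_nonneg_left ?_ hL2.le)
    nlinarith)
  rw [trigWeight, hcos] at hb
  have hyW : 0 ≤ (1 - y) ^ (α + 1 / 2) * (1 + y) ^ (β + 1 / 2) := by positivity
  have hD : 0 ≤ (1 + 1 / δ) ^ (α + 1 / 2) * 3 ^ (β + 1 / 2) := by positivity
  calc jacobiP α β n x ^ 2 * uniW α β (n + 1) x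
      ≤ (4 * jacobiP α β n y ^ 2) * ((1 + 1 / δ) ^ (α + 1 / 2) * 3 ^ (β + 1 / 2) *
        ((1 - y) ^ (α + 1 / 2) * (1 + y) ^ (β + 1 / 2))) := by
        refine mul_le_mul hP2 hW (uniW_pos α β (by omega) ⟨by linarith [hx.1], hx.2⟩).le
          (by positivity)
    _ = 4 * ((1 + 1 / δ) ^ (α + 1 / 2) * 3 ^ (β + 1 / 2)) *
        ((1 - y) ^ (α + 1 / 2) * (1 + y) ^ (β + 1 / 2) * jacobiP α β n y ^ 2) := by ring
    _ ≤ 4 * ((1 + 1 / δ) ^ (α + 1 / 2) * 3 ^ (β + 1 / 2)) * (C * jacobiNormSq α β n) := by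
        gcongr
    _ = _ := by ring

/-- Uniform pointwise bound for Jacobi polynomials. -/
theorem exists_jacobiP_sq_le {α β : ℝ} (hα : -1 / 2 ≤ α) (hβ : -1 / 2 ≤ β) :
    ∃ C : ℝ, 0 < C ∧ ∀ (n : ℕ) (x : ℝ), x ∈ Set.Icc (-1 : ℝ) 1 →
      jacobiP α β n x ^ 2 * uniW α β (n + 1) x ≤ C * jacobiNormSq α β n := by
  obtain ⟨C₁, hC₁, h₁⟩ := exists_jacobiP_sq_le_right hα hβ
  obtain ⟨C₂, hC₂, h₂⟩ := exists_jacobiP_sq_le_right hβ hα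
  refine ⟨C₁ + C₂, by positivity, fun n x hx => ?_⟩
  have hσ := jacobiNormSq_pos (α := α) (β := β) (by linarith) (by linarith) n
  rcases le_total 0 x with h | h
  · refine (h₁ n x ⟨h, hx.2⟩).trans ?_
    gcongr
    linarith
  · have e := h₂ n (-x) ⟨by linarith, by linarith [hx.1]⟩
    rw [jacobiP_neg, uniW_neg, mul_pow, ← pow_mul, mul_comm n 2, pow_mul, jacobiNormSq_swap] at e
    norm_num at e
    refine e.trans ?_
    gcongr
    linarith

end TensorJacobi
end

/-! ### Calculus of discrete symbols -/

noncomputable section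

namespace TensorJacobi

/-- `f` is a discrete symbol of order `r`, up to `M` differences, with constant `C`:
`‖Δ^m f ν‖ ≤ C (ν+1)^{r-m}` for `m ≤ M`. -/
def Sym {E : Type*} [NormedAddCommGroup E] : ℕ → ℤ → ℝ → (ℕ → E) → Prop
  | 0, r, C, f => ∀ ν, ‖f ν‖ ≤ C * ((ν : ℝ) + 1) ^ r
  | M + 1, r, C, f => (∀ ν, ‖f ν‖ ≤ C * ((ν : ℝ) + 1) ^ r) ∧
      Sym M (r - 1) C (fun ν => f (ν + 1) - f ν)

section Sym

variable {E : Type*} [NormedAddCommGroup E]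

theorem Sym.bound {M : ℕ} {r : ℤ} {C : ℝ} {f : ℕ → E} (h : Sym M r C f) (ν : ℕ) :
    ‖f ν‖ ≤ C * ((ν : ℝ) + 1) ^ r := by
  cases M with
  | zero => exact h ν
  | succ M => exact h.1 ν

theorem Sym.const_nonneg {M : ℕ} {r : ℤ} {C : ℝ} {f : ℕ → E} (h : Sym M r C f) : 0 ≤ C := by
  have := (norm_nonneg _).trans (h.bound 0)
  simpa using this

theorem Sym.mono {M : ℕ} : ∀ {r r' : ℤ} {C C' : ℝ} {f : ℕ → E}, Sym M r C f → r ≤ r' → C ≤ C' →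
    Sym M r' C' f := by
  induction M with
  | zero =>
    intro r r' C C' f h hr hC ν
    have h1 : (1 : ℝ) ≤ (ν : ℝ) + 1 := by linarith [ν.cast_nonneg (α := ℝ)]
    have hC0 : 0 ≤ C' := (Sym.const_nonneg (M := 0) h).trans hC
    refine (h ν).trans ?_
    gcongr
  | succ M ih =>
    intro r r' C C' f h hr hC
    have h1 : ∀ ν : ℕ, (1 : ℝ) ≤ (ν : ℝ) + 1 := fun ν => by linarith [ν.cast_nonneg (α := ℝ)]
    have hC0 : 0 ≤ C' := h.const_nonneg.trans hC
    refine ⟨fun ν => (h.1 ν).trans ?_, ih h.2 (by omega) hC⟩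
    have := h1 ν
    gcongr

theorem Sym.of_succ {M : ℕ} : ∀ {r : ℤ} {C : ℝ} {f : ℕ → E}, Sym (M + 1) r C f → Sym M r C f := by
  induction M with
  | zero => intro r C f h; exact h.1
  | succ M ih => intro r C f h; exact ⟨h.1, ih h.2⟩

theorem Sym.add {M : ℕ} : ∀ {r : ℤ} {C C' : ℝ} {f g : ℕ → E}, Sym M r C f → Sym M r C' g →
    Sym M r (C + C') (fun ν => f ν + g ν) := by
  induction M with
  | zero =>
    intro r C C' f g hf hg ν
    refine (norm_add_le _ _).trans ?_
    rw [add_mul]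
    exact add_le_add (hf ν) (hg ν)
  | succ M ih =>
    intro r C C' f g hf hg
    refine ⟨fun ν => (norm_add_le _ _).trans ?_, ?_⟩
    · rw [add_mul]
      exact add_le_add (hf.1 ν) (hg.1 ν)
    · have e : (fun ν => f (ν + 1) + g (ν + 1) - (f ν + g ν)) =
          fun ν => (f (ν + 1) - f ν) + (g (ν + 1) - g ν) := by
        ext ν; abel
      rw [e]
      exact ih hf.2 hg.2

/-- The discrete Leibniz rule `Δ(a f) = a Δf + Δa f + Δa Δf` has three terms, hence the factor `3`
per difference. -/
theorem Sym.smul [NormedSpace ℝ E] {M : ℕ} : ∀ {p q : ℤ} {A B : ℝ} {a : ℕ → ℝ} {f : ℕ → E},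
    Sym M p A a → Sym M q B f → Sym M (p + q) (3 ^ M * (A * B)) (fun ν => a ν • f ν) := by
  have hv : ∀ {M : ℕ} {p q : ℤ} {A B : ℝ} {a : ℕ → ℝ} {f : ℕ → E}, Sym M p A a → Sym M q B f →
      ∀ ν, ‖a ν • f ν‖ ≤ A * B * ((ν : ℝ) + 1) ^ (p + q) := by
    intro M p q A B a f ha hf ν
    have h1 : (0 : ℝ) < (ν : ℝ) + 1 := by positivity
    rw [norm_smul, zpow_add₀ h1.ne']
    calc ‖a ν‖ * ‖f ν‖ ≤ (A * ((ν : ℝ) + 1) ^ p) * (B * ((ν : ℝ) + 1) ^ q) :=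
          mul_le_mul (ha.bound ν) (hf.bound ν) (norm_nonneg _)
            ((norm_nonneg _).trans (ha.bound ν))
      _ = _ := by ring
  induction M with
  | zero =>
    intro p q A B a f ha hf ν
    simpa using hv ha hf ν
  | succ M ih =>
    intro p q A B a f ha hf
    have hA := ha.const_nonneg
    have hB := hf.const_nonneg
    refine ⟨fun ν => (hv ha hf ν).trans ?_, ?_⟩
    · have h1 : (1 : ℝ) ≤ 3 ^ (M + 1) := one_le_pow₀ (by norm_num)
      have h2 : 0 ≤ A * B := by positivity
      refine mul_le_mul_of_nonneg_right ?_ (by positivity)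
      nlinarith
    · have e1 := (ih ha.of_succ hf.2).mono (r' := p + q - 1) (by omega) le_rfl
      have e2 := (ih ha.2 hf.of_succ).mono (r' := p + q - 1) (by omega) le_rfl
      have e3 := (ih ha.2 hf.2).mono (r' := p + q - 1) (by omega) le_rfl
      have e4 := (e1.add e2).add e3
      have e5 : (3 : ℝ) ^ (M + 1) * (A * B) =
          3 ^ M * (A * B) + 3 ^ M * (A * B) + 3 ^ M * (A * B) := by ring
      rw [e5]
      convert e4 using 2
      module

/-- Altering one value only changes the constant; this disposes of the exceptional formulas for the
recurrence coefficients at index `0`. -/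
theorem Sym.of_shift {M : ℕ} : ∀ {r : ℤ} {C : ℝ} {f : ℕ → E}, Sym M r C (fun ν => f (ν + 1)) →
    ∃ C', Sym M r C' f := by
  have hv : ∀ {M : ℕ} {r : ℤ} {C : ℝ} {f : ℕ → E}, Sym M r C (fun ν => f (ν + 1)) →
      ∀ ν, ‖f ν‖ ≤ (‖f 0‖ + C * 2 ^ |r|) * ((ν : ℝ) + 1) ^ r := by
    intro M r C f h ν
    have hC := h.const_nonneg
    cases ν with
    | zero =>
      simp only [Nat.cast_zero, zero_add, one_zpow, mul_one]
      have : 0 ≤ C * (2 : ℝ) ^ |r| := by positivity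
      linarith
    | succ ν =>
      have h1 := h.bound ν
      have h2 : (0 : ℝ) < (ν : ℝ) + 1 := by positivity
      have h3 : ((ν : ℝ) + 1) ^ r ≤ 2 ^ |r| * (((ν + 1 : ℕ) : ℝ) + 1) ^ r := by
        push_cast
        rcases le_total 0 r with hr | hr
        · have e1 : ((ν : ℝ) + 1) ^ r ≤ ((ν : ℝ) + 1 + 1) ^ r :=
            zpow_le_zpow_left₀ hr h2.le (by linarith)
          have e2 : (1 : ℝ) ≤ 2 ^ |r| := one_le_zpow₀ (by norm_num) (abs_nonneg r)
          exact e1.trans (le_mul_of_one_le_left (by positivity) e2)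
        · obtain ⟨k, rfl⟩ : ∃ k : ℕ, r = -k := ⟨r.natAbs, by omega⟩
          rw [abs_neg, Nat.abs_cast, zpow_neg, zpow_neg, zpow_natCast, zpow_natCast, zpow_natCast,
            ← div_eq_mul_inv, ← div_pow, ← inv_pow]
          refine pow_le_pow_left₀ (by positivity) ?_ k
          rw [inv_eq_one_div, div_le_div_iff₀ h2 (by positivity)]
          linarith
      calc ‖f (ν + 1)‖ ≤ C * ((ν : ℝ) + 1) ^ r := h1
        _ ≤ C * (2 ^ |r| * (((ν + 1 : ℕ) : ℝ) + 1) ^ r) := by gcongr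
        _ ≤ _ := by
          have : 0 ≤ ‖f 0‖ * (((ν + 1 : ℕ) : ℝ) + 1) ^ r := by positivity
          linarith
  induction M with
  | zero => intro r C f h; exact ⟨_, hv h⟩
  | succ M ih =>
    intro r C f h
    obtain ⟨C', hC'⟩ := ih (f := fun ν => f (ν + 1) - f ν) h.2
    have h0 := hC'.const_nonneg
    have hC := h.const_nonneg
    have h1 : 0 ≤ ‖f 0‖ + C * 2 ^ |r| := by positivity
    refine ⟨(‖f 0‖ + C * 2 ^ |r|) + C', fun ν => (hv h ν).trans ?_,
      hC'.mono le_rfl (by linarith)⟩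
    exact mul_le_mul_of_nonneg_right (by linarith) (by positivity)

end Sym

/-- A real sequence all of whose differences obey symbol estimates of order `r`. -/
def IsSymbol (r : ℤ) (a : ℕ → ℝ) : Prop := ∀ M, ∃ C, Sym M r C a

namespace IsSymbol

variable {r p : ℤ} {a b : ℕ → ℝ}

theorem mono (h : IsSymbol r a) (hr : r ≤ p) : IsSymbol p a := fun M =>
  let ⟨C, hC⟩ := h M
  ⟨C, hC.mono hr le_rfl⟩

theorem add (ha : IsSymbol r a) (hb : IsSymbol r b) : IsSymbol r (fun ν => a ν + b ν) := fun M =>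
  let ⟨_, hC⟩ := ha M
  let ⟨_, hD⟩ := hb M
  ⟨_, hC.add hD⟩

theorem mul (ha : IsSymbol r a) (hb : IsSymbol p b) : IsSymbol (r + p) (fun ν => a ν * b ν) :=
  fun M =>
  let ⟨_, hC⟩ := ha M
  let ⟨_, hD⟩ := hb M
  ⟨_, hC.smul hD⟩

theorem zero (r : ℤ) : IsSymbol r (fun _ => 0) := by
  intro M
  refine ⟨0, ?_⟩
  induction M generalizing r with
  | zero => intro ν; simp
  | succ M ih => exact ⟨fun ν => by simp, by simpa using ih (r - 1)⟩

theorem const (c : ℝ) : IsSymbol 0 (fun _ => c) := by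
  intro M
  cases M with
  | zero => exact ⟨|c|, fun ν => by simp⟩
  | succ M =>
    obtain ⟨C, hC⟩ := zero (0 - 1) M
    have h := hC.const_nonneg
    refine ⟨|c| + C, fun ν => by simpa using h, ?_⟩
    simp only [sub_self]
    exact hC.mono le_rfl (by linarith [abs_nonneg c])

theorem const_mul (c : ℝ) (ha : IsSymbol r a) : IsSymbol r (fun ν => c * a ν) := by
  have := (const c).mul ha
  rwa [zero_add] at this

theorem neg (ha : IsSymbol r a) : IsSymbol r (fun ν => -a ν) := by
  have := ha.const_mul (-1)
  simpa using this

theorem sub (ha : IsSymbol r a) (hb : IsSymbol r b) : IsSymbol r (fun ν => a ν - b ν) := by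
  simpa only [sub_eq_add_neg] using ha.add hb.neg

theorem linear (c e : ℝ) : IsSymbol 1 (fun ν => c * ν + e) := by
  intro M
  have hv : ∀ ν : ℕ, ‖c * (ν : ℝ) + e‖ ≤ (|c| + |e|) * ((ν : ℝ) + 1) ^ (1 : ℤ) := by
    intro ν
    rw [zpow_one, Real.norm_eq_abs]
    refine (abs_add_le _ _).trans ?_
    rw [abs_mul, Nat.abs_cast]
    nlinarith [abs_nonneg c, abs_nonneg e, ν.cast_nonneg (α := ℝ),
      mul_nonneg (abs_nonneg e) (ν.cast_nonneg (α := ℝ))]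
  cases M with
  | zero => exact ⟨_, hv⟩
  | succ M =>
    obtain ⟨C, hC⟩ := const c M
    have h := hC.const_nonneg
    refine ⟨(|c| + |e|) + C, fun ν => (hv ν).trans ?_, ?_⟩
    · exact mul_le_mul_of_nonneg_right (by linarith) (by positivity)
    · have e1 : (fun ν : ℕ => c * ((ν + 1 : ℕ) : ℝ) + e - (c * ν + e)) = fun _ => c := by
        ext ν; push_cast; ring
      rw [e1]
      exact hC.mono (by norm_num) (by linarith [abs_nonneg c, abs_nonneg e])

theorem inv_linear {c : ℝ} (hc : 0 < c) : IsSymbol (-1) (fun ν => ((ν : ℝ) + c)⁻¹) := by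
  have hv : ∀ {c : ℝ}, 0 < c → ∀ ν : ℕ,
      ‖((ν : ℝ) + c)⁻¹‖ ≤ (1 + c⁻¹) * ((ν : ℝ) + 1) ^ (-1 : ℤ) := by
    intro c hc ν
    have hν := ν.cast_nonneg (α := ℝ)
    rw [zpow_neg_one, norm_inv, Real.norm_of_nonneg (by positivity), ← div_eq_mul_inv,
      inv_eq_one_div, div_le_div_iff₀ (by positivity) (by positivity)]
    have : (1 + c⁻¹) * ((ν : ℝ) + c) = ν + c + ν * c⁻¹ + 1 := by field_simp; ring
    rw [this]
    have : 0 ≤ (ν : ℝ) * c⁻¹ := by positivity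
    linarith
  intro M
  induction M generalizing c with
  | zero => exact ⟨_, hv hc⟩
  | succ M ih =>
    obtain ⟨C, hC⟩ := ih hc
    obtain ⟨D, hD⟩ := ih (show 0 < c + 1 by linarith)
    obtain ⟨N, hN⟩ := const (-1) M
    have key := hN.smul (hC.smul hD)
    -- The difference is a product of two reciprocals, with constants `c` and `c + 1`; hence the
    -- induction runs over all `c` at once.
    have e : (fun ν : ℕ => (((ν + 1 : ℕ) : ℝ) + c)⁻¹ - ((ν : ℝ) + c)⁻¹) =
        fun ν : ℕ => (-1 : ℝ) • (((ν : ℝ) + c)⁻¹ • ((ν : ℝ) + (c + 1))⁻¹) := by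
      ext ν
      have h1 : (ν : ℝ) + c ≠ 0 := by positivity
      have h2 : (ν : ℝ) + (c + 1) ≠ 0 := by positivity
      have h3 : (ν : ℝ) + 1 + c ≠ 0 := by positivity
      simp only [smul_eq_mul]
      push_cast
      field_simp
      ring
    set K := 3 ^ M * (N * (3 ^ M * (C * D)))
    have hK := key.const_nonneg
    refine ⟨(1 + c⁻¹) + K, fun ν => (hv hc ν).trans ?_, ?_⟩
    · exact mul_le_mul_of_nonneg_right (by linarith) (by positivity)
    · rw [e]
      exact key.mono (by norm_num) (by have : 0 < c⁻¹ := by positivity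
                                       linarith)

theorem of_shift (h : IsSymbol r (fun ν => a (ν + 1))) : IsSymbol r a := fun M =>
  let ⟨_, hC⟩ := h M
  hC.of_shift

end IsSymbol

end TensorJacobi
end

/-! ### Asymptotics of the recurrence coefficients -/

noncomputable section

namespace TensorJacobi

theorem isSymbol_linear_div {c₁ c₂ c₃ : ℝ} (h₁ : 0 < c₁) (h₂ : 0 < c₂) (h₃ : 0 < c₃) (e f : ℝ) :
    IsSymbol (-2) (fun ν => (e * ν + f) / (((ν : ℝ) + c₁) * (ν + c₂) * (ν + c₃))) := by
  have h := (((IsSymbol.linear e f).mul (IsSymbol.inv_linear h₁)).mul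
    (IsSymbol.inv_linear h₂)).mul (IsSymbol.inv_linear h₃)
  norm_num at h
  convert h using 2 with ν
  have e1 : (ν : ℝ) + c₁ ≠ 0 := by positivity
  have e2 : (ν : ℝ) + c₂ ≠ 0 := by positivity
  have e3 : (ν : ℝ) + c₃ ≠ 0 := by positivity
  field_simp

/-- The first two terms of the expansion do not depend on `α, β`. With the analogous fact for
`recC`, this is what makes coefficients for different parameters interchangeable up to order `-2`.
-/
theorem isSymbol_recA_sub {α β : ℝ} (hs : -1 ≤ α + β) :
    IsSymbol (-2) (fun ν => recA α β ν - (1 / 2 + 1 / 4 * ((ν : ℝ) + 1)⁻¹)) := by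
  apply IsSymbol.of_shift
  set s := α + β with hsdef
  convert isSymbol_linear_div (c₁ := 2) (c₂ := (s + 3) / 2) (c₃ := (s + 4) / 2) (by norm_num)
    (by linarith) (by linarith) ((2 - 2 * s - 2 * s ^ 2) / 16)
    (((2 - 2 * s - 2 * s ^ 2) + (s + 1) * (2 - 3 * s)) / 16) using 2 with ν
  simp only [recA, Nat.succ_ne_zero, if_false]
  push_cast
  rw [show 2 * ((ν : ℝ) + 1) + α + β + 1 = 2 * ν + s + 3 by rw [hsdef]; ring,
    show 2 * ((ν : ℝ) + 1) + α + β + 2 = 2 * ν + s + 4 by rw [hsdef]; ring,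
    show (ν : ℝ) + 1 + α + β + 1 = ν + s + 2 by rw [hsdef]; ring,
    show (ν : ℝ) + (s + 3) / 2 = (2 * ν + s + 3) / 2 by ring,
    show (ν : ℝ) + (s + 4) / 2 = (2 * ν + s + 4) / 2 by ring]
  have hν := ν.cast_nonneg (α := ℝ)
  have e1 : 2 * (ν : ℝ) + s + 3 ≠ 0 := by linarith
  have e2 : 2 * (ν : ℝ) + s + 4 ≠ 0 := by linarith
  have e3 : (ν : ℝ) + 2 ≠ 0 := by linarith
  have e4 : (ν : ℝ) + 1 + 1 ≠ 0 := by linarith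
  field_simp
  ring

theorem isSymbol_recC_sub {α β : ℝ} (hs : -1 ≤ α + β) :
    IsSymbol (-2) (fun ν => recC α β ν - (1 / 2 - 1 / 4 * ((ν : ℝ) + 1)⁻¹)) := by
  set s := α + β with hsdef
  convert isSymbol_linear_div (c₁ := 1) (c₂ := (s + 2) / 2) (c₃ := (s + 3) / 2) (by norm_num)
    (by linarith) (by linarith) ((8 * α * β - 2 * s ^ 2 + 2 * s + 2) / 16)
    (((8 * α * β - 2 * s ^ 2 + 2 * s + 2) + s ^ 2 + s) / 16) using 2 with ν
  simp only [recC]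
  rw [show 2 * (ν : ℝ) + α + β + 2 = 2 * ν + s + 2 by rw [hsdef]; ring,
    show 2 * (ν : ℝ) + α + β + 3 = 2 * ν + s + 3 by rw [hsdef]; ring,
    show (ν : ℝ) + (s + 2) / 2 = (2 * ν + s + 2) / 2 by ring,
    show (ν : ℝ) + (s + 3) / 2 = (2 * ν + s + 3) / 2 by ring]
  have hν := ν.cast_nonneg (α := ℝ)
  have e1 : 2 * (ν : ℝ) + s + 2 ≠ 0 := by linarith
  have e2 : 2 * (ν : ℝ) + s + 3 ≠ 0 := by linarith
  have e3 : (ν : ℝ) + 1 ≠ 0 := by linarith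
  field_simp
  rw [hsdef]
  ring

theorem isSymbol_recB {α β : ℝ} (hs : -1 ≤ α + β) : IsSymbol (-2) (recB α β) := by
  apply IsSymbol.of_shift
  set s := α + β with hsdef
  have h := ((IsSymbol.inv_linear (c := (s + 2) / 2) (by linarith)).mul
    (IsSymbol.inv_linear (c := (s + 4) / 2) (by linarith))).const_mul ((β ^ 2 - α ^ 2) / 4)
  norm_num at h
  convert h using 2 with ν
  simp only [recB, Nat.succ_ne_zero, if_false]
  push_cast
  rw [show 2 * ((ν : ℝ) + 1) + α + β = 2 * ν + s + 2 by rw [hsdef]; ring,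
    show 2 * (ν : ℝ) + s + 2 + 2 = 2 * ν + s + 4 by ring,
    show (ν : ℝ) + (s + 2) / 2 = (2 * ν + s + 2) / 2 by ring,
    show (ν : ℝ) + (s + 4) / 2 = (2 * ν + s + 4) / 2 by ring]
  have hν := ν.cast_nonneg (α := ℝ)
  have e1 : 2 * (ν : ℝ) + s + 2 ≠ 0 := by linarith
  have e2 : 2 * (ν : ℝ) + s + 4 ≠ 0 := by linarith
  field_simp
  norm_num

theorem isSymbol_recC_inv {α β : ℝ} (hα : -1 < α) (hβ : -1 < β) :
    IsSymbol 0 (fun ν => (recC α β ν)⁻¹) := by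
  have h := (((IsSymbol.linear 2 (α + β + 2)).mul (IsSymbol.linear 1 ((α + β + 3) / 2))).mul
    (IsSymbol.inv_linear (c := 1 + α) (by linarith))).mul
    (IsSymbol.inv_linear (c := 1 + β) (by linarith))
  norm_num at h
  convert h using 2 with ν
  simp only [recC]
  have hν := ν.cast_nonneg (α := ℝ)
  have e1 : (ν : ℝ) + (1 + α) ≠ 0 := by linarith
  have e2 : (ν : ℝ) + (1 + β) ≠ 0 := by linarith
  rw [inv_div, add_assoc (ν : ℝ) 1 α, add_assoc (ν : ℝ) 1 β]
  field_simp
  ring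

/-- `P_{n+1} = raiseDiag n * P_n - raiseShift n * (1-x) P_n^{(α+1,β)}`. -/
def raiseDiag (α : ℝ) (n : ℕ) : ℝ := (n + α + 1) / (n + 1)

def raiseShift (α β : ℝ) (n : ℕ) : ℝ := (n + (α + β) / 2 + 1) / (n + 1)

theorem jacobiP_succ_eq (α β : ℝ) (n : ℕ) (x : ℝ) :
    jacobiP α β (n + 1) x = raiseDiag α n * jacobiP α β n x -
      raiseShift α β n * ((1 - x) * jacobiP (α + 1) β n x) := by
  have h := jacobiP_raise α β n x
  have hn : (n : ℝ) + 1 ≠ 0 := by positivity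
  unfold raiseDiag raiseShift
  generalize (n : ℝ) + (α + β) / 2 + 1 = D at *
  field_simp
  linear_combination h

theorem isSymbol_linear_div_one (e f : ℝ) :
    IsSymbol 0 (fun ν => (e * (ν : ℝ) + f) / ((ν : ℝ) + 1)) := by
  have h := (IsSymbol.linear e f).mul (IsSymbol.inv_linear (c := 1) one_pos)
  norm_num at h
  simpa only [div_eq_mul_inv] using h

theorem isSymbol_raiseDiag (α : ℝ) : IsSymbol 0 (raiseDiag α) := by
  convert isSymbol_linear_div_one 1 (α + 1) using 2 with ν
  unfold raiseDiag
  ring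

theorem isSymbol_raiseShift (α β : ℝ) : IsSymbol 0 (raiseShift α β) := by
  convert isSymbol_linear_div_one 1 ((α + β) / 2 + 1) using 2 with ν
  unfold raiseShift
  ring

theorem isSymbol_raiseDiag_sub (α α' : ℝ) :
    IsSymbol (-1) (fun ν => raiseDiag α ν - raiseDiag α' ν) := by
  convert (IsSymbol.inv_linear (c := 1) one_pos).const_mul (α - α') using 2 with ν
  unfold raiseDiag
  have hn : (ν : ℝ) + 1 ≠ 0 := by positivity
  field_simp
  ring

/-- The coefficient `C_{n+1}^{(α+i,β)}` renormalized by the ratio of consecutive norms. -/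
def recCn (α β : ℝ) (i : ℕ) (ν : ℕ) : ℝ :=
  recC (α + i) β ν * (recA α β ν * (recC α β ν)⁻¹)

theorem isSymbol_recA {α β : ℝ} (hs : -1 ≤ α + β) : IsSymbol 0 (recA α β) := by
  have h1 := (isSymbol_recA_sub hs).mono (p := 0) (by norm_num)
  have h2 := (IsSymbol.const (1 / 2)).add
    (((IsSymbol.inv_linear (c := 1) one_pos).const_mul (1 / 4)).mono (p := 0) (by norm_num))
  convert h1.add h2 using 2 with ν
  ring

theorem isSymbol_recC {α β : ℝ} (hs : -1 ≤ α + β) : IsSymbol 0 (recC α β) := by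
  have h1 := (isSymbol_recC_sub hs).mono (p := 0) (by norm_num)
  have h2 := (IsSymbol.const (1 / 2)).sub
    (((IsSymbol.inv_linear (c := 1) one_pos).const_mul (1 / 4)).mono (p := 0) (by norm_num))
  convert h1.add h2 using 2 with ν
  ring

theorem recC_ne_zero {α β : ℝ} (hα : -1 < α) (hβ : -1 < β) (ν : ℕ) : recC α β ν ≠ 0 := by
  have hν := ν.cast_nonneg (α := ℝ)
  unfold recC
  have e1 : (ν : ℝ) + 1 + α ≠ 0 := by linarith
  have e2 : (ν : ℝ) + 1 + β ≠ 0 := by linarith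
  have e3 : 2 * (ν : ℝ) + α + β + 2 ≠ 0 := by linarith
  have e4 : 2 * (ν : ℝ) + α + β + 3 ≠ 0 := by linarith
  positivity

theorem isSymbol_recCn {α β : ℝ} (hα : -1 / 2 ≤ α) (hβ : -1 / 2 ≤ β) (i : ℕ) :
    IsSymbol 0 (recCn α β i) := by
  have hi := i.cast_nonneg (α := ℝ)
  have h := (isSymbol_recC (α := α + i) (β := β) (by linarith)).mul
    ((isSymbol_recA (α := α) (β := β) (by linarith)).mul
      (isSymbol_recC_inv (α := α) (β := β) (by linarith) (by linarith)))
  norm_num at h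
  exact h

/-- After multiplication by `recC α β` this compares `C^{(α+i)} A^{(α)}` with `A^{(α+j)} C^{(α)}`.
Both products agree up to order `-2` with that of the universal two-term expansions `k1` and `k2`.
-/
theorem isSymbol_recCn_sub_recA {α β : ℝ} (hα : -1 / 2 ≤ α) (hβ : -1 / 2 ≤ β) (i j : ℕ) :
    IsSymbol (-2) (fun ν => recCn α β i ν - recA (α + j) β ν) := by
  have hi := i.cast_nonneg (α := ℝ)
  have hj := j.cast_nonneg (α := ℝ)
  have hs : -1 ≤ α + β := by linarith
  have a0 := isSymbol_recA_sub hs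
  have aj := isSymbol_recA_sub (α := α + j) (β := β) (by linarith)
  have c0 := isSymbol_recC_sub hs
  have ci := isSymbol_recC_sub (α := α + i) (β := β) (by linarith)
  have k1 : IsSymbol 0 (fun ν => 1 / 2 + 1 / 4 * ((ν : ℝ) + 1)⁻¹) :=
    (IsSymbol.const (1 / 2)).add
    (((IsSymbol.inv_linear (c := 1) one_pos).const_mul (1 / 4)).mono (p := 0) (by norm_num))
  have k2 : IsSymbol 0 (fun ν => 1 / 2 - 1 / 4 * ((ν : ℝ) + 1)⁻¹) :=
    (IsSymbol.const (1 / 2)).sub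
    (((IsSymbol.inv_linear (c := 1) one_pos).const_mul (1 / 4)).mono (p := 0) (by norm_num))
  have t1 := ci.mul (isSymbol_recA hs)
  have t2 := k2.mul a0
  have t3 := aj.mul (isSymbol_recC hs)
  have t4 := k1.mul c0
  norm_num at t1 t2 t3 t4
  have h := (((t1.add t2).sub t3).sub t4).mul
    (isSymbol_recC_inv (α := α) (β := β) (by linarith) (by linarith))
  norm_num at h
  convert h using 2 with ν
  have hne := recC_ne_zero (α := α) (β := β) (by linarith) (by linarith) ν
  unfold recCn
  field_simp
  ring

/-- First-order difference operators `a Δ + b` lower the order of a symbol. -/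
theorem exists_sym_diffOp {p : ℤ} {a b : ℕ → ℝ} (ha : IsSymbol (p + 1) a) (hb : IsSymbol p b)
    (M : ℕ) : ∃ K : ℝ, 0 ≤ K ∧ ∀ (r : ℤ) (D : ℝ) (g : ℕ → ℂ), Sym (M + 1) r D g →
      Sym M (r + p) (K * D) (fun ν => a ν • (g (ν + 1) - g ν) + b ν • g ν) := by
  obtain ⟨A, hA⟩ := ha M
  obtain ⟨B, hB⟩ := hb M
  have hA0 := hA.const_nonneg
  have hB0 := hB.const_nonneg
  refine ⟨3 ^ M * (A + B), by positivity, fun r D g hg => ?_⟩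
  have h1 := (hA.smul hg.2).mono (r' := r + p) (by omega) le_rfl
  have h2 := (hB.smul hg.of_succ).mono (r' := r + p) (by omega) le_rfl
  have h3 := h1.add h2
  rwa [← mul_add, ← add_mul, ← mul_assoc] at h3

end TensorJacobi
end

/-! ### Bilinear forms and multiplication by `x - y` -/

noncomputable section

namespace TensorJacobi

open Finset

/-- The bilinear forms generated by multiplying the kernel with `x - y`. -/
def jetForm (α β : ℝ) (i j K : ℕ) (x y : ℝ) (g : ℕ → ℂ) : ℂ :=
  ∑ ν ∈ range K, ((jacobiNormSq α β ν)⁻¹ * ((1 - x) ^ i * jacobiP (α + i) β ν x) *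
    ((1 - y) ^ j * jacobiP (α + j) β ν y)) • g ν

/-- The part of `x P_n` involving `P_{n-1}`. -/
def recPrev (α β : ℝ) (x : ℝ) : ℕ → ℝ
  | 0 => 0
  | n + 1 => recC α β n * jacobiP α β n x

theorem jacobiP_rec {α β : ℝ} (h : -2 < α + β) (n : ℕ) (x : ℝ) :
    x * jacobiP α β n x = recA α β n * jacobiP α β (n + 1) x +
      recB α β n * jacobiP α β n x + recPrev α β x n := by
  cases n with
  | zero => rw [jacobiP_rec_zero h, recPrev, add_zero]
  | succ n => rw [jacobiP_rec_succ h, recPrev]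

theorem inv_normSq_succ {α β : ℝ} (hα : -1 < α) (hβ : -1 < β) (n : ℕ) :
    (jacobiNormSq α β (n + 1))⁻¹ =
      (jacobiNormSq α β n)⁻¹ * (recA α β n * (recC α β n)⁻¹) := by
  have h := recA_mul_normSq hα hβ n
  have h1 := (jacobiNormSq_pos hα hβ n).ne'
  have h2 := (jacobiNormSq_pos hα hβ (n + 1)).ne'
  have h3 := recC_ne_zero hα hβ n
  field_simp
  linear_combination -h

/-- The operator fixing the pair of orders. -/
def stepDiag (α β : ℝ) (i j : ℕ) (g : ℕ → ℂ) (ν : ℕ) : ℂ :=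
  (raiseDiag (α + j) ν * recCn α β i ν - raiseDiag (α + i) ν * recCn α β j ν) • (g (ν + 1) - g ν) +
    (raiseDiag (α + i) ν * (recA (α + i) β ν - recCn α β j ν) +
      raiseDiag (α + j) ν * (recCn α β i ν - recA (α + j) β ν) +
      (recB (α + i) β ν - recB (α + j) β ν)) • g ν

/-- The operator raising the first order. -/
def stepLeft (α β : ℝ) (i j : ℕ) (g : ℕ → ℂ) (ν : ℕ) : ℂ :=
  (raiseShift (α + i) β ν * recCn α β j ν) • (g (ν + 1) - g ν) +
    (raiseShift (α + i) β ν * (recCn α β j ν - recA (α + i) β ν)) • g ν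

/-- The operator raising the second order. -/
def stepRight (α β : ℝ) (i j : ℕ) (g : ℕ → ℂ) (ν : ℕ) : ℂ :=
  (-(raiseShift (α + j) β ν * recCn α β i ν)) • (g (ν + 1) - g ν) +
    (-(raiseShift (α + j) β ν * (recCn α β i ν - recA (α + j) β ν))) • g ν

theorem sum_range_shift {f : ℕ → ℂ} {K : ℕ} (h0 : f 0 = 0) (hK : f K = 0) :
    ∑ ν ∈ range K, f ν = ∑ ν ∈ range K, f (ν + 1) := by
  have h := Finset.sum_range_succ' f K
  rw [Finset.sum_range_succ, h0, hK, add_zero, add_zero] at h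
  exact h

/-- A Christoffel–Darboux computation with multiplier. Apply the recurrence in `x` and in `y`, and
shift the index in the terms of degree `ν - 1`, so that only degrees `ν` and `ν + 1` remain. Then
eliminate degree `ν + 1` through `jacobiP_succ_eq`. In a product of a raised and an unraised
polynomial the second summand of that identity lifts `i` or `j` by one. -/
theorem sub_smul_jetForm {α β : ℝ} (hα : -1 / 2 ≤ α) (hβ : -1 / 2 ≤ β) (i j K : ℕ) (x y : ℝ)
    {g : ℕ → ℂ} (hg : ∀ ν, K ≤ ν → g ν = 0) :
    (x - y) • jetForm α β i j K x y g = jetForm α β i j K x y (stepDiag α β i j g) +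
      jetForm α β (i + 1) j K x y (stepLeft α β i j g) +
      jetForm α β i (j + 1) K x y (stepRight α β i j g) := by
  have hi := i.cast_nonneg (α := ℝ)
  have hj := j.cast_nonneg (α := ℝ)
  set X : ℝ := (1 - x) ^ i
  set Y : ℝ := (1 - y) ^ j
  -- The terms of lower degree, whose index is to be shifted. No boundary terms arise: `recPrev`
  -- vanishes at `0` and `g` vanishes at `K`.
  set e : ℕ → ℂ := fun ν => ((jacobiNormSq α β ν)⁻¹ * X * Y *
    (recPrev (α + i) β x ν * jacobiP (α + j) β ν y -
      jacobiP (α + i) β ν x * recPrev (α + j) β y ν)) • g ν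
  have he := sum_range_shift (f := e) (K := K) (by simp [e, recPrev]) (by simp [e, hg K le_rfl])
  have h1 : (x - y) • jetForm α β i j K x y g = ∑ ν ∈ range K,
      (((jacobiNormSq α β ν)⁻¹ * X * Y *
        (recA (α + i) β ν * jacobiP (α + i) β (ν + 1) x * jacobiP (α + j) β ν y -
          recA (α + j) β ν * jacobiP (α + i) β ν x * jacobiP (α + j) β (ν + 1) y +
          (recB (α + i) β ν - recB (α + j) β ν) *
            (jacobiP (α + i) β ν x * jacobiP (α + j) β ν y))) • g ν + e ν) := by
    rw [jetForm, smul_sum]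
    refine sum_congr rfl fun ν _ => ?_
    have r1 := jacobiP_rec (α := α + i) (β := β) (by linarith) ν x
    have r2 := jacobiP_rec (α := α + j) (β := β) (by linarith) ν y
    simp only [e]
    rw [smul_smul, ← add_smul]
    congr 1
    linear_combination ((jacobiNormSq α β ν)⁻¹ * X * Y) *
      (jacobiP (α + j) β ν y * r1 - jacobiP (α + i) β ν x * r2)
  rw [h1, sum_add_distrib, he, ← sum_add_distrib]
  simp only [jetForm]
  rw [← sum_add_distrib, ← sum_add_distrib]
  refine sum_congr rfl fun ν _ => ?_
  simp only [e, recPrev, stepDiag, stepLeft, stepRight]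
  rw [inv_normSq_succ (by linarith) (by linarith), jacobiP_succ_eq (α + i) β ν x,
    jacobiP_succ_eq (α + j) β ν y, pow_succ, pow_succ]
  push_cast
  rw [← add_assoc, ← add_assoc]
  simp only [recCn]
  module

theorem stepDiag_eq_zero {α β : ℝ} {i j K : ℕ} {g : ℕ → ℂ} (hg : ∀ ν, K ≤ ν → g ν = 0) (ν : ℕ)
    (hν : K ≤ ν) : stepDiag α β i j g ν = 0 := by
  simp [stepDiag, hg ν hν, hg (ν + 1) (by omega)]

theorem stepLeft_eq_zero {α β : ℝ} {i j K : ℕ} {g : ℕ → ℂ} (hg : ∀ ν, K ≤ ν → g ν = 0) (ν : ℕ)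
    (hν : K ≤ ν) : stepLeft α β i j g ν = 0 := by
  simp [stepLeft, hg ν hν, hg (ν + 1) (by omega)]

theorem stepRight_eq_zero {α β : ℝ} {i j K : ℕ} {g : ℕ → ℂ} (hg : ∀ ν, K ≤ ν → g ν = 0) (ν : ℕ)
    (hν : K ≤ ν) : stepRight α β i j g ν = 0 := by
  simp [stepRight, hg ν hν, hg (ν + 1) (by omega)]

/-- The coefficient of the difference is of order `-1`, by `isSymbol_raiseDiag_sub` and the near
equality of the renormalized recurrence coefficients. The coefficient of `g` itself is of order
`-2`. -/
theorem exists_sym_stepDiag {α β : ℝ} (hα : -1 / 2 ≤ α) (hβ : -1 / 2 ≤ β) (i j M : ℕ) :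
    ∃ K : ℝ, 0 ≤ K ∧ ∀ (r : ℤ) (D : ℝ) (g : ℕ → ℂ), Sym (M + 1) r D g →
      Sym M (r + -2) (K * D) (stepDiag α β i j g) := by
  have hi := i.cast_nonneg (α := ℝ)
  have hj := j.cast_nonneg (α := ℝ)
  have ci := isSymbol_recCn hα hβ i
  have ij := isSymbol_recCn_sub_recA hα hβ i j
  have jj := isSymbol_recCn_sub_recA hα hβ j j
  have ji := isSymbol_recCn_sub_recA hα hβ j i
  refine exists_sym_diffOp (p := -2) ?_ ?_ M
  · have t1 := (isSymbol_raiseDiag_sub (α + j) (α + i)).mul ci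
    have t2 := ((isSymbol_raiseDiag (α + i)).mul (ij.sub jj)).mono (p := -1) (by norm_num)
    norm_num at t1
    norm_num
    convert t1.add t2 using 2 with ν
    ring
  · have t1 := (isSymbol_raiseDiag (α + i)).mul ji
    have t2 := (isSymbol_raiseDiag (α + j)).mul ij
    have t3 := (isSymbol_recB (α := α + i) (β := β) (by linarith)).sub
      (isSymbol_recB (α := α + j) (β := β) (by linarith))
    norm_num at t1 t2
    convert (t2.sub t1).add t3 using 2 with ν
    ring

theorem exists_sym_stepLeft {α β : ℝ} (hα : -1 / 2 ≤ α) (hβ : -1 / 2 ≤ β) (i j M : ℕ) :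
    ∃ K : ℝ, 0 ≤ K ∧ ∀ (r : ℤ) (D : ℝ) (g : ℕ → ℂ), Sym (M + 1) r D g →
      Sym M (r + -1) (K * D) (stepLeft α β i j g) := by
  refine exists_sym_diffOp (p := -1) ?_ ?_ M
  · have t := (isSymbol_raiseShift (α + i) β).mul (isSymbol_recCn hα hβ j)
    norm_num at t
    norm_num
    exact t
  · have t := (isSymbol_raiseShift (α + i) β).mul (isSymbol_recCn_sub_recA hα hβ j i)
    exact t.mono (by norm_num)

theorem exists_sym_stepRight {α β : ℝ} (hα : -1 / 2 ≤ α) (hβ : -1 / 2 ≤ β) (i j M : ℕ) :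
    ∃ K : ℝ, 0 ≤ K ∧ ∀ (r : ℤ) (D : ℝ) (g : ℕ → ℂ), Sym (M + 1) r D g →
      Sym M (r + -1) (K * D) (stepRight α β i j g) := by
  refine exists_sym_diffOp (p := -1) ?_ ?_ M
  · have t := ((isSymbol_raiseShift (α + j) β).mul (isSymbol_recCn hα hβ i)).neg
    norm_num at t
    norm_num
    exact t
  · have t := ((isSymbol_raiseShift (α + j) β).mul (isSymbol_recCn_sub_recA hα hβ i j)).neg
    exact t.mono (by norm_num)

theorem uniW_comparable {α β : ℝ} (hα : -1 / 2 ≤ α) (hβ : -1 / 2 ≤ β) {n ν : ℕ} (hn : 1 ≤ n)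
    (hν : ν < 3 * n) {x : ℝ} (hx : x ∈ Set.Icc (-1 : ℝ) 1) :
    uniW α β n x ≤ 9 ^ (α + 1 / 2) * 9 ^ (β + 1 / 2) * uniW α β (ν + 1) x := by
  have hn0 : (0 : ℝ) < n := by exact_mod_cast hn
  -- The `9` is the square of the ratio in `ν + 1 ≤ 3n`; the kernel only involves `ν ≤ 2n`.
  have h1 : ((n : ℝ) ^ 2)⁻¹ ≤ 9 * (((ν + 1 : ℕ) : ℝ) ^ 2)⁻¹ := by
    have h2 : ((ν + 1 : ℕ) : ℝ) ≤ 3 * n := by exact_mod_cast hν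
    have h3 : (0 : ℝ) < ((ν + 1 : ℕ) : ℝ) := by positivity
    rw [← div_eq_mul_inv, inv_eq_one_div, div_le_div_iff₀ (by positivity) (by positivity)]
    nlinarith
  have h0 : 0 < ((n : ℝ) ^ 2)⁻¹ := by positivity
  have h0' : 0 < (((ν + 1 : ℕ) : ℝ) ^ 2)⁻¹ := by positivity
  unfold uniW
  rw [mul_mul_mul_comm, ← Real.mul_rpow (by norm_num) (by linarith [hx.2]),
    ← Real.mul_rpow (by norm_num) (by linarith [hx.1])]
  refine mul_le_mul (Real.rpow_le_rpow (by linarith [hx.2]) (by linarith [hx.2]) (by linarith))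
    (Real.rpow_le_rpow (by linarith [hx.1]) (by linarith [hx.1]) (by linarith))
    (Real.rpow_nonneg (by linarith [hx.1]) _) (Real.rpow_nonneg (by linarith [hx.2]) _)

theorem uniW_shift_ge {α β : ℝ} (i : ℕ) {n : ℕ} (hn : 1 ≤ n) {x : ℝ}
    (hx : x ∈ Set.Icc (-1 : ℝ) 1) :
    (1 - x) ^ i * uniW α β n x ≤ uniW (α + i) β n x := by
  have hn0 : (0 : ℝ) < n := by exact_mod_cast hn
  have h0 : 0 < ((n : ℝ) ^ 2)⁻¹ := by positivity
  have h1 : 0 < 1 - x + ((n : ℝ) ^ 2)⁻¹ := by linarith [hx.2]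
  have h2 : uniW (α + i) β n x = (1 - x + ((n : ℝ) ^ 2)⁻¹) ^ i * uniW α β n x := by
    unfold uniW
    rw [show α + i + 1 / 2 = α + 1 / 2 + i by ring, Real.rpow_add h1, Real.rpow_natCast]
    ring
  rw [h2]
  refine mul_le_mul_of_nonneg_right ?_ (uniW_pos α β hn hx).le
  exact pow_le_pow_left₀ (by linarith [hx.2]) (by linarith) i

/-- Of the two factors `(1-x)^i` in the square, one pays for passing from the weight of `(α, β)` to
that of `(α+i, β)`. The other survives, so each raise of the parameter is worth `√(1-x)`. -/
theorem exists_jet_sq_le {α β : ℝ} (hα : -1 / 2 ≤ α) (hβ : -1 / 2 ≤ β) (i : ℕ) :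
    ∃ C : ℝ, 0 < C ∧ ∀ (n ν : ℕ) (x : ℝ), 1 ≤ n → ν < 3 * n → x ∈ Set.Icc (-1 : ℝ) 1 →
      (jacobiNormSq α β ν)⁻¹ * ((1 - x) ^ i * jacobiP (α + i) β ν x) ^ 2 * uniW α β n x ≤
        C * (1 - x) ^ i := by
  have hi := i.cast_nonneg (α := ℝ)
  obtain ⟨C₁, hC₁, h₁⟩ := exists_jacobiP_sq_le (α := α + i) (β := β) (by linarith) hβ
  obtain ⟨C₂, hC₂, h₂⟩ := exists_normSq_shift_le hα hβ i
  set c : ℝ := 9 ^ (α + 1 / 2) * 9 ^ (β + 1 / 2)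
  have hc : 0 < c := by positivity
  refine ⟨c * (C₁ * C₂), by positivity, fun n ν x hn hν hx => ?_⟩
  have hσ := jacobiNormSq_pos (α := α) (β := β) (by linarith) (by linarith) ν
  have hx0 : 0 ≤ (1 - x) ^ i := pow_nonneg (by linarith [hx.2]) i
  have a1 := uniW_comparable hα hβ hn hν hx
  have a2 := uniW_shift_ge (α := α) (β := β) i (n := ν + 1) (by omega) hx
  have a3 := h₁ ν x hx
  have a4 := h₂ ν
  set p := jacobiP (α + i) β ν x
  set t := (1 - x) ^ i
  calc (jacobiNormSq α β ν)⁻¹ * (t * p) ^ 2 * uniW α β n x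
      ≤ (jacobiNormSq α β ν)⁻¹ * (t * p) ^ 2 * (c * uniW α β (ν + 1) x) := by gcongr
    _ = (jacobiNormSq α β ν)⁻¹ * c * t * (p ^ 2 * (t * uniW α β (ν + 1) x)) := by ring
    _ ≤ (jacobiNormSq α β ν)⁻¹ * c * t * (p ^ 2 * uniW (α + i) β (ν + 1) x) := by gcongr
    _ ≤ (jacobiNormSq α β ν)⁻¹ * c * t * (C₁ * (C₂ * jacobiNormSq α β ν)) := by
        refine mul_le_mul_of_nonneg_left (a3.trans ?_) (by positivity)
        gcongr
    _ = _ := by field_simp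

end TensorJacobi
end

/-! ### Decay by repeated multiplication by `x - y` -/

noncomputable section

namespace TensorJacobi

open Finset

theorem exists_jet_mul_le {α β : ℝ} (hα : -1 / 2 ≤ α) (hβ : -1 / 2 ≤ β) (i j : ℕ) :
    ∃ C : ℝ, 0 < C ∧ ∀ (n ν : ℕ) (x y q : ℝ), 1 ≤ n → ν < 3 * n → x ∈ Set.Icc (-1 : ℝ) 1 →
      y ∈ Set.Icc (-1 : ℝ) 1 → 0 ≤ q → 1 - x ≤ q ^ 2 → 1 - y ≤ q ^ 2 →
      |(jacobiNormSq α β ν)⁻¹ * ((1 - x) ^ i * jacobiP (α + i) β ν x) *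
        ((1 - y) ^ j * jacobiP (α + j) β ν y)| ≤
      C * q ^ (i + j) / (√(uniW α β n x) * √(uniW α β n y)) := by
  obtain ⟨C₁, hC₁, h₁⟩ := exists_jet_sq_le hα hβ i
  obtain ⟨C₂, hC₂, h₂⟩ := exists_jet_sq_le hα hβ j
  refine ⟨√(C₁ * C₂), by positivity, fun n ν x y q hn hν hx hy hq hqx hqy => ?_⟩
  have wx := uniW_pos α β hn hx
  have wy := uniW_pos α β hn hy
  have a1 := h₁ n ν x hn hν hx
  have a2 := h₂ n ν y hn hν hy
  have hσ := jacobiNormSq_pos (α := α) (β := β) (by linarith) (by linarith) ν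
  have b1 : (1 - x) ^ i ≤ (q ^ 2) ^ i := pow_le_pow_left₀ (by linarith [hx.2]) hqx i
  have b2 : (1 - y) ^ j ≤ (q ^ 2) ^ j := pow_le_pow_left₀ (by linarith [hy.2]) hqy j
  set X := (1 - x) ^ i * jacobiP (α + i) β ν x
  set Y := (1 - y) ^ j * jacobiP (α + j) β ν y
  rw [le_div_iff₀ (by positivity), ← abs_of_nonneg (show 0 ≤ √(uniW α β n x) * √(uniW α β n y) by
    positivity), ← abs_mul]
  refine abs_le_of_sq_le_sq ?_ (by positivity)
  calc ((jacobiNormSq α β ν)⁻¹ * X * Y * (√(uniW α β n x) * √(uniW α β n y))) ^ 2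
      = ((jacobiNormSq α β ν)⁻¹ * X ^ 2 * uniW α β n x) *
        ((jacobiNormSq α β ν)⁻¹ * Y ^ 2 * uniW α β n y) := by
        rw [mul_pow, mul_pow (√(uniW α β n x)), Real.sq_sqrt wx.le, Real.sq_sqrt wy.le]
        ring
    _ ≤ (C₁ * (q ^ 2) ^ i) * (C₂ * (q ^ 2) ^ j) := by
        refine mul_le_mul (a1.trans (by gcongr)) (a2.trans (by gcongr)) (by positivity)
          (by positivity)
    _ = (√(C₁ * C₂) * q ^ (i + j)) ^ 2 := by
        rw [mul_pow, Real.sq_sqrt (by positivity)]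
        ring

/-- Each induction step spends one factor `x - y` and one difference of the symbol. A multiplication
can lower the order by two, so `2m ≤ r` keeps the final order nonnegative; the remaining sum of at
most `3n` terms is then of size `n^{r+1}`. -/
theorem exists_jetForm_bound {α β : ℝ} (hα : -1 / 2 ≤ α) (hβ : -1 / 2 ≤ β) (m : ℕ) :
    ∀ (i j : ℕ) (r : ℤ), 2 * (m : ℤ) ≤ r → ∃ C : ℝ, 0 ≤ C ∧
      ∀ (n : ℕ) (g : ℕ → ℂ) (D x y q : ℝ), 1 ≤ n → Sym m r D g → (∀ ν, 2 * n + 1 ≤ ν → g ν = 0) →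
        x ∈ Set.Icc (-1 : ℝ) 1 → y ∈ Set.Icc (-1 : ℝ) 1 → 1 - x ≤ q ^ 2 → 1 - y ≤ q ^ 2 →
        0 ≤ q → 1 ≤ n * q →
        |x - y| ^ m * ‖jetForm α β i j (2 * n + 1) x y g‖ ≤
          C * D * (n : ℝ) ^ (r + 1 - m) * q ^ (i + j + m) /
            (√(uniW α β n x) * √(uniW α β n y)) := by
  induction m with
  | zero =>
    intro i j r hr
    obtain ⟨C, hC, h⟩ := exists_jet_mul_le hα hβ i j
    refine ⟨C * 3 ^ (r + 1), by positivity, fun n g D x y q hn hg _ hx hy hqx hqy hq _ => ?_⟩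
    have hn0 : (0 : ℝ) < n := by exact_mod_cast hn
    have hn1 : (1 : ℝ) ≤ n := by exact_mod_cast hn
    have hD := hg.const_nonneg
    have wx := uniW_pos α β hn hx
    have wy := uniW_pos α β hn hy
    rw [pow_zero, one_mul]
    calc ‖jetForm α β i j (2 * n + 1) x y g‖
        ≤ ∑ ν ∈ range (2 * n + 1), C * q ^ (i + j) / (√(uniW α β n x) * √(uniW α β n y)) *
            (D * (3 * (n : ℝ)) ^ r) := by
          refine (norm_sum_le _ _).trans (sum_le_sum fun ν hν => ?_)
          have hν' : ν < 3 * n := by have := mem_range.mp hν; omega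
          rw [norm_smul]
          refine mul_le_mul (h n ν x y q hn hν' hx hy hq hqx hqy) ?_ (norm_nonneg _)
            (by positivity)
          refine (hg.bound ν).trans ?_
          have : (ν : ℝ) + 1 ≤ 3 * n := by exact_mod_cast hν'
          have := zpow_le_zpow_left₀ (show 0 ≤ r by simpa using hr) (by positivity) this
          gcongr
      _ = (2 * (n : ℝ) + 1) * (C * q ^ (i + j) / (√(uniW α β n x) * √(uniW α β n y)) *
            (D * (3 * (n : ℝ)) ^ r)) := by
          rw [sum_const, card_range, nsmul_eq_mul]
          push_cast
          ring
      _ ≤ (3 * (n : ℝ)) * (C * q ^ (i + j) / (√(uniW α β n x) * √(uniW α β n y)) *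
            (D * (3 * (n : ℝ)) ^ r)) := by
          refine mul_le_mul_of_nonneg_right (by linarith) (by positivity)
      _ = _ := by
          rw [Nat.cast_zero, sub_zero, add_zero, mul_zpow, zpow_add_one₀ hn0.ne',
            zpow_add_one₀ (by norm_num : (3 : ℝ) ≠ 0)]
          ring
  | succ m ih =>
    intro i j r hr
    push_cast at hr
    obtain ⟨K₀, hK₀, s₀⟩ := exists_sym_stepDiag hα hβ i j m
    obtain ⟨K₁, hK₁, s₁⟩ := exists_sym_stepLeft hα hβ i j m
    obtain ⟨K₂, hK₂, s₂⟩ := exists_sym_stepRight hα hβ i j m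
    obtain ⟨C₀, hC₀, h₀⟩ := ih i j (r + -2) (by omega)
    obtain ⟨C₁, hC₁, h₁⟩ := ih (i + 1) j (r + -1) (by omega)
    obtain ⟨C₂, hC₂, h₂⟩ := ih i (j + 1) (r + -1) (by omega)
    refine ⟨C₀ * K₀ + C₁ * K₁ + C₂ * K₂, by positivity,
      fun n g D x y q hn hg hsupp hx hy hqx hqy hq hnq => ?_⟩
    have hn0 : (0 : ℝ) < n := by exact_mod_cast hn
    have hD := hg.const_nonneg
    have wx := uniW_pos α β hn hx
    have wy := uniW_pos α β hn hy
    have b₀ := h₀ n _ _ x y q hn (s₀ r D g hg) (stepDiag_eq_zero hsupp) hx hy hqx hqy hq hnq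
    have b₁ := h₁ n _ _ x y q hn (s₁ r D g hg) (stepLeft_eq_zero hsupp) hx hy hqx hqy hq hnq
    have b₂ := h₂ n _ _ x y q hn (s₂ r D g hg) (stepRight_eq_zero hsupp) hx hy hqx hqy hq hnq
    have e₁ : r + -1 + 1 - (m : ℤ) = r + 1 - ((m + 1 : ℕ) : ℤ) := by push_cast; ring
    have e₀ : r + -2 + 1 - (m : ℤ) = r + 1 - ((m + 1 : ℕ) : ℤ) - 1 := by push_cast; ring
    rw [e₀, zpow_sub_one₀ hn0.ne'] at b₀
    rw [e₁, show i + 1 + j + m = i + j + (m + 1) by ring] at b₁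
    rw [e₁, show i + (j + 1) + m = i + j + (m + 1) by ring] at b₂
    -- The diagonal term gains `n^{-2}` but no factor `q`; one power of `1/n` is traded for the
    -- missing `q`.
    have hinv : (n : ℝ)⁻¹ ≤ q := by
      rw [inv_le_iff_one_le_mul₀ hn0]; linarith
    set S := √(uniW α β n x) * √(uniW α β n y)
    set N := (n : ℝ) ^ (r + 1 - ((m + 1 : ℕ) : ℤ))
    have hN : 0 < N := by positivity
    have hS : 0 < S := by positivity
    have b₀' : C₀ * (K₀ * D) * (N * (n : ℝ)⁻¹) * q ^ (i + j + m) / S ≤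
        C₀ * (K₀ * D) * N * q ^ (i + j + (m + 1)) / S := by
      refine div_le_div_of_nonneg_right ?_ hS.le
      calc C₀ * (K₀ * D) * (N * (n : ℝ)⁻¹) * q ^ (i + j + m)
          ≤ C₀ * (K₀ * D) * (N * q) * q ^ (i + j + m) := by gcongr
        _ = _ := by ring
    calc |x - y| ^ (m + 1) * ‖jetForm α β i j (2 * n + 1) x y g‖
        = |x - y| ^ m * ‖(x - y) • jetForm α β i j (2 * n + 1) x y g‖ := by
          rw [norm_smul, Real.norm_eq_abs]; ring
      _ ≤ |x - y| ^ m * (‖jetForm α β i j (2 * n + 1) x y (stepDiag α β i j g)‖ +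
            ‖jetForm α β (i + 1) j (2 * n + 1) x y (stepLeft α β i j g)‖ +
            ‖jetForm α β i (j + 1) (2 * n + 1) x y (stepRight α β i j g)‖) := by
          rw [sub_smul_jetForm hα hβ i j _ x y hsupp]
          gcongr
          exact norm_add₃_le
      _ ≤ C₀ * (K₀ * D) * N * q ^ (i + j + (m + 1)) / S +
            C₁ * (K₁ * D) * N * q ^ (i + j + (m + 1)) / S +
            C₂ * (K₂ * D) * N * q ^ (i + j + (m + 1)) / S := by
          rw [mul_add, mul_add]
          exact add_le_add_three (b₀.trans b₀') b₁ b₂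
      _ = _ := by ring

theorem recCn_zero {α β : ℝ} (hα : -1 < α) (hβ : -1 < β) (ν : ℕ) :
    recCn α β 0 ν = recA α β ν := by
  have := recC_ne_zero hα hβ ν
  simp only [recCn, Nat.cast_zero, add_zero]
  field_simp

/-- Localization of the kernel in terms of the symbol order of the first difference of the
multiplier. -/
theorem exists_kernel_decay {α β : ℝ} (hα : -1 / 2 ≤ α) (hβ : -1 / 2 ≤ β) (m : ℕ) (r : ℤ)
    (hr : 2 * (m : ℤ) ≤ r) : ∃ C : ℝ, 0 ≤ C ∧
      ∀ (n : ℕ) (g : ℕ → ℂ) (D x y q : ℝ), 1 ≤ n → Sym m r D (fun ν => g (ν + 1) - g ν) →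
        (∀ ν, 2 * n + 1 ≤ ν → g ν = 0) →
        x ∈ Set.Icc (-1 : ℝ) 1 → y ∈ Set.Icc (-1 : ℝ) 1 → 1 - x ≤ q ^ 2 → 1 - y ≤ q ^ 2 →
        0 ≤ q → 1 ≤ n * q →
        |x - y| ^ (m + 1) * ‖jetForm α β 0 0 (2 * n + 1) x y g‖ ≤
          C * D * (n : ℝ) ^ (r + 1 - m) * q ^ (m + 1) /
            (√(uniW α β n x) * √(uniW α β n y)) := by
  obtain ⟨C₁, hC₁, h₁⟩ := exists_jetForm_bound hα hβ m 1 0 r hr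
  obtain ⟨C₂, hC₂, h₂⟩ := exists_jetForm_bound hα hβ m 0 1 r hr
  obtain ⟨A, hA⟩ := ((isSymbol_raiseShift α β).mul
    (isSymbol_recA (α := α) (β := β) (by linarith))) m
  have hA0 := hA.const_nonneg
  refine ⟨(C₁ + C₂) * (3 ^ m * A), by positivity,
    fun n g D x y q hn hg hsupp hx hy hqx hqy hq hnq => ?_⟩
  have hD := hg.const_nonneg
  have z := recCn_zero (α := α) (β := β) (by linarith) (by linarith)
  have eL : stepLeft α β 0 0 g =
      fun ν => (raiseShift α β ν * recA α β ν) • (g (ν + 1) - g ν) := by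
    ext ν; simp [stepLeft, z]
  have eR : stepRight α β 0 0 g =
      fun ν => -((raiseShift α β ν * recA α β ν) • (g (ν + 1) - g ν)) := by
    ext ν; simp [stepRight, z]
  -- For `i = j = 0` the renormalized coefficient is exactly `recA`, so every term in `g` itself
  -- drops out. Only the difference of `g` remains, and it alone must obey symbol bounds.
  have eD : stepDiag α β 0 0 g = fun _ => 0 := by
    ext ν; simp [stepDiag, z]
  set f : ℕ → ℂ := fun ν => (raiseShift α β ν * recA α β ν) • (g (ν + 1) - g ν)
  have hf : Sym m r (3 ^ m * (A * D)) f :=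
    (hA.smul hg).mono (by norm_num) le_rfl
  have hf0 : ∀ ν, 2 * n + 1 ≤ ν → f ν = 0 := fun ν hν => by
    simp [f, hsupp ν hν, hsupp (ν + 1) (by omega)]
  have id1 := sub_smul_jetForm hα hβ 0 0 (2 * n + 1) x y hsupp
  have n2 : jetForm α β 0 1 (2 * n + 1) x y (fun ν => -f ν) =
      -jetForm α β 0 1 (2 * n + 1) x y f := by
    simp only [jetForm, smul_neg, sum_neg_distrib]
  have n0 : jetForm α β 0 0 (2 * n + 1) x y (fun _ => 0) = 0 := by simp [jetForm]
  rw [eL, eR, eD, zero_add, n2, n0, zero_add] at id1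
  have b₁ := h₁ n f _ x y q hn hf hf0 hx hy hqx hqy hq hnq
  have b₂ := h₂ n f _ x y q hn hf hf0 hx hy hqx hqy hq hnq
  calc |x - y| ^ (m + 1) * ‖jetForm α β 0 0 (2 * n + 1) x y g‖
      = |x - y| ^ m * ‖(x - y) • jetForm α β 0 0 (2 * n + 1) x y g‖ := by
        rw [norm_smul, Real.norm_eq_abs]; ring
    _ ≤ |x - y| ^ m * (‖jetForm α β 1 0 (2 * n + 1) x y f‖ +
          ‖jetForm α β 0 1 (2 * n + 1) x y f‖) := by
        rw [id1]
        gcongr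
        refine (norm_add_le _ _).trans ?_
        rw [norm_neg]
    _ ≤ _ := by
        rw [mul_add]
        refine (add_le_add b₁ b₂).trans (le_of_eq ?_)
        rw [show 1 + 0 + m = m + 1 by ring]
        ring

end TensorJacobi
end

/-! ### Univariate cutoffs and localization -/

noncomputable section

namespace TensorJacobi

open Finset Real

/-- `D m` is the `m`-th one-sided derivative of `D 0` on `[0,∞)`, for `m ≤ Q`. -/
def IsDerivFamily (Q : ℕ) (D : ℕ → ℝ → ℂ) : Prop :=
  ∀ m < Q, ∀ t, 0 ≤ t → HasDerivWithinAt (D m) (D (m + 1) t) (Set.Ici 0) t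

theorem IsDerivFamily.norm_sub_le {Q : ℕ} {D : ℕ → ℝ → ℂ} (h : IsDerivFamily Q D) {m : ℕ}
    (hm : m < Q) {a b B : ℝ} (ha : 0 ≤ a) (hab : a ≤ b)
    (hB : ∀ t ∈ Set.Icc a b, ‖D (m + 1) t‖ ≤ B) : ‖D m b - D m a‖ ≤ B * (b - a) := by
  have := Convex.norm_image_sub_le_of_norm_hasDerivWithin_le (s := Set.Icc a b) (f := D m)
    (f' := fun t => D (m + 1) t) (C := B)
    (fun t ht => (h m hm t (ha.trans ht.1)).mono fun s hs => ha.trans hs.1) hB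
    (convex_Icc a b) (Set.left_mem_Icc.mpr hab) (Set.right_mem_Icc.mpr hab)
  rwa [Real.norm_of_nonneg (sub_nonneg.mpr hab)] at this

/-- Descent from the top derivative by repeated use of the mean value inequality from `0`. This
makes a bound on that derivative alone sufficient. -/
theorem IsDerivFamily.norm_le_of_flat {Q : ℕ} {D : ℕ → ℝ → ℂ} (h : IsDerivFamily Q D) {B : ℝ}
    (hflat : ∀ m, 1 ≤ m → m ≤ Q → D m 0 = 0) (hB : ∀ t, 0 ≤ t → ‖D Q t‖ ≤ B) (l : ℕ) :
    ∀ m, 1 ≤ m → m + l = Q → ∀ t, 0 ≤ t → ‖D m t‖ ≤ B * t ^ l := by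
  have hB0 : 0 ≤ B := (norm_nonneg _).trans (hB 0 le_rfl)
  induction l with
  | zero =>
    intro m _ hm t ht
    rw [show m = Q by omega]
    simpa using hB t ht
  | succ l ih =>
    intro m hm1 hm t ht
    have h1 := h.norm_sub_le (m := m) (by omega) le_rfl ht (B := B * t ^ l) fun s hs => by
      refine (ih (m + 1) (by omega) (by omega) s hs.1).trans ?_
      have := pow_le_pow_left₀ hs.1 hs.2 l
      gcongr
    rw [hflat m hm1 (by omega), sub_zero, sub_zero] at h1
    rwa [pow_succ, ← mul_assoc]

theorem IsDerivFamily.diff {Q : ℕ} {D : ℕ → ℝ → ℂ} (h : IsDerivFamily Q D) :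
    IsDerivFamily Q (fun m t => D m (t + 1) - D m t) := by
  intro m hm t ht
  have h1 : HasDerivWithinAt (fun s => D m (s + 1)) (D (m + 1) (t + 1)) (Set.Ici 0) t := by
    have := (h m hm (t + 1) (by linarith)).scomp t
      (((hasDerivAt_id t).add_const 1).hasDerivWithinAt (s := Set.Ici 0))
      (fun s hs => by simp only [Set.mem_Ici, id] at *; linarith)
    exact this.congr_deriv (by simp)
  exact h1.sub (h m hm t ht)

theorem IsDerivFamily.scale {Q : ℕ} {D : ℕ → ℝ → ℂ} (h : IsDerivFamily Q D) {c : ℝ} (hc : 0 ≤ c) :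
    IsDerivFamily Q (fun m t => (c ^ m) • D m (c * t)) := by
  intro m hm t ht
  have := ((h m hm (c * t) (by positivity)).scomp t
      (((hasDerivAt_id t).const_mul c).hasDerivWithinAt (s := Set.Ici 0))
      (fun s hs => mul_nonneg hc hs)).const_smul (c ^ m)
  refine this.congr_deriv ?_
  simp only [mul_one, smul_smul, pow_succ]

theorem exists_sym_of_derivFamily (M : ℕ) : ∀ e : ℕ, M ≤ e → ∃ C : ℝ, 0 ≤ C ∧
    ∀ (D : ℕ → ℝ → ℂ) (B : ℝ), IsDerivFamily M D →
      (∀ m ≤ M, ∀ t, 0 ≤ t → ‖D m t‖ ≤ B * (t + 1) ^ (e - m)) →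
      Sym M (e : ℤ) (C * B) (fun ν => D 0 ν) := by
  induction M with
  | zero =>
    intro e _
    refine ⟨1, zero_le_one, fun D B _ hB ν => ?_⟩
    have := hB 0 le_rfl ν ν.cast_nonneg
    rw [one_mul, zpow_natCast]
    simpa using this
  | succ M ih =>
    intro e he
    obtain ⟨C, hC, h⟩ := ih (e - 1) (by omega)
    refine ⟨1 + C * 2 ^ e, by positivity, fun D B hD hB => ?_⟩
    have hB0 : 0 ≤ B := by
      have := (norm_nonneg _).trans (hB 0 (by omega) 0 le_rfl)
      simpa using this
    refine ⟨fun ν => ?_, ?_⟩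
    · have := hB 0 (by omega) ν ν.cast_nonneg
      rw [zpow_natCast]
      refine this.trans ?_
      rw [Nat.sub_zero]
      refine mul_le_mul_of_nonneg_right ?_ (by positivity)
      have : 0 ≤ C * 2 ^ e * B := by positivity
      linarith
    · have key := h (fun m t => D m (t + 1) - D m t) (2 ^ e * B)
        (fun m hm t ht => hD.diff m (by omega) t ht) (by
          intro m hm t ht
          have h1 := hD.norm_sub_le (m := m) (by omega) ht (show t ≤ t + 1 by linarith)
            (B := B * (2 * (t + 1)) ^ (e - (m + 1))) (fun s hs => by
              refine (hB (m + 1) (by omega) s (ht.trans hs.1)).trans ?_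
              have := pow_le_pow_left₀ (show 0 ≤ s + 1 by linarith [hs.1])
                (show s + 1 ≤ 2 * (t + 1) by linarith [hs.2]) (e - (m + 1))
              gcongr)
          refine h1.trans ?_
          rw [add_sub_cancel_left, mul_one, mul_pow, show e - (m + 1) = e - 1 - m by omega]
          have h2 : (2 : ℝ) ^ (e - 1 - m) ≤ 2 ^ e := pow_le_pow_right₀ (by norm_num) (by omega)
          have h3 : 0 ≤ B * (t + 1) ^ (e - 1 - m) := by positivity
          nlinarith)
      have e1 : ((e - 1 : ℕ) : ℤ) = (e : ℤ) - 1 := by omega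
      rw [e1] at key
      have key2 := key.mono le_rfl (show C * (2 ^ e * B) ≤ (1 + C * 2 ^ e) * B by nlinarith)
      convert key2 using 2
      push_cast
      rfl

/-- A one-variable cutoff: derivative family, flat at `0`, supported in `[0,2]`, with bounded top
derivative. -/
structure IsUniCutoff (k : ℕ) (B : ℝ) (D : ℕ → ℝ → ℂ) : Prop where
  family : IsDerivFamily (3 * k - 1) D
  flat : ∀ m, 1 ≤ m → m ≤ 3 * k - 1 → D m 0 = 0
  bound : ∀ t, 0 ≤ t → ‖D (3 * k - 1) t‖ ≤ B
  supp : ∀ t, 2 < t → D 0 t = 0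

theorem IsUniCutoff.norm_le {k : ℕ} (hk : 1 ≤ k) {B : ℝ} {D : ℕ → ℝ → ℂ} (h : IsUniCutoff k B D)
    {t : ℝ} (ht : 0 ≤ t) : ‖D 0 t‖ ≤ B * 3 ^ (3 * k - 1) := by
  have hB0 : 0 ≤ B := (norm_nonneg _).trans (h.bound 0 le_rfl)
  rcases lt_or_ge 2 t with h2 | h2
  · rw [h.supp t h2, norm_zero]; positivity
  -- The value at `0` is unrestricted, so the comparison is with the point `3`, beyond the support.
  · have h1 := h.family.norm_sub_le (m := 0) (by omega) ht (show t ≤ 3 by linarith)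
      (B := B * 3 ^ (3 * k - 2)) fun s hs => by
        refine (h.family.norm_le_of_flat h.flat h.bound (3 * k - 2) (0 + 1) le_rfl (by omega) s
          (ht.trans hs.1)).trans ?_
        have := pow_le_pow_left₀ (ht.trans hs.1) hs.2 (3 * k - 2)
        gcongr
    rw [h.supp 3 (by norm_num), zero_sub, norm_neg] at h1
    refine h1.trans ?_
    rw [show 3 * k - 1 = (3 * k - 2) + 1 by omega, pow_succ, ← mul_assoc]
    gcongr
    linarith

/-- By flatness the derivative of order `m + 1` of `t ↦ D 0 (t/n)` is at most `B n^{-(3k-1)}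
t^{3k-2-m}`; the powers of `n` do not depend on `m`. Mean values turn this into bounds for the
derivatives of the first difference, and then for its iterated differences. -/
theorem exists_sym_diff_cutoff {k : ℕ} (hk : 1 ≤ k) : ∃ C : ℝ, 0 ≤ C ∧
    ∀ (B : ℝ) (D : ℕ → ℝ → ℂ) (n : ℕ), IsUniCutoff k B D → 1 ≤ n →
      Sym (k - 1) (3 * k - 2 : ℕ) (C * (B * ((n : ℝ) ^ (3 * k - 1))⁻¹))
        (fun ν => D 0 (((ν + 1 : ℕ) : ℝ) / n) - D 0 ((ν : ℝ) / n)) := by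
  obtain ⟨C, hC, h⟩ := exists_sym_of_derivFamily (k - 1) (3 * k - 2) (by omega)
  refine ⟨C, hC, fun B D n hD hn => ?_⟩
  have hB0 : 0 ≤ B := (norm_nonneg _).trans (hD.bound 0 le_rfl)
  have hn0 : (0 : ℝ) < n := by exact_mod_cast hn
  have hc : (0 : ℝ) ≤ (n : ℝ)⁻¹ := by positivity
  have fam := hD.family.scale hc
  have key := h (fun m t => ((n : ℝ)⁻¹ ^ m) • D m ((n : ℝ)⁻¹ * (t + 1)) -
      ((n : ℝ)⁻¹ ^ m) • D m ((n : ℝ)⁻¹ * t)) (B * ((n : ℝ) ^ (3 * k - 1))⁻¹)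
    (fun m hm t ht => fam.diff m (by omega) t ht) (by
      intro m hm t ht
      have h1 := fam.norm_sub_le (m := m) (by omega) ht (show t ≤ t + 1 by linarith)
        (B := B * ((n : ℝ) ^ (3 * k - 1))⁻¹ * (t + 1) ^ (3 * k - 2 - m)) (fun s hs => by
          have hs0 := ht.trans hs.1
          have h2 := hD.family.norm_le_of_flat hD.flat hD.bound (3 * k - 2 - m) (m + 1) (by omega)
            (by omega) ((n : ℝ)⁻¹ * s) (by positivity)
          rw [norm_smul, Real.norm_of_nonneg (by positivity)]
          calc _ ≤ (n : ℝ)⁻¹ ^ (m + 1) * (B * ((n : ℝ)⁻¹ * s) ^ (3 * k - 2 - m)) := by gcongr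
            _ = B * ((n : ℝ) ^ (3 * k - 1))⁻¹ * s ^ (3 * k - 2 - m) := by
              rw [← inv_pow, show 3 * k - 1 = (m + 1) + (3 * k - 2 - m) by omega, mul_pow, pow_add]
              ring
            _ ≤ _ := by
              have := pow_le_pow_left₀ hs0 hs.2 (3 * k - 2 - m)
              gcongr)
      rwa [add_sub_cancel_left, mul_one] at h1)
  convert key using 2 with ν
  simp only [pow_zero, one_smul]
  push_cast
  rw [div_eq_inv_mul, div_eq_inv_mul]

theorem jetForm_neg (α β : ℝ) (K : ℕ) (x y : ℝ) (g : ℕ → ℂ) :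
    jetForm α β 0 0 K (-x) (-y) g = jetForm β α 0 0 K x y g := by
  unfold jetForm
  refine sum_congr rfl fun ν _ => ?_
  simp only [pow_zero, one_mul, Nat.cast_zero, add_zero, jacobiP_neg α β, jacobiNormSq_swap α β]
  congr 1
  have : ((-1 : ℝ) ^ ν) * (-1) ^ ν = 1 := by rw [← mul_pow]; norm_num
  linear_combination ((jacobiNormSq β α ν)⁻¹ * jacobiP β α ν x * jacobiP β α ν y) * this

/-- Write the difference of cosines as a product of sines and use Jordan's inequality; the
hypothesis keeps both half-angles within `π/2`. -/
theorem abs_sub_ge_arccos {x y : ℝ} (hx : x ∈ Set.Icc (-1 : ℝ) 1) (hy : y ∈ Set.Icc (-1 : ℝ) 1)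
    (h : arccos x + arccos y ≤ π) :
    2 / π ^ 2 * ((arccos x + arccos y) * |arccos x - arccos y|) ≤ |x - y| := by
  have hθ := arccos_nonneg x
  have hφ := arccos_nonneg y
  have hp := pi_pos
  have e : x - y = -2 * sin ((arccos x + arccos y) / 2) * sin ((arccos x - arccos y) / 2) := by
    rw [← cos_sub_cos, cos_arccos hx.1 hx.2, cos_arccos hy.1 hy.2]
  have h1 : 2 / π * ((arccos x + arccos y) / 2) ≤ sin ((arccos x + arccos y) / 2) :=
    mul_le_sin (by linarith) (by linarith)
  have h2 : 2 / π * (|arccos x - arccos y| / 2) ≤ |sin ((arccos x - arccos y) / 2)| := by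
    have h3 : |arccos x - arccos y| ≤ π := by
      rw [abs_le]; constructor <;> linarith
    have h4 := mul_le_sin (x := |arccos x - arccos y| / 2) (by positivity) (by linarith)
    refine h4.trans ?_
    rcases abs_choice (arccos x - arccos y) with h5 | h5 <;> rw [h5]
    · exact le_abs_self _
    · rw [neg_div, sin_neg]; exact neg_le_abs _
  rw [e, abs_mul, abs_mul, abs_of_nonneg ((by positivity : (0 : ℝ) ≤ _).trans h1)]
  norm_num
  calc _ = 2 * (2 / π * ((arccos x + arccos y) / 2)) * (2 / π * (|arccos x - arccos y| / 2)) := by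
        field_simp
    _ ≤ _ := by
        have h3 : 0 ≤ 2 / π * ((arccos x + arccos y) / 2) := by positivity
        have h4 : 0 ≤ sin ((arccos x + arccos y) / 2) := h3.trans h1
        gcongr

theorem one_sub_le_arccos_sq {x : ℝ} (hx : x ∈ Set.Icc (-1 : ℝ) 1) : 1 - x ≤ arccos x ^ 2 := by
  have h := one_sub_sq_div_two_le_cos (x := arccos x)
  rw [cos_arccos hx.1 hx.2] at h
  nlinarith [sq_nonneg (arccos x)]

theorem exists_uni_bound_of_add_le {α β : ℝ} (hα : -1 / 2 ≤ α) (hβ : -1 / 2 ≤ β) {k : ℕ}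
    (hk : 1 ≤ k) : ∃ C : ℝ, 0 ≤ C ∧
    ∀ (B : ℝ) (D : ℕ → ℝ → ℂ) (n : ℕ) (x y : ℝ), IsUniCutoff k B D → 1 ≤ n →
      x ∈ Set.Icc (-1 : ℝ) 1 → y ∈ Set.Icc (-1 : ℝ) 1 → arccos x + arccos y ≤ π →
      (1 + n * |arccos x - arccos y|) ^ k *
        ‖jetForm α β 0 0 (2 * n + 1) x y (fun ν => D 0 ((ν : ℝ) / n))‖ ≤
      C * B * n / (√(uniW α β n x) * √(uniW α β n y)) := by
  obtain ⟨C₀, hC₀, h₀⟩ := exists_jetForm_bound hα hβ 0 0 0 0 (by norm_num)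
  obtain ⟨C₁, hC₁, h₁⟩ := exists_kernel_decay hα hβ (k - 1) ((3 * k - 2 : ℕ) : ℤ) (by omega)
  obtain ⟨C₂, hC₂, h₂⟩ := exists_sym_diff_cutoff hk
  have hp := pi_pos
  refine ⟨2 ^ k * (C₀ * 3 ^ (3 * k - 1)) + 2 ^ k * ((π ^ 2 / 2) ^ k * (C₁ * C₂)), by positivity,
    fun B D n x y hD hn hx hy hxy => ?_⟩
  have hB0 : 0 ≤ B := (norm_nonneg _).trans (hD.bound 0 le_rfl)
  have hn0 : (0 : ℝ) < n := by exact_mod_cast hn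
  have hn1 : (1 : ℝ) ≤ n := by exact_mod_cast hn
  have wx := uniW_pos α β hn hx
  have wy := uniW_pos α β hn hy
  have hsupp : ∀ ν : ℕ, 2 * n + 1 ≤ ν → D 0 ((ν : ℝ) / n) = 0 := fun ν hν => by
    refine hD.supp _ ?_
    rw [lt_div_iff₀ hn0]
    exact_mod_cast (by omega : 2 * n < ν)
  set S := √(uniW α β n x) * √(uniW α β n y)
  have hS : 0 < S := by positivity
  set J := jetForm α β 0 0 (2 * n + 1) x y (fun ν => D 0 ((ν : ℝ) / n))
  set ρ := |arccos x - arccos y|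
  have hρ : 0 ≤ ρ := abs_nonneg _
  have split : ∀ a b : ℝ, 0 ≤ a → 0 ≤ b →
      (a + b) * B * n / S = a * B * n / S + b * B * n / S := fun a b _ _ => by ring
  rw [split _ _ (by positivity) (by positivity)]
  rcases le_total ((n : ℝ) * ρ) 1 with hsmall | hlarge
  -- Close points need only the size of the kernel. With `m = i = j = 0` the parameter `q` enters to
  -- the power zero, so any admissible value such as `2` will do.
  · have b := h₀ n (fun ν => D 0 ((ν : ℝ) / n)) (B * 3 ^ (3 * k - 1)) x y 2 hn
      (fun ν => by simpa using hD.norm_le hk (t := (ν : ℝ) / n) (by positivity)) hsupp hx hy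
      (by linarith [hx.1]) (by linarith [hy.1]) (by norm_num) (by linarith)
    norm_num at b
    have b2 : (1 + (n : ℝ) * ρ) ^ k ≤ 2 ^ k := pow_le_pow_left₀ (by positivity) (by linarith) k
    have b3 : 0 ≤ 2 ^ k * ((π ^ 2 / 2) ^ k * (C₁ * C₂)) * B * n / S := by positivity
    calc (1 + (n : ℝ) * ρ) ^ k * ‖J‖ ≤ 2 ^ k * (C₀ * (B * 3 ^ (3 * k - 1)) * n / S) := by
          exact mul_le_mul b2 b (norm_nonneg _) (by positivity)
      _ = 2 ^ k * (C₀ * 3 ^ (3 * k - 1)) * B * n / S := by ring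
      _ ≤ _ := by linarith
  · set q := arccos x + arccos y with hq
    have hθ := arccos_nonneg x
    have hφ := arccos_nonneg y
    have hρq : ρ ≤ q := by
      rw [abs_le]; constructor <;> linarith
    have hρ0 : 0 < ρ := by
      by_contra hcon
      have : ρ = 0 := le_antisymm (not_lt.mp hcon) hρ
      rw [this, mul_zero] at hlarge
      linarith
    have hq0 : 0 < q := hρ0.trans_le hρq
    have b := h₁ n (fun ν => D 0 ((ν : ℝ) / n)) _ x y q hn (h₂ B D n hD hn) hsupp hx hy
      ((one_sub_le_arccos_sq hx).trans (pow_le_pow_left₀ hθ (by linarith) 2))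
      ((one_sub_le_arccos_sq hy).trans (pow_le_pow_left₀ hφ (by linarith) 2)) hq0.le
      (hlarge.trans (by gcongr))
    -- The factor `n^{3k-1}` cancels the constant of the cutoff symbol; the rest is `n` times the
    -- desired `n^{-k}`.
    have hN : (n : ℝ) ^ (((3 * k - 2 : ℕ) : ℤ) + 1 - ((k - 1 : ℕ) : ℤ)) =
        n ^ (3 * k - 1) * (n * ((n : ℝ) ^ k)⁻¹) := by
      rw [show ((3 * k - 2 : ℕ) : ℤ) + 1 - ((k - 1 : ℕ) : ℤ) =
        ((3 * k - 1 : ℕ) : ℤ) + (1 - (k : ℤ)) by omega, zpow_add₀ hn0.ne', zpow_sub₀ hn0.ne',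
        zpow_natCast, zpow_natCast, zpow_one, div_eq_mul_inv]
    rw [Nat.sub_add_cancel hk, hN] at b
    have lower : (2 / π ^ 2 * (q * ρ)) ^ k ≤ |x - y| ^ k :=
      pow_le_pow_left₀ (by positivity) (abs_sub_ge_arccos hx hy hxy) k
    have c1 : (2 / π ^ 2 * (q * ρ)) ^ k * ‖J‖ ≤
        C₁ * C₂ * B * (n * ((n : ℝ) ^ k)⁻¹) * q ^ k / S := by
      refine (mul_le_mul_of_nonneg_right lower (norm_nonneg _)).trans (b.trans (le_of_eq ?_))
      field_simp
      simp only [S]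
      ring
    have c2 : ((n : ℝ) * ρ) ^ k * ‖J‖ ≤ (π ^ 2 / 2) ^ k * (C₁ * C₂) * B * n / S := by
      have hfac : 0 < (2 / π ^ 2 * q) ^ k * ((n : ℝ) ^ k)⁻¹ := by positivity
      refine le_of_mul_le_mul_left ?_ hfac
      calc (2 / π ^ 2 * q) ^ k * ((n : ℝ) ^ k)⁻¹ * (((n : ℝ) * ρ) ^ k * ‖J‖)
          = (2 / π ^ 2 * (q * ρ)) ^ k * ‖J‖ := by
            simp only [mul_pow]
            field_simp
        _ ≤ _ := c1
        _ = _ := by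
            simp only [mul_pow, div_pow]
            field_simp
    have c3 : (1 + (n : ℝ) * ρ) ^ k ≤ 2 ^ k * ((n : ℝ) * ρ) ^ k := by
      rw [← mul_pow]
      exact pow_le_pow_left₀ (by positivity) (by linarith) k
    have b3 : 0 ≤ 2 ^ k * (C₀ * 3 ^ (3 * k - 1)) * B * n / S := by positivity
    calc (1 + (n : ℝ) * ρ) ^ k * ‖J‖ ≤ 2 ^ k * ((n : ℝ) * ρ) ^ k * ‖J‖ := by gcongr
      _ = 2 ^ k * (((n : ℝ) * ρ) ^ k * ‖J‖) := by ring
      _ ≤ 2 ^ k * ((π ^ 2 / 2) ^ k * (C₁ * C₂) * B * n / S) := by gcongr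
      _ = 2 ^ k * ((π ^ 2 / 2) ^ k * (C₁ * C₂)) * B * n / S := by ring
      _ ≤ _ := by linarith

/-- Localization of univariate kernels. -/
theorem exists_uni_bound {α β : ℝ} (hα : -1 / 2 ≤ α) (hβ : -1 / 2 ≤ β) {k : ℕ} (hk : 1 ≤ k) :
    ∃ C : ℝ, 0 ≤ C ∧
    ∀ (B : ℝ) (D : ℕ → ℝ → ℂ) (n : ℕ) (x y : ℝ), IsUniCutoff k B D → 1 ≤ n →
      x ∈ Set.Icc (-1 : ℝ) 1 → y ∈ Set.Icc (-1 : ℝ) 1 →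
      (1 + n * |arccos x - arccos y|) ^ k *
        ‖jetForm α β 0 0 (2 * n + 1) x y (fun ν => D 0 ((ν : ℝ) / n))‖ ≤
      C * B * n / (√(uniW α β n x) * √(uniW α β n y)) := by
  obtain ⟨C₁, hC₁, h₁⟩ := exists_uni_bound_of_add_le hα hβ hk
  obtain ⟨C₂, hC₂, h₂⟩ := exists_uni_bound_of_add_le hβ hα hk
  refine ⟨C₁ + C₂, by positivity, fun B D n x y hD hn hx hy => ?_⟩
  have hB0 : 0 ≤ B := (norm_nonneg _).trans (hD.bound 0 le_rfl)
  have mono : ∀ c, c ≤ C₁ + C₂ → c * B * n / (√(uniW α β n x) * √(uniW α β n y)) ≤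
      (C₁ + C₂) * B * n / (√(uniW α β n x) * √(uniW α β n y)) := fun c hc => by gcongr
  rcases le_total (arccos x + arccos y) π with h | h
  · exact (h₁ B D n x y hD hn hx hy h).trans (mono _ (by linarith))
  -- Reflection replaces each angle by its supplement and exchanges `α` and `β`.
  · have key := h₂ B D n (-x) (-y) hD hn ⟨by linarith [hx.2], by linarith [hx.1]⟩
      ⟨by linarith [hy.2], by linarith [hy.1]⟩ (by rw [arccos_neg, arccos_neg]; linarith)
    rw [jetForm_neg, uniW_neg, uniW_neg, arccos_neg, arccos_neg, sub_sub_sub_cancel_left,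
      abs_sub_comm] at key
    exact key.trans (mono _ (by linarith))

end TensorJacobi
end

/-! ### Multivariate cutoffs along coordinate lines -/

noncomputable section

namespace TensorJacobi

open Function

variable {d : ℕ}

theorem update_mem_orthant {t : Fin d → ℝ} (ht : t ∈ orthant d) (ℓ : Fin d) {s : ℝ} (hs : 0 ≤ s) :
    update t ℓ s ∈ orthant d := by
  intro j
  rcases eq_or_ne j ℓ with rfl | hj
  · simpa using hs
  · simpa [hj] using ht j

theorem contDiffOn_comp_update {N : ℕ∞ω} {A : (Fin d → ℝ) → ℂ} (hA : ContDiffOn ℝ N A (orthant d))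
    {t : Fin d → ℝ} (ht : t ∈ orthant d) (ℓ : Fin d) :
    ContDiffOn ℝ N (fun s => A (update t ℓ s)) (Set.Ici 0) :=
  hA.comp (contDiff_update N t ℓ).contDiffOn fun _ hs => update_mem_orthant ht ℓ hs

theorem partialD_update (ℓ : Fin d) (m : ℕ) (A : (Fin d → ℝ) → ℂ) (t : Fin d → ℝ) (s : ℝ) :
    partialD ℓ m A (update t ℓ s) =
      iteratedDerivWithin m (fun s => A (update t ℓ s)) (Set.Ici 0) s := by
  simp [partialD]

/-- The restriction of a multivariate cutoff to a line parallel to a coordinate axis. -/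
theorem IsCutoff.isUniCutoff {k : ℕ} {A : (Fin d → ℝ) → ℂ} (hA : IsCutoff k A) {B : ℝ} {ℓ : Fin d}
    (hB : ∀ t ∈ orthant d, ‖partialD ℓ (3 * k - 1) A t‖ ≤ B) {t : Fin d → ℝ} (ht : t ∈ orthant d)
    (ht2 : ∀ j, t j ≤ 2) :
    IsUniCutoff k B fun m s => iteratedDerivWithin m (fun s => A (update t ℓ s)) (Set.Ici 0) s where
  family m hm s hs := by
    have h := (contDiffOn_comp_update hA.contDiffOn ht ℓ).differentiableOn_iteratedDerivWithin
      (m := m) (by exact_mod_cast hm) (uniqueDiffOn_Ici 0) s hs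
    simp only [iteratedDerivWithin_succ]
    exact h.hasDerivWithinAt
  flat m h1 hm := by
    rw [← partialD_update]
    refine hA.boundary ℓ _ (update_mem_orthant ht ℓ le_rfl) (fun j => ?_) (by simp) m h1 hm
    rcases eq_or_ne j ℓ with rfl | hj
    · simp
    · simpa [hj] using ht2 j
  bound s hs := by
    rw [← partialD_update]
    exact hB _ (update_mem_orthant ht ℓ hs)
  supp s hs := by
    rw [iteratedDerivWithin_zero]
    by_contra h
    have := hA.supp _ (update_mem_orthant ht ℓ (by linarith)) h ℓ
    rw [update_self] at this
    linarith

theorem uniqueDiffOn_orthant (d : ℕ) : UniqueDiffOn ℝ (orthant d) := by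
  have : orthant d = Set.univ.pi fun _ => Set.Ici 0 := by
    ext t
    simp only [orthant, Set.mem_ofPred_eq, Set.mem_univ_pi, Set.mem_Ici]
  rw [this]
  exact UniqueDiffOn.univ_pi fun _ => uniqueDiffOn_Ici 0

/-- Iterated directional derivatives along a coordinate axis, relative to the orthant. -/
def axisDeriv (ℓ : Fin d) (A : (Fin d → ℝ) → ℂ) : ℕ → (Fin d → ℝ) → ℂ
  | 0 => A
  | m + 1 => fun t => fderivWithin ℝ (axisDeriv ℓ A m) (orthant d) t (Pi.single ℓ 1)

theorem contDiffOn_axisDeriv {A : (Fin d → ℝ) → ℂ} (hA : ContDiffOn ℝ ∞ A (orthant d)) (ℓ : Fin d)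
    (m : ℕ) : ContDiffOn ℝ ∞ (axisDeriv ℓ A m) (orthant d) := by
  induction m with
  | zero => exact hA
  | succ m ih =>
    exact (ih.fderivWithin (uniqueDiffOn_orthant d) (by simp)).clm_apply contDiffOn_const

/-- The one-variable derivatives carry no joint continuity by definition; the directional ones do,
which compactness will require. -/
theorem partialD_eq_axisDeriv {A : (Fin d → ℝ) → ℂ} (hA : ContDiffOn ℝ ∞ A (orthant d)) (ℓ : Fin d)
    (m : ℕ) : ∀ t ∈ orthant d, partialD ℓ m A t = axisDeriv ℓ A m t := by
  induction m with
  | zero => intro t _; simp [partialD, axisDeriv]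
  | succ m ih =>
    intro t ht
    have h1 : Set.EqOn (iteratedDerivWithin m (fun s => A (update t ℓ s)) (Set.Ici 0))
        (fun s => axisDeriv ℓ A m (update t ℓ s)) (Set.Ici 0) := fun s hs => by
      rw [← partialD_update, ih _ (update_mem_orthant ht ℓ hs)]
    have h2 := ((contDiffOn_axisDeriv hA ℓ m).differentiableOn (by simp) t ht).hasFDerivWithinAt
    rw [← update_eq_self ℓ t] at h2
    have h3 := h2.comp_hasDerivWithinAt (t ℓ) (hasDerivAt_update t ℓ (t ℓ)).hasDerivWithinAt
      (s := Set.Ici 0) fun s hs => update_mem_orthant ht ℓ hs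
    rw [update_eq_self] at h3
    rw [partialD, iteratedDerivWithin_succ, derivWithin_congr h1 (h1 (ht ℓ))]
    exact h3.derivWithin (uniqueDiffOn_Ici 0 _ (ht ℓ))

theorem axisDeriv_eq_zero {A : (Fin d → ℝ) → ℂ} (hA : SuppInCube A) (ℓ : Fin d) (m : ℕ)
    {j : Fin d} : ∀ t ∈ orthant d, 2 < t j → axisDeriv ℓ A m t = 0 := by
  induction m with
  | zero =>
    intro t ht hj
    by_contra h
    exact absurd (hA t ht h j) (not_le.mpr hj)
  | succ m ih =>
    intro t ht hj
    have h : axisDeriv ℓ A m =ᶠ[nhdsWithin t (orthant d)] fun _ => 0 := by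
      have hopen : ∀ᶠ u in nhds t, 2 < u j :=
        (continuous_apply j).continuousAt.eventually (lt_mem_nhds hj)
      filter_upwards [hopen.filter_mono nhdsWithin_le_nhds, self_mem_nhdsWithin] with u hu hu'
      exact ih u hu' hu
    simp only [axisDeriv]
    rw [h.fderivWithin_eq (ih t ht hj)]
    simp

/-- Continuity bounds the derivative on the compact cube, and it vanishes on the rest of the
orthant. -/
theorem IsAdmissible.exists_partialD_bound {A : (Fin d → ℝ) → ℂ} (hA : IsAdmissible A) (ℓ : Fin d)
    (m : ℕ) : ∃ M : ℝ, ∀ t ∈ orthant d, ‖partialD ℓ m A t‖ ≤ M := by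
  have hsub : Set.Icc (0 : Fin d → ℝ) (fun _ => 2) ⊆ orthant d := fun t ht j => ht.1 j
  obtain ⟨M, hM⟩ := isCompact_Icc.exists_bound_of_continuousOn
    ((contDiffOn_axisDeriv hA.contDiffOn ℓ m).continuousOn.mono hsub)
  refine ⟨max M 0, fun t ht => ?_⟩
  rw [partialD_eq_axisDeriv hA.contDiffOn ℓ m t ht]
  by_cases h : ∀ j, t j ≤ 2
  · exact (hM t ⟨ht, h⟩).trans (le_max_left _ _)
  · push Not at h
    obtain ⟨j, hj⟩ := h
    rw [axisDeriv_eq_zero hA.supp ℓ m t ht hj, norm_zero]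
    exact le_max_right _ _

theorem IsAdmissible.isCutoff {A : (Fin d → ℝ) → ℂ} (hA : IsAdmissible A) (k : ℕ) :
    IsCutoff k A where
  contDiffOn := hA.contDiffOn.of_le (by exact_mod_cast le_top)
  supp := hA.supp
  boundary ℓ t ht _ h0 m h1 _ := hA.boundary ℓ t ht h0 m h1

end TensorJacobi
end

/-! ### Tensor products and conclusion -/

noncomputable section

namespace TensorJacobi

open Finset Function

/-- A sum over a cube is the average of its sums along the lines parallel to a coordinate axis. -/
theorem sum_cube_eq_average {d : ℕ} (K : ℕ) (ℓ : Fin d) (F : (Fin d → ℕ) → ℂ) :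
    ∑ ν ∈ Fintype.piFinset fun _ => range K, ∑ s ∈ range K, F (update ν ℓ s) =
      (K : ℂ) * ∑ ν ∈ Fintype.piFinset fun _ => range K, F ν := by
  have hmem : ∀ ν ∈ Fintype.piFinset fun _ : Fin d => range K, ∀ s ∈ range K,
      update ν ℓ s ∈ Fintype.piFinset fun _ : Fin d => range K := by
    intro ν hν s hs
    rw [Fintype.mem_piFinset] at hν ⊢
    intro j
    rcases eq_or_ne j ℓ with rfl | hj
    · simpa using hs
    · simpa [hj] using hν j
  have key : ∑ p ∈ (Fintype.piFinset fun _ => range K) ×ˢ range K, F (update p.1 ℓ p.2) =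
      ∑ p ∈ (Fintype.piFinset fun _ : Fin d => range K) ×ˢ range K, F p.1 := by
    -- Exchanging the `ℓ`-th entry with `s` is an involution of the index set.
    refine sum_nbij' (fun p => (update p.1 ℓ p.2, p.1 ℓ)) (fun p => (update p.1 ℓ p.2, p.1 ℓ))
      ?_ ?_ ?_ ?_ ?_
    · rintro ⟨ν, s⟩ h
      rw [mem_product] at h ⊢
      exact ⟨hmem ν h.1 s h.2, Fintype.mem_piFinset.mp h.1 ℓ⟩
    · rintro ⟨ν, s⟩ h
      rw [mem_product] at h ⊢
      exact ⟨hmem ν h.1 s h.2, Fintype.mem_piFinset.mp h.1 ℓ⟩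
    · rintro ⟨ν, s⟩ _; simp
    · rintro ⟨ν, s⟩ _; simp
    · rintro ⟨ν, s⟩ _; rfl
  rw [sum_product, sum_product] at key
  rw [key, mul_sum]
  simp

theorem bigW_eq_prod {d : ℕ} (α β : Fin d → ℝ) (n : ℕ) (x : Fin d → ℝ) :
    bigW α β n x = ∏ j, uniW (α j) (β j) n (x j) := rfl

theorem jacobiPn_mul_jacobiPn {α β : ℝ} (hα : -1 < α) (hβ : -1 < β) (ν : ℕ) (x y : ℝ) :
    jacobiPn α β ν x * jacobiPn α β ν y =
      (jacobiNormSq α β ν)⁻¹ * jacobiP α β ν x * jacobiP α β ν y := by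
  have h := Real.mul_self_sqrt (jacobiNormSq_pos hα hβ ν).le
  rw [jacobiPn, jacobiPn, ← h, mul_inv, h]
  ring

theorem kernel_eq_sum {d : ℕ} {α β : Fin d → ℝ} (hα : ∀ j, -1 < α j) (hβ : ∀ j, -1 < β j)
    {A : (Fin d → ℝ) → ℂ} (hA : SuppInCube A) {n : ℕ} (hn : 1 ≤ n) (x y : Fin d → ℝ) :
    kernel α β A n x y = ∑ ν ∈ Fintype.piFinset fun _ => range (2 * n + 1),
      (∏ j, (jacobiNormSq (α j) (β j) (ν j))⁻¹ * jacobiP (α j) (β j) (ν j) (x j) *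
        jacobiP (α j) (β j) (ν j) (y j)) • A fun j => (ν j : ℝ) / n := by
  have hn0 : (0 : ℝ) < n := by exact_mod_cast hn
  rw [kernel, tsum_eq_sum (s := Fintype.piFinset fun _ => range (2 * n + 1))]
  · refine sum_congr rfl fun ν _ => ?_
    rw [mul_assoc, mul_comm, ← Complex.ofReal_mul, tensorJacobi, tensorJacobi, ← prod_mul_distrib,
      Complex.real_smul]
    simp only [jacobiPn_mul_jacobiPn (hα _) (hβ _)]
  · intro ν hν
    rw [mul_assoc]
    refine mul_eq_zero_of_left ?_ _
    by_contra h
    refine hν (Fintype.mem_piFinset.mpr fun j => ?_)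
    have := hA _ (fun j => by positivity) h j
    rw [div_le_iff₀ hn0] at this
    have : ν j ≤ 2 * n := by exact_mod_cast this
    rw [mem_range]
    omega

theorem rho_nonneg {d : ℕ} (x y : Fin d → ℝ) : 0 ≤ rho x y :=
  Real.iSup_nonneg fun _ => abs_nonneg _

/-- Localization along the coordinate in which two points are farthest apart. -/
theorem exists_tensor_bound {d : ℕ} {α β : Fin d → ℝ} (hα : ∀ j, -1 / 2 ≤ α j)
    (hβ : ∀ j, -1 / 2 ≤ β j) {k : ℕ} (hk : 1 ≤ k) (ℓ : Fin d) :
    ∃ C : ℝ, 0 ≤ C ∧ ∀ (B : ℝ) (A : (Fin d → ℝ) → ℂ), IsCutoff k A →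
      (∀ t ∈ orthant d, ‖partialD ℓ (3 * k - 1) A t‖ ≤ B) →
      ∀ (n : ℕ) (x y : Fin d → ℝ), 1 ≤ n → x ∈ Set.Icc (-1 : Fin d → ℝ) 1 →
        y ∈ Set.Icc (-1 : Fin d → ℝ) 1 →
        (1 + n * |Real.arccos (x ℓ) - Real.arccos (y ℓ)|) ^ k * ‖kernel α β A n x y‖ ≤
          C * B * n ^ d / (√(bigW α β n x) * √(bigW α β n y)) := by
  choose c hc hjet using fun j => exists_jet_mul_le (hα j) (hβ j) 0 0
  obtain ⟨U, hU, huni⟩ := exists_uni_bound (hα ℓ) (hβ ℓ) hk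
  have hP : 0 ≤ ∏ j ∈ univ.erase ℓ, c j := prod_nonneg fun j _ => (hc j).le
  refine ⟨3 ^ d * (U * ∏ j ∈ univ.erase ℓ, c j), by positivity,
    fun B A hA hB n x y hn hx hy => ?_⟩
  have hn0 : (0 : ℝ) < n := by exact_mod_cast hn
  have hB0 : 0 ≤ B := (norm_nonneg _).trans (hB 0 fun _ => le_rfl)
  have hxj : ∀ j, x j ∈ Set.Icc (-1 : ℝ) 1 := fun j => ⟨hx.1 j, hx.2 j⟩
  have hyj : ∀ j, y j ∈ Set.Icc (-1 : ℝ) 1 := fun j => ⟨hy.1 j, hy.2 j⟩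
  set K := 2 * n + 1 with hK
  set R := (1 + n * |Real.arccos (x ℓ) - Real.arccos (y ℓ)|) ^ k
  have hR : 0 ≤ R := by positivity
  set G : Fin d → ℕ → ℝ := fun j ν => (jacobiNormSq (α j) (β j) ν)⁻¹ *
    jacobiP (α j) (β j) ν (x j) * jacobiP (α j) (β j) ν (y j) with hG
  set w : Fin d → ℝ := fun j => √(uniW (α j) (β j) n (x j)) * √(uniW (α j) (β j) n (y j)) with hw
  have hw0 : ∀ j, 0 < w j := fun j => mul_pos
    (Real.sqrt_pos.mpr (uniW_pos _ _ hn (hxj j))) (Real.sqrt_pos.mpr (uniW_pos _ _ hn (hyj j)))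
  have hW : √(bigW α β n x) * √(bigW α β n y) = w ℓ * ∏ j ∈ univ.erase ℓ, w j := by
    rw [mul_prod_erase univ w (mem_univ ℓ), prod_mul_distrib, bigW_eq_prod, bigW_eq_prod,
      Real.sqrt_prod _ fun j _ => (uniW_pos _ _ hn (hxj j)).le,
      Real.sqrt_prod _ fun j _ => (uniW_pos _ _ hn (hyj j)).le]
  have hGle : ∀ j, ∀ ν < K, |G j ν| ≤ c j / w j := by
    intro j ν hν
    have := hjet j n ν (x j) (y j) 2 hn (by omega) (hxj j) (hyj j) (by norm_num)
      (by linarith [(hxj j).1]) (by linarith [(hyj j).1])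
    simpa [hG] using this
  have line : ∀ ν ∈ Fintype.piFinset fun _ : Fin d => range K,
      R * ‖∑ s ∈ range K, (∏ j, G j (update ν ℓ s j)) •
        A fun j => ((update ν ℓ s j : ℕ) : ℝ) / n‖ ≤
      U * B * n / w ℓ * ∏ j ∈ univ.erase ℓ, (c j / w j) := by
    intro ν hν
    have hν' : ∀ j, ν j < K := fun j => mem_range.mp (Fintype.mem_piFinset.mp hν j)
    set t : Fin d → ℝ := fun j => (ν j : ℝ) / n
    have ht2 : ∀ j, t j ≤ 2 := fun j => by
      rw [div_le_iff₀ hn0]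
      exact_mod_cast (by have := hν' j; omega : ν j ≤ 2 * n)
    have hcut := hA.isUniCutoff hB (fun j => by positivity : t ∈ orthant d) ht2
    have hu := huni B _ n (x ℓ) (y ℓ) hcut hn (hxj ℓ) (hyj ℓ)
    -- Along the line only the factor with index `ℓ` varies, so the others come out and a univariate
    -- kernel is left.
    have hsum : ∑ s ∈ range K, (∏ j, G j (update ν ℓ s j)) •
        A (fun j => ((update ν ℓ s j : ℕ) : ℝ) / n) =
        (∏ j ∈ univ.erase ℓ, G j (ν j)) • jetForm (α ℓ) (β ℓ) 0 0 K (x ℓ) (y ℓ)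
          (fun s => iteratedDerivWithin 0 (fun s => A (update t ℓ s)) (Set.Ici 0) ((s : ℝ) / n)) := by
      rw [jetForm, smul_sum]
      refine sum_congr rfl fun s _ => ?_
      have h1 : (fun j => ((update ν ℓ s j : ℕ) : ℝ) / n) = update t ℓ ((s : ℝ) / n) := by
        funext j
        rcases eq_or_ne j ℓ with rfl | hj
        · simp
        · simp [hj, t]
      have h2 : ∏ j ∈ univ.erase ℓ, G j (update ν ℓ s j) = ∏ j ∈ univ.erase ℓ, G j (ν j) :=
        prod_congr rfl fun j hj => by rw [update_of_ne (ne_of_mem_erase hj)]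
      rw [h1, ← mul_prod_erase univ _ (mem_univ ℓ), h2, update_self, smul_smul, mul_comm]
      simp [hG]
    rw [hsum, norm_smul, Real.norm_eq_abs, abs_prod, mul_left_comm, mul_comm]
    refine mul_le_mul hu (prod_le_prod (fun _ _ => abs_nonneg _) fun j _ => hGle j _ (hν' j))
      (prod_nonneg fun _ _ => abs_nonneg _) ?_
    exact div_nonneg (by positivity) (hw0 ℓ).le
  -- There are `K^d` lines, counted with repetition, each contributing `O(n)`; division by `K ≥ n`
  -- leaves `K^d ≤ (3n)^d`.
  have havg := sum_cube_eq_average K ℓ fun ν => (∏ j, G j (ν j)) • A fun j => ((ν j : ℕ) : ℝ) / n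
  rw [← kernel_eq_sum (fun j => by linarith [hα j]) (fun j => by linarith [hβ j]) hA.supp hn] at havg
  have hnorm : (K : ℝ) * (R * ‖kernel α β A n x y‖) ≤
      (K : ℝ) ^ d * (U * B * n / w ℓ * ∏ j ∈ univ.erase ℓ, (c j / w j)) := by
    have h1 := congrArg norm havg
    rw [norm_mul, Complex.norm_natCast] at h1
    rw [mul_left_comm, ← h1]
    calc _ ≤ R * ∑ ν ∈ Fintype.piFinset fun _ : Fin d => range K,
          ‖∑ s ∈ range K, (∏ j, G j (update ν ℓ s j)) •
            A fun j => ((update ν ℓ s j : ℕ) : ℝ) / n‖ :=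
          mul_le_mul_of_nonneg_left (norm_sum_le _ _) hR
      _ ≤ ∑ ν ∈ Fintype.piFinset fun _ : Fin d => range K,
          (U * B * n / w ℓ * ∏ j ∈ univ.erase ℓ, (c j / w j)) := by
          rw [mul_sum]
          exact sum_le_sum line
      _ = _ := by simp [Fintype.card_piFinset]
  have hK0 : (0 : ℝ) < K := by positivity
  have hnK : (n : ℝ) ≤ K := by exact_mod_cast (by omega : n ≤ K)
  have hK3 : (K : ℝ) ≤ 3 * n := by exact_mod_cast (by omega : K ≤ 3 * n)
  rw [hW]
  refine le_of_mul_le_mul_left (hnorm.trans ?_) hK0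
  rw [prod_div_distrib]
  have hPw : 0 < ∏ j ∈ univ.erase ℓ, w j := prod_pos fun j _ => hw0 j
  have := hw0 ℓ
  calc (K : ℝ) ^ d * (U * B * n / w ℓ * ((∏ j ∈ univ.erase ℓ, c j) / ∏ j ∈ univ.erase ℓ, w j))
      ≤ (3 * n) ^ d * (U * B * K / w ℓ *
        ((∏ j ∈ univ.erase ℓ, c j) / ∏ j ∈ univ.erase ℓ, w j)) := by gcongr
    _ = _ := by
      rw [mul_pow]
      field_simp

theorem exists_kernel_bound {d : ℕ} (hd : 1 ≤ d) {α β : Fin d → ℝ} (hα : ∀ j, -1 / 2 ≤ α j)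
    (hβ : ∀ j, -1 / 2 ≤ β j) {k : ℕ} (hk : 1 ≤ k) (M : Fin d → ℝ) :
    ∃ c : ℝ, 0 < c ∧ ∀ A : (Fin d → ℝ) → ℂ, IsCutoff k A →
      (∀ ℓ, ∀ t ∈ orthant d, ‖partialD ℓ (3 * k - 1) A t‖ ≤ M ℓ) →
      ∀ n : ℕ, 1 ≤ n → ∀ x ∈ Set.Icc (-1 : Fin d → ℝ) 1, ∀ y ∈ Set.Icc (-1 : Fin d → ℝ) 1,
        ‖kernel α β A n x y‖ ≤ c * (n : ℝ) ^ d / (√(bigW α β n x) * √(bigW α β n y)) *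
          (1 + n * rho x y) ^ (-(k : ℝ)) := by
  choose C hC hbound using fun ℓ => exists_tensor_bound hα hβ hk ℓ
  have hterm : ∀ ℓ, 0 ≤ C ℓ * |M ℓ| := fun ℓ => mul_nonneg (hC ℓ) (abs_nonneg _)
  refine ⟨∑ ℓ, C ℓ * |M ℓ| + 1, add_pos_of_nonneg_of_pos (sum_nonneg fun ℓ _ => hterm ℓ) one_pos,
    fun A hA hM n hn x hx y hy => ?_⟩
  have : Nonempty (Fin d) := ⟨⟨0, hd⟩⟩
  obtain ⟨ℓ, hℓ⟩ := exists_eq_ciSup_of_finite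
    (f := fun j => |Real.arccos (x j) - Real.arccos (y j)|)
  have hρ : rho x y = |Real.arccos (x ℓ) - Real.arccos (y ℓ)| := hℓ.symm
  have hpos : 0 < 1 + n * rho x y := by
    have := rho_nonneg x y
    positivity
  have h := hbound ℓ |M ℓ| A hA (fun t ht => (hM ℓ t ht).trans (le_abs_self _)) n x y hn hx hy
  rw [← hρ] at h
  rw [Real.rpow_neg hpos.le, Real.rpow_natCast, ← div_eq_mul_inv, le_div_iff₀ (pow_pos hpos k),
    mul_comm]
  refine h.trans ?_
  have hle : C ℓ * |M ℓ| ≤ ∑ ℓ, C ℓ * |M ℓ| + 1 :=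
    (single_le_sum (f := fun ℓ => C ℓ * |M ℓ|) (fun j _ => hterm j) (mem_univ ℓ)).trans
      (by linarith)
  gcongr

theorem IsAdmissible.exists_kernel_bound {d : ℕ} (hd : 1 ≤ d) {α β : Fin d → ℝ}
    (hα : ∀ j, -1 / 2 ≤ α j) (hβ : ∀ j, -1 / 2 ≤ β j) {A : (Fin d → ℝ) → ℂ}
    (hA : IsAdmissible A) {κ : ℝ} (hκ : 0 < κ) :
    ∃ c : ℝ, 0 < c ∧
      ∀ n : ℕ, 1 ≤ n → ∀ x ∈ Set.Icc (-1 : Fin d → ℝ) 1, ∀ y ∈ Set.Icc (-1 : Fin d → ℝ) 1,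
        ‖kernel α β A n x y‖ ≤ c * (n : ℝ) ^ d / (√(bigW α β n x) * √(bigW α β n y)) *
          (1 + n * rho x y) ^ (-κ) := by
  -- The integer case with exponent `⌈κ⌉₊` is stronger, because the base `1 + n * rho x y` is at
  -- least `1`.
  choose M hM using fun ℓ => hA.exists_partialD_bound ℓ (3 * ⌈κ⌉₊ - 1)
  obtain ⟨c, hc, h⟩ := TensorJacobi.exists_kernel_bound hd hα hβ (Nat.ceil_pos.mpr hκ) M
  refine ⟨c, hc, fun n hn x hx y hy => (h A (hA.isCutoff _) hM n hn x hx y hy).trans ?_⟩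
  refine mul_le_mul_of_nonneg_left ?_ (by positivity)
  have := rho_nonneg x y
  exact Real.rpow_le_rpow_of_exponent_le (by simp; positivity) (neg_le_neg (Nat.le_ceil κ))

end TensorJacobi
end

theorem mainTheorem1 (d : ℕ) (hd : 1 ≤ d) (α β : Fin d → ℝ)
    (hα : ∀ j, -(1 / 2 : ℝ) ≤ α j) (hβ : ∀ j, -(1 / 2 : ℝ) ≤ β j) :
    (∀ k : ℕ, 1 ≤ k → ∀ M : Fin d → ℝ, ∃ c : ℝ, 0 < c ∧
      ∀ A : (Fin d → ℝ) → ℂ, TensorJacobi.IsCutoff k A →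
        (∀ ℓ, ∀ t ∈ TensorJacobi.orthant d, ‖TensorJacobi.partialD ℓ (3 * k - 1) A t‖ ≤ M ℓ) →
        ∀ n : ℕ, 1 ≤ n → ∀ x ∈ Set.Icc (-1 : Fin d → ℝ) 1, ∀ y ∈ Set.Icc (-1 : Fin d → ℝ) 1,
          ‖TensorJacobi.kernel α β A n x y‖ ≤
            c * (n : ℝ) ^ d /
              (√(TensorJacobi.bigW α β n x) * √(TensorJacobi.bigW α β n y)) *
              (1 + n * TensorJacobi.rho x y) ^ (-(k : ℝ))) ∧
    (∀ A : (Fin d → ℝ) → ℂ, TensorJacobi.IsAdmissible A →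
      ∀ κ : ℝ, 0 < κ → ∃ c : ℝ, 0 < c ∧
        ∀ n : ℕ, 1 ≤ n → ∀ x ∈ Set.Icc (-1 : Fin d → ℝ) 1, ∀ y ∈ Set.Icc (-1 : Fin d → ℝ) 1,
          ‖TensorJacobi.kernel α β A n x y‖ ≤
            c * (n : ℝ) ^ d /
              (√(TensorJacobi.bigW α β n x) * √(TensorJacobi.bigW α β n y)) *
              (1 + n * TensorJacobi.rho x y) ^ (-κ)) := by
  have hα' : ∀ j, -1 / 2 ≤ α j := fun j => by linarith [hα j]
  have hβ' : ∀ j, -1 / 2 ≤ β j := fun j => by linarith [hβ j]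
  exact ⟨fun k hk M => TensorJacobi.exists_kernel_bound hd hα' hβ' hk M,
    fun A hA κ hκ => hA.exists_kernel_bound hd hα' hβ' hκ⟩
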